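/- Let $\Gamma$ be the Dynkin diagram of an irreducible simply-laced finite root system ($A_n$, $D_n$, $E_6$, $E_7$, $E_8$) or of a simply-laced affine root system ($\tilde A_n$ with $n\ge 2$, $\tilde D_n$ with $n\ge 4$, $\tilde E_6,\tilde E_7,\tilde E_8$), i.e. a connected simple graph on a finite vertex set $V$ whose Cartan matrix $2I-\mathrm{Adj}(\Gamma)$ is positive definite, respectively positive semidefinite and singular. Let $W$ be its Weyl (Coxeter) group with simple reflections $\sigma_i$ $(i\in V)$, let $\Phi^+\subset\mathbb{Z}^V$ be the set of positive real roots, $\mathrm{ht}(\alpha)=\sum_i a_i$ and $\mathbf{x}^\alpha=\prod_i x_i^{a_i}$ for $\alpha=(a_i)_i$. Let $q$ be a prime power with $q\equiv 1 \pmod 4$, and let $W$ act on $\mathbf{x}=(x_i)_{i\in V}$ by $$(\sigma_i\mathbf{x})_i=q^{-1}x_i^{-1},\qquad (\sigma_i\mathbf{x})_j=q^{1/2}x_ix_j\ (j\sim i),\qquad (\sigma_i\mathbf{x})_j=x_j\ \text{otherwise}.$$ For a function $f$ let $f^{\pm}_i(\mathbf{x})=\tfrac12\bigl(f(\mathbf{x})\pm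 f(\epsilon_i\mathbf{x})\bigr)$, where $\epsilon_i$ changes the sign of $x_j$ for all $j\sim i$, and let $$(f|\sigma_i)(\mathbf{x})=\frac{1-x_i^{-1}}{1-qx_i}\,f^+_i(\sigma_i\mathbf{x})+q^{-1/2}x_i^{-1}f^-_i(\sigma_i\mathbf{x}),\qquad f|\sigma_{i_1}\cdots\sigma_{i_\ell}=(\cdots(f|\sigma_{i_1})|\cdots)|\sigma_{i_\ell}.$$ Put $$D(\mathbf{x})=\prod_{\alpha\in\Phi^+}\bigl(1-q^{\mathrm{ht}(\alpha)+1}\mathbf{x}^{2\alpha}\bigr),\qquad \Delta(\mathbf{x})=\prod_{\alpha\in\Phi^+}\bigl(1-q^{\mathrm{ht}(\alpha)}\mathbf{x}^{2\alpha}\bigr).$$ Let $U=\mathbb{C}^V$ if $\Gamma$ is of finite type. If $\Gamma$ is of affine type, there is a least nonzero nonnegative vector $\alpha_0\in\mathbb{Z}^V$ fixed by $W$ (the imaginary root), and we let $U=\{\mathbf{x}\in\mathbb{C}^V: |\mathbf{x}^{\alpha_0}|<q^{-\mathrm{ht}(\alpha_0)/2}\}$. Then the products $D$ and $\Delta$ converge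 absolutely on $U$ to holomorphic functions, and there is a power series $Z_{\mathrm{avg}}(\mathbf{x})=\sum_{a}c_a\mathbf{x}^a\in\mathbb{C}[[x_i: i\in V]]$ with $c_0=1$ such that: 1. For each $i\in V$, writing $Z_{\mathrm{odd}}$ and $Z_{\mathrm{even}}$ for the parts of $Z_{\mathrm{avg}}$ consisting of the terms with $\sum_{j\sim i}a_j$ odd and even respectively, one has the formal identities $$Z_{\mathrm{odd}}(\sigma_i\mathbf{x})=q^{1/2}x_i\,Z_{\mathrm{odd}}(\mathbf{x}),\qquad (1-x_i^{-1})\,Z_{\mathrm{even}}(\sigma_i\mathbf{x})=(1-qx_i)\,Z_{\mathrm{even}}(\mathbf{x}),$$ understood as equalities of the coefficients of every Laurent monomial; that is, with $c_a=0$ when $a$ has a negative entry, with $c_m$ denoting the coefficient whose $i$-th index is $m$ and whose other indices are those of $a\in\mathbb{Z}^V$, and with $S=\sum_{j\sim i}a_j$: if $S$ is odd, $c_{a_i}=q^{a_i-(S-1)/2}c_{S-1-a_i}$; if $S$ is even, $c_{a_i}-q\,c_{a_i-1}=q^{a_i-S/2}\bigl(c_{S-a_i}-q\,c_{S-a_i-1}\bigr)$.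 2. $Z_{\mathrm{avg}}$ converges absolutely on a polydisc around $0$ and has meromorphic continuation to $U$. 3. $Z_{\mathrm{avg}}$ is the average over $W$: at every $\mathbf{x}\in U$ with all $x_i\ne 0$, $D(\mathbf{x})\neq 0$ and $\Delta(\mathbf{x})\ne0$, the continuation is given by the absolutely convergent sum $$Z_{\mathrm{avg}}(\mathbf{x})=\sum_{w\in W}\Delta(w\mathbf{x})^{-1}(1|w)(\mathbf{x}),$$ where $w\mathbf{x}$ and $(1|w)(\mathbf{x})$ are computed from any reduced word of $w$, independently of the choice. 4. $D\cdot Z_{\mathrm{avg}}$ is holomorphic on $U$. -/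

import Mathlib

open scoped Topology

noncomputable section

namespace WeylSeries

variable {V : Type*} [Fintype V] [DecidableEq V] (Γ : SimpleGraph V) [DecidableRel Γ.Adj]

/-- The simply-laced generalized Cartan matrix of `Γ`: `2` on the diagonal, `-1` for adjacent
vertices, `0` otherwise. -/
def cartan : Matrix V V ℝ := (2 : ℝ) • (1 : Matrix V V ℝ) - Γ.adjMatrix ℝ

/-- `Γ` is the Dynkin diagram of an irreducible simply-laced finite root system
(type `A`, `D` or `E`). -/
def IsFiniteType : Prop := Γ.Connected ∧ (cartan Γ).PosDef

/-- `Γ` is the Dynkin diagram of a simply-laced affine Kac-Moody root system: its Cartan matrix is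
indecomposable, positive semidefinite and singular. These are the extended diagrams of types
`A_n` (`n ≥ 2`, a cycle), `D_n` (`n ≥ 4`), `E_6`, `E_7` and `E_8`. -/
def IsAffineType : Prop := Γ.Connected ∧ (cartan Γ).PosSemidef ∧ (cartan Γ).det = 0

/-! ### Root system and Weyl group -/

/-- The simple reflection on the root lattice: `e_i ↦ -e_i`, `e_j ↦ e_j + e_i` for `j` adjacent
to `i`, and `e_j ↦ e_j` otherwise, in coordinates with respect to the simple roots. -/
def reflection (i : V) (α : V → ℤ) : V → ℤ :=
  Function.update α i (∑ j ∈ Γ.neighborFinset i, α j - α i)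

/-- The (real) roots: the orbit of the simple roots under the simple reflections. -/
inductive IsRoot : (V → ℤ) → Prop
  | simple (i : V) : IsRoot (Pi.single i 1)
  | reflect (i : V) (α : V → ℤ) : IsRoot α → IsRoot (reflection Γ i α)

/-- The set of positive (real) roots. -/
def posRoots : Set (V → ℤ) := {α | IsRoot Γ α ∧ 0 ≤ α}

/-- Nonzero nonnegative vectors of the root lattice fixed by the Weyl group. In affine type the
least of them is the imaginary root. -/
def invariantVectors : Set (V → ℤ) := {δ | 0 < δ ∧ ∀ i, reflection Γ i δ = δ}

/-- The height of a vector of the root lattice. -/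
def height (α : V → ℤ) : ℤ := ∑ i, α i

/-- The monomial `x ^ α`. -/
def monomial (x : V → ℂ) (α : V → ℤ) : ℂ := ∏ i, x i ^ α i

/-- The Coxeter matrix of `Γ`. -/
def coxeterMatrix : CoxeterMatrix V where
  M := Matrix.of fun i j => if i = j then 1 else if Γ.Adj i j then 3 else 2
  isSymm := by
    ext i j
    simp [Γ.adj_comm i j, eq_comm (a := i) (b := j)]
  diagonal := by simp
  off_diagonal := by
    intro i j h
    by_cases hij : Γ.Adj i j <;> simp [h, hij]

/-- The Weyl group `W` of `Γ`, as a Coxeter system. -/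
abbrev weylSystem : CoxeterSystem (coxeterMatrix Γ) (coxeterMatrix Γ).Group :=
  (coxeterMatrix Γ).toCoxeterSystem

/-! ### The formal functional equations -/

/-- The coefficients of a power series, extended by zero to all integral exponents. -/
def coeffZ (Z : MvPowerSeries V ℂ) (a : V → ℤ) : ℂ :=
  if ∀ i, 0 ≤ a i then
    MvPowerSeries.coeff (Finsupp.equivFunOnFinite.symm fun i => (a i).toNat) Z
  else 0

/-- The functional equation of a formal power series `Z` under `σ_i`. Write `Z_odd`, `Z_even` for
the parts of `Z` consisting of the terms `c_a x^a` with `S = ∑_{j ~ i} a_j` odd, respectively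
even. The equations
`Z_odd (σ_i x) = q^(1/2) x_i Z_odd (x)` and
`(1 - x_i⁻¹) Z_even (σ_i x) = (1 - q x_i) Z_even (x)`
are identities of formal Laurent expansions; comparing the coefficients of `x^a` gives the two
families of relations below. -/
def FunctionalEquation (q : ℕ) (Z : MvPowerSeries V ℂ) (i : V) : Prop :=
  ∀ a : V → ℤ,
    let S : ℤ := ∑ j ∈ Γ.neighborFinset i, a j
    let c : ℤ → ℂ := fun m => coeffZ Z (Function.update a i m)
    (Odd S → c (a i) = (q : ℂ) ^ (a i - (S - 1) / 2) * c (S - 1 - a i)) ∧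
    (Even S → c (a i) - q * c (a i - 1) =
      (q : ℂ) ^ (a i - S / 2) * (c (S - a i) - q * c (S - a i - 1)))

/-! ### The averaging construction -/

/-- The square root of `q`. -/
def sqrtq (q : ℕ) : ℂ := ((Real.sqrt (q : ℝ) : ℝ) : ℂ)

/-- The action of the simple reflection `σ_i` on the variables: `x_i ↦ q⁻¹ x_i⁻¹`, and
`x_j ↦ q^(1/2) x_i x_j` for `j` adjacent to `i`. -/
def sigma (q : ℕ) (i : V) (x : V → ℂ) : V → ℂ := fun j =>
  if j = i then (q : ℂ)⁻¹ * (x i)⁻¹ else if Γ.Adj i j then sqrtq q * x i * x j else x j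

/-- The sign change `x_j ↦ -x_j` for `j` adjacent to `i`. -/
def epsilon (i : V) (x : V → ℂ) : V → ℂ := fun j => if Γ.Adj i j then -x j else x j

/-- The part of `f` which is even in the variables adjacent to `i`. -/
def evenPart (i : V) (f : (V → ℂ) → ℂ) (x : V → ℂ) : ℂ := (f x + f (epsilon Γ i x)) / 2

/-- The part of `f` which is odd in the variables adjacent to `i`. -/
def oddPart (i : V) (f : (V → ℂ) → ℂ) (x : V → ℂ) : ℂ := (f x - f (epsilon Γ i x)) / 2

/-- The Chinta-Gunnells action `f ↦ f | σ_i`. -/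
def slash (q : ℕ) (f : (V → ℂ) → ℂ) (i : V) : (V → ℂ) → ℂ := fun x =>
  (1 - (x i)⁻¹) * (1 - q * x i)⁻¹ * evenPart Γ i f (sigma Γ q i x)
    + (sqrtq q)⁻¹ * (x i)⁻¹ * oddPart Γ i f (sigma Γ q i x)

/-- `1 | σ_{i₁} | ⋯ | σ_{i_l}` for the word `ω = [i₁, …, i_l]`. -/
def oneSlash (q : ℕ) (ω : List V) : (V → ℂ) → ℂ := ω.foldl (slash Γ q) (fun _ => 1)

/-- `σ_{i₁} (⋯ (σ_{i_l} x))` for the word `ω = [i₁, …, i_l]`. -/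
def act (q : ℕ) (ω : List V) (x : V → ℂ) : V → ℂ := ω.foldr (sigma Γ q) x

/-- The factor `1 - q^(ht α + 1) x^(2α)` of `D`. -/
def factorD (q : ℕ) (x : V → ℂ) (α : V → ℤ) : ℂ :=
  1 - (q : ℂ) ^ (height α + 1) * monomial x (2 • α)

/-- The factor `1 - q^(ht α) x^(2α)` of `Δ`. -/
def factorDelta (q : ℕ) (x : V → ℂ) (α : V → ℤ) : ℂ :=
  1 - (q : ℂ) ^ height α * monomial x (2 • α)

/-- The deformed Weyl denominator `D(x) = ∏_{α > 0} (1 - q^(ht α + 1) x^(2α))`. -/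
def weylD (q : ℕ) (x : V → ℂ) : ℂ := ∏' α : posRoots Γ, factorD q x α

/-- The undeformed Weyl denominator `Δ(x) = ∏_{α > 0} (1 - q^(ht α) x^(2α))`. -/
def weylDelta (q : ℕ) (x : V → ℂ) : ℂ := ∏' α : posRoots Γ, factorDelta q x α

/-- `F` is given on `U` by the average `∑_{w ∈ W} Δ(w x)⁻¹ (1 | w)(x)`, absolutely convergent at
every point of `U` where the coordinates, `D` and `Δ` do not vanish. (This nonvanishing excludes
the poles of all terms.) Each `w` may be written as any reduced word, so it is part of the claim
that `(1 | w)(x)` and `w x` do not depend on the chosen word. -/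
def IsAverage (q : ℕ) (U : Set (V → ℂ)) (F : (V → ℂ) → ℂ) : Prop :=
  ∀ x ∈ U, (∀ i, x i ≠ 0) → weylD Γ q x ≠ 0 → weylDelta Γ q x ≠ 0 →
    ∀ word : (coxeterMatrix Γ).Group → List V,
      (∀ w, (weylSystem Γ).IsReduced (word w) ∧ (weylSystem Γ).wordProd (word w) = w) →
      HasSum (fun w => (weylDelta Γ q (act Γ q (word w) x))⁻¹ * oneSlash Γ q (word w) x) (F x)

/-! ### Meromorphic continuation -/

/-- `F` is meromorphic on `U`: locally around every point of `U` it is a quotient `g / h` of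
holomorphic functions, where `h` is not identically zero near the point. The values of `F` at the
zeros of `h` are irrelevant. -/
def IsMeromorphicOn (F : (V → ℂ) → ℂ) (U : Set (V → ℂ)) : Prop :=
  ∀ p ∈ U, ∃ N : Set (V → ℂ), IsOpen N ∧ p ∈ N ∧ ∃ g h : (V → ℂ) → ℂ,
    DifferentiableOn ℂ g N ∧ DifferentiableOn ℂ h N ∧ (¬ ∀ᶠ x in 𝓝 p, h x = 0) ∧
    ∀ x ∈ N, h x ≠ 0 → F x = g x / h x

/-- The power series `Z` converges absolutely to `F` on a polydisc around the origin. -/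
def ConvergesNearZero (Z : MvPowerSeries V ℂ) (F : (V → ℂ) → ℂ) : Prop :=
  ∃ r : ℝ, 0 < r ∧ ∀ x : V → ℂ, (∀ i, ‖x i‖ < r) →
    HasSum (fun a : V →₀ ℕ => MvPowerSeries.coeff a Z * ∏ i, x i ^ a i) (F x)

end WeylSeries

end

open WeylSeries

/-!
Write `u_γ = q ^ (ht γ) x ^ (2 γ)` for a positive root `γ`. It is the square of the normalized
monomial `sv q x γ = q ^ (ht γ / 2) x ^ γ`, on which the Weyl group acts without any power of `q`:
`sv q (σ_i x) γ = sv q x (σ_i γ)`. Then `D = ∏ (1 - q u_γ)` and `Δ = ∏ (1 - u_γ)`.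

*The average.* A function `1 | w` has the denominator `∏ u_γ (1 - q u_γ)`, where `γ` runs over the
inversions of `w`, that is, over the positive roots which `w` makes negative, and
`Δ(w x) = ± Δ(x) ∏ u_γ⁻¹` over the same set. So `D Δ` times the average is the sum
`N = ∑ ± D ∏ u_γ (1 | w)`, whose terms are holomorphic on all of `U`, also where coordinates
vanish. The term of `w` is bounded by a constant times `∏ κ_γ` over the inversions of `w`, where
the family `κ` is summable because the normalized monomials of the positive roots are. An element
of `W` is determined by its inversions (`inversions_injective`), hence the sum over `W` is
dominated by the sum over all finite sets of positive roots, which is at most `∏ (1 + κ_γ)`. Thus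
`N` is holomorphic on `U` (`differentiableOn_numerator`). The slash operators satisfy the relations
of `W` away from the hypersurfaces `u_γ = 1` and `q u_γ = 1` (`slash_slash`, `slash_comm`,
`slash_braid`), so that nothing depends on the choice of reduced words.

*Removing `Δ`.* The average is invariant under the slash operators, which is a functional equation
for `N` (`numerator_sigma`). At a point with `u_i = 1` the two sides of this equation have opposite
signs, which forces `N = 0` there. The functional equation carries this to all hypersurfaces
`u_β = 1`. Locally only finitely many of them occur, no two of them coincide, and a holomorphic
function which vanishes on `u_β = 1` is divisible by `1 - u_β`, by Cauchy's integral formula in one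
variable. Hence `N = Δ G` with `G` holomorphic on `U` (`exists_numerator_eq_delta_mul`), and
`Z = G / D` is the continuation.

*The power series.* At the origin only `w = 1` contributes, `N = D = Δ = 1`, and `Z` has a Taylor
series there with constant term `1`. For a vertex `i`, the only factor of `D` that vanishes
somewhere on a thin polydisc `‖x i‖ ≤ 2`, `‖x j‖ ≤ δ` (`j ≠ i`) is that of the simple root `e_i`.
So `H = (1 - q s ^ 2) Z`, with `s = √q x_i`, has a Taylor series on a neighbourhood of a torus
which `σ_i` maps into the domain of convergence. The functional equation of `H` becomes an identity
of convergent Laurent series, hence a recurrence for the Laurent coefficients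
(`recurrence_of_hasSum`). It is the desired relation up to the operators `E ^ 2 - q` and
`1 - q E ^ 2` or `1 + √q E`, where `E` is the shift in the `i`-th index. The first operator is
removed because the coefficients of `H` decay, by convergence at `x_i = 1`, and the second because
of the symmetry of the relation (`eq_of_odd_recurrence`, `eq_of_even_recurrence`).

*The domain.* All of this uses of `U` only the properties collected in `IsGoodDomain`. The main one
is that the normalized monomials of the positive roots are locally uniformly summable. In finite
type there are finitely many positive roots; in affine type they lie in finitely many strings
`β + n α₀`, and `‖sv q x α₀‖ < 1` is the inequality which defines `U`.
-/

noncomputable section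

namespace WeylSeries

set_option linter.unusedSectionVars false

/-! ### Separately holomorphic functions -/

section

open Filter Asymptotics Function

variable {V : Type*} [Fintype V] [DecidableEq V]

/-- The derivative in one variable of a jointly continuous family of holomorphic functions depends
continuously on the parameter, since convergence is locally uniform. -/
theorem tendsto_deriv_of_continuousAt {X : Type*} [TopologicalSpace X] {g : X → ℂ → ℂ} {x₀ : X}
    {D : Set ℂ} (hD : IsOpen D) (hc : ∀ z ∈ D, ContinuousAt (uncurry g) (x₀, z))
    (hd : ∀ᶠ x in 𝓝 x₀, DifferentiableOn ℂ (g x) D) {z : ℂ} (hz : z ∈ D) :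
    Tendsto (fun x => deriv (g x) z) (𝓝 x₀) (𝓝 (deriv (g x₀) z)) := by
  have hu : TendstoLocallyUniformlyOn g (g x₀) (𝓝 x₀) D := by
    rw [Metric.tendstoLocallyUniformlyOn_iff]
    intro ε hε w hw
    have h1 := Metric.continuousAt_iff'.1 (hc w hw) (ε / 2) (half_pos hε)
    rw [nhds_prod_eq] at h1
    obtain ⟨P, hP, Q, hQ, hPQ⟩ := Filter.eventually_prod_iff.1 h1
    refine ⟨{y | Q y}, mem_nhdsWithin_of_mem_nhds hQ, ?_⟩
    filter_upwards [hP] with x hx y hy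
    have h2 := hPQ hx hy
    have h3 := hPQ hP.self_of_nhds hy
    simp only [uncurry] at h2 h3
    calc dist (g x₀ y) (g x y) ≤ dist (g x₀ y) (g x₀ w) + dist (g x y) (g x₀ w) :=
          dist_triangle_right _ _ _
      _ < ε := by linarith
  exact (hu.deriv hd hD).tendsto_at hz

/-- A continuous function which is holomorphic in each variable is holomorphic (Osgood): its partial
derivatives are continuous. -/
theorem differentiableOn_of_continuousOn_of_partial {f : (V → ℂ) → ℂ} {S : Set (V → ℂ)}
    (hS : IsOpen S) (hc : ContinuousOn f S)
    (hd : ∀ x ∈ S, ∀ i, DifferentiableAt ℂ (fun z => f (update x i z)) (x i)) :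
    DifferentiableOn ℂ f S := by
  intro p hp
  apply DifferentiableAt.differentiableWithinAt
  set d : V → (V → ℂ) → ℂ := fun i x => deriv (fun z => f (update x i z)) (x i) with hd_def
  have hcd : ∀ i, ContinuousAt (d i) p := by
    intro i
    obtain ⟨r, hr, hrS⟩ := Metric.isOpen_iff.1 hS p hp
    have hmem : ∀ x ∈ Metric.ball p (r / 2), ∀ w ∈ Metric.ball (0 : ℂ) (r / 2),
        update x i (x i + w) ∈ S := by
      intro x hx w hw
      apply hrS
      rw [Metric.mem_ball, dist_pi_lt_iff hr]
      intro j
      have hxj := (dist_pi_lt_iff (half_pos hr)).1 hx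
      by_cases hj : j = i
      · subst hj
        have := hxj j
        rw [mem_ball_zero_iff] at hw
        rw [update_self]
        calc dist (x j + w) (p j) = ‖(x j - p j) + w‖ := by rw [dist_eq_norm]; congr 1; ring
          _ ≤ ‖x j - p j‖ + ‖w‖ := norm_add_le _ _
          _ < r := by rw [← dist_eq_norm]; linarith
      · rw [update_of_ne hj]
        linarith [hxj j]
    have key := tendsto_deriv_of_continuousAt (x₀ := p) (D := Metric.ball (0 : ℂ) (r / 2))
      (g := fun x w => f (update x i (x i + w))) Metric.isOpen_ball ?_ ?_
      (z := 0) (Metric.mem_ball_self (half_pos hr))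
    · have e : ∀ x, d i x = deriv (fun w => f (update x i (x i + w))) 0 := by
        intro x
        have := deriv_comp_const_add (fun z => f (update x i z)) (x i) 0
        simp only [add_zero] at this
        rw [this]
      simpa only [ContinuousAt, ← e] using key
    · intro z hz
      have h1 : ContinuousAt f (update p i (p i + z)) :=
        hc.continuousAt (hS.mem_nhds (hmem p (Metric.mem_ball_self (half_pos hr)) z hz))
      have h2 : ContinuousAt (fun y : (V → ℂ) × ℂ => update y.1 i (y.1 i + y.2)) (p, z) := by
        fun_prop
      exact ContinuousAt.comp (f := fun y : (V → ℂ) × ℂ => update y.1 i (y.1 i + y.2))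
        (x := (p, z)) h1 h2
    · filter_upwards [Metric.ball_mem_nhds p (half_pos hr)] with x hx w hw
      apply DifferentiableAt.differentiableWithinAt
      have h1 := hd _ (hmem x hx w hw) i
      simp only [update_idem, update_self] at h1
      exact h1.comp w (by fun_prop)
  -- the increment of `f` is expanded one coordinate at a time, by the mean value inequality
  have claim : ∀ s : Finset V, (fun h : V → ℂ => f (p + s.piecewise h 0) - f p -
      ∑ i ∈ s, d i p * h i) =o[𝓝 0] (fun h => h) := by
    intro s
    induction s using Finset.induction_on with
    | empty => simp
    | insert i s hi ih =>
      have hpt : Tendsto (fun y : (V → ℂ) × ℂ => p + s.piecewise y.1 0 + Pi.single i y.2)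
          (𝓝 0 ×ˢ 𝓝 0) (𝓝 p) := by
        have h1 : Continuous (fun y : (V → ℂ) × ℂ => p + s.piecewise y.1 0 + Pi.single i y.2) := by
          refine continuous_pi fun j => ?_
          by_cases hj : j ∈ s
          · by_cases hji : j = i
            · subst hji; simp [hj]; fun_prop
            · simp [hj, hji]; fun_prop
          · by_cases hji : j = i
            · subst hji; simp [hj]; fun_prop
            · simp [hj, hji]; fun_prop
        have h2 := h1.tendsto (0, 0)
        rw [nhds_prod_eq] at h2
        have h3 : p + s.piecewise (0 : V → ℂ) 0 + Pi.single i (0 : ℂ) = p := by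
          ext j; by_cases hj : j ∈ s <;> simp [hj]
        simpa only [h3] using h2
      have hder : ∀ᶠ y : (V → ℂ) × ℂ in 𝓝 0 ×ˢ 𝓝 0,
          HasDerivAt (fun z => f (p + s.piecewise y.1 0 + Pi.single i z))
            (d i (p + s.piecewise y.1 0 + Pi.single i y.2)) y.2 := by
        filter_upwards [hpt (hS.mem_nhds hp)] with y hy
        have h3 := (hd _ hy i).hasDerivAt
        have h5 := HasDerivAt.comp_const_add (p i) y.2
          (f := fun z => f (update (p + s.piecewise y.1 0 + Pi.single i y.2) i z))
          (f' := d i (p + s.piecewise y.1 0 + Pi.single i y.2)) ?_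
        · refine h5.congr_of_eventuallyEq (Eventually.of_forall fun z => ?_)
          simp only
          congr 1
          ext j
          by_cases hji : j = i
          · subst hji; simp [hi]
          · simp [hji]
        · convert h3 using 1
          simp [hi]
      have hlim : Tendsto (fun y : (V → ℂ) × ℂ => d i (p + s.piecewise y.1 0 + Pi.single i y.2))
          (𝓝 0 ×ˢ 𝓝 0) (𝓝 (d i p)) := (hcd i).tendsto.comp hpt
      have h1 : (fun h : V → ℂ => f (p + s.piecewise h 0 + Pi.single i (h i)) -
          f (p + s.piecewise h 0) - d i p * h i) =o[𝓝 0] (fun h => h) := by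
        rw [isLittleO_iff]
        intro ε hε
        have h2 := hder.and (hlim (Metric.closedBall_mem_nhds _ hε))
        obtain ⟨P, hP, Q, hQ, hPQ⟩ := Filter.eventually_prod_iff.1 h2
        obtain ⟨η, hη, hQη⟩ := Metric.eventually_nhds_iff_ball.1 hQ
        filter_upwards [hP, Metric.ball_mem_nhds 0 hη] with h hh hhη
        have hhi : ‖h i‖ < η := (norm_le_pi_norm h i).trans_lt (mem_ball_zero_iff.1 hhη)
        have hb := Convex.norm_image_sub_le_of_norm_hasDerivWithin_le (𝕜 := ℂ)
          (s := Metric.ball (0 : ℂ) η) (C := ε) (x := 0) (y := h i)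
          (f := fun z => f (p + s.piecewise h 0 + Pi.single i z) - d i p * z)
          (f' := fun z => d i (p + s.piecewise h 0 + Pi.single i z) - d i p)
          (fun z hz => ?_) (fun z hz => ?_) (convex_ball _ _) (Metric.mem_ball_self hη)
          (mem_ball_zero_iff.2 hhi)
        · simp only [Pi.single_zero, add_zero, mul_zero, sub_zero] at hb
          calc _ = ‖f (p + s.piecewise h 0 + Pi.single i (h i)) - d i p * h i -
                f (p + s.piecewise h 0)‖ := by congr 1; ring
            _ ≤ ε * ‖h i‖ := hb
            _ ≤ ε * ‖h‖ := by gcongr; exact norm_le_pi_norm h i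
        · have := ((hPQ hh (hQη z hz)).1.fun_sub ((hasDerivAt_id z).const_mul (d i p)))
          simpa using this.hasDerivWithinAt
        · have := (hPQ hh (hQη z hz)).2
          simpa [dist_eq_norm] using this
      refine (h1.add ih).congr_left fun h => ?_
      have e : p + (insert i s).piecewise h 0 = p + s.piecewise h 0 + Pi.single i (h i) := by
        ext j
        by_cases hji : j = i
        · subst hji; simp [hi]
        · simp [hji, Finset.piecewise]
      rw [Finset.sum_insert hi, e]
      ring
  have h := claim Finset.univ
  refine ⟨∑ i, d i p • ContinuousLinearMap.proj i, ?_⟩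
  rw [hasFDerivAt_iff_isLittleO_nhds_zero]
  refine h.congr_left fun v => ?_
  simp

end

/-! ### Limits, products and parameter integrals of holomorphic functions -/

section

open Filter Asymptotics Function

variable {V : Type*} [Fintype V] [DecidableEq V]

omit [Fintype V] in
theorem isOpen_update_preimage {S : Set (V → ℂ)} (hS : IsOpen S) (x : V → ℂ) (i : V) :
    IsOpen {z | update x i z ∈ S} :=
  (continuous_const.update i continuous_id).isOpen_preimage _ hS

/-- The restriction of a holomorphic function to a line parallel to a coordinate axis. -/
theorem differentiableAt_slice {f : (V → ℂ) → ℂ} {S : Set (V → ℂ)} (hS : IsOpen S)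
    (hf : DifferentiableOn ℂ f S) (x : V → ℂ) (i : V) {z : ℂ} (hz : update x i z ∈ S) :
    DifferentiableAt ℂ (fun z => f (update x i z)) z :=
  DifferentiableAt.comp (f := fun z => update x i z) z (hf.differentiableAt (hS.mem_nhds hz))
    (hasFDerivAt_update x z).differentiableAt

/-- The several variables version of the theorem of Weierstrass. -/
theorem differentiableOn_of_tendstoLocallyUniformlyOn {ι : Type*} {F : ι → (V → ℂ) → ℂ}
    {f : (V → ℂ) → ℂ} {S : Set (V → ℂ)} {φ : Filter ι} [φ.NeBot] (hS : IsOpen S)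
    (hf : TendstoLocallyUniformlyOn F f φ S) (hF : ∀ n, DifferentiableOn ℂ (F n) S) :
    DifferentiableOn ℂ f S := by
  refine differentiableOn_of_continuousOn_of_partial hS
    (hf.continuousOn (Eventually.of_forall fun n => (hF n).continuousOn).frequently) ?_
  intro x hx i
  have hD := isOpen_update_preimage hS x i
  have h1 : TendstoLocallyUniformlyOn (fun n z => F n (update x i z))
      (fun z => f (update x i z)) φ {z | update x i z ∈ S} :=
    hf.comp (fun z => update x i z) (fun z hz => hz)
      (by fun_prop : Continuous fun z => update x i z).continuousOn
  have h2 := h1.differentiableOn (Eventually.of_forall fun n z hz =>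
    (differentiableAt_slice hS (hF n) x i hz).differentiableWithinAt) hD
  exact h2.differentiableAt (hD.mem_nhds (by simpa using hx))

theorem differentiableOn_tsum {ι : Type*} {F : ι → (V → ℂ) → ℂ} {S : Set (V → ℂ)} (hS : IsOpen S)
    (hF : ∀ n, DifferentiableOn ℂ (F n) S)
    (hb : ∀ p ∈ S, ∃ N ∈ 𝓝 p, ∃ u : ι → ℝ, Summable u ∧ ∀ n, ∀ x ∈ N, ‖F n x‖ ≤ u n) :
    DifferentiableOn ℂ (fun x => ∑' n, F n x) S := by
  intro p hp
  obtain ⟨N, hN, u, hu, hbd⟩ := hb p hp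
  have ho : IsOpen (interior N ∩ S) := isOpen_interior.inter hS
  have h := differentiableOn_of_tendstoLocallyUniformlyOn ho
    (tendstoUniformlyOn_tsum hu (fun n x hx => hbd n x (interior_subset hx.1))
      ).tendstoLocallyUniformlyOn
    (fun s => DifferentiableOn.fun_sum fun n _ => (hF n).mono Set.inter_subset_right)
  exact (h.differentiableAt (ho.mem_nhds ⟨mem_interior_iff_mem_nhds.2 hN, hp⟩)
    ).differentiableWithinAt

omit [DecidableEq V] in
theorem differentiableOn_finset_prod {ι : Type*} {F : ι → (V → ℂ) → ℂ} {S : Set (V → ℂ)}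
    (s : Finset ι) (hF : ∀ n ∈ s, DifferentiableOn ℂ (F n) S) :
    DifferentiableOn ℂ (fun x => ∏ n ∈ s, F n x) S := by
  classical
  induction s using Finset.induction_on with
  | empty => simp
  | insert i s hi ih =>
    simp only [Finset.prod_insert hi]
    exact (hF i (Finset.mem_insert_self i s)).mul
      (ih fun n hn => hF n (Finset.mem_insert_of_mem hn))

theorem differentiableOn_tprod_one_add {ι : Type*} {F : ι → (V → ℂ) → ℂ} {S : Set (V → ℂ)}
    (hS : IsOpen S) (hF : ∀ n, DifferentiableOn ℂ (F n) S)
    (hb : ∀ p ∈ S, ∃ N ∈ 𝓝 p, ∃ u : ι → ℝ, Summable u ∧ ∀ n, ∀ x ∈ N, ‖F n x‖ ≤ u n) :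
    DifferentiableOn ℂ (fun x => ∏' n, (1 + F n x)) S := by
  intro p hp
  obtain ⟨N, hN, u, hu, hbd⟩ := hb p hp
  obtain ⟨r, hr, hrN⟩ := Metric.nhds_basis_closedBall.mem_iff.1
    (Filter.inter_mem hN (hS.mem_nhds hp))
  have h0 := Summable.hasProdUniformlyOn_one_add (isCompact_closedBall p r) hu
    (Eventually.of_forall fun n x hx => hbd n x (hrN hx).1)
    (fun n => (hF n).continuousOn.mono fun x hx => (hrN hx).2)
  rw [hasProdUniformlyOn_iff_tendstoUniformlyOn] at h0
  have h := differentiableOn_of_tendstoLocallyUniformlyOn Metric.isOpen_ball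
    ((h0.mono Metric.ball_subset_closedBall).tendstoLocallyUniformlyOn)
    (fun s => differentiableOn_finset_prod s fun n _ => DifferentiableOn.const_add _
      ((hF n).mono fun x hx => (hrN (Metric.ball_subset_closedBall hx)).2))
  exact (h.differentiableAt (Metric.isOpen_ball.mem_nhds (Metric.mem_ball_self hr))
    ).differentiableWithinAt

theorem differentiableOn_intervalIntegral {g : (V → ℂ) → ℝ → ℂ} {S : Set (V → ℂ)} (hS : IsOpen S)
    (a b : ℝ) (hc : ContinuousOn (uncurry g) (S ×ˢ Set.univ))
    (hd : ∀ θ, DifferentiableOn ℂ (fun x => g x θ) S) :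
    DifferentiableOn ℂ (fun x => ∫ θ in a..b, g x θ) S := by
  have hopen : IsOpen (S ×ˢ (Set.univ : Set ℝ)) := hS.prod isOpen_univ
  have hcθ : ∀ x ∈ S, Continuous (g x) := fun x hx => by
    rw [← continuousOn_univ]
    exact hc.comp (Continuous.prodMk_right x).continuousOn fun θ _ => ⟨hx, trivial⟩
  have hbd : ∀ p ∈ S, ∃ r > 0, ∃ C, Metric.closedBall p r ⊆ S ∧
      ∀ x ∈ Metric.closedBall p r, ∀ θ ∈ Set.uIcc a b, ‖g x θ‖ ≤ C := by
    intro p hp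
    obtain ⟨r, hr, hrS⟩ := Metric.nhds_basis_closedBall.mem_iff.1 (hS.mem_nhds hp)
    obtain ⟨C, hC⟩ := ((isCompact_closedBall p r).prod (isCompact_uIcc (a := a) (b := b))
      ).exists_bound_of_continuousOn (hc.mono (Set.prod_mono hrS (Set.subset_univ _)))
    exact ⟨r, hr, C, hrS, fun x hx θ hθ => hC (x, θ) ⟨hx, hθ⟩⟩
  refine differentiableOn_of_continuousOn_of_partial hS ?_ ?_
  · intro p hp
    apply ContinuousAt.continuousWithinAt
    obtain ⟨r, hr, C, hrS, hC⟩ := hbd p hp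
    refine intervalIntegral.continuousAt_of_dominated_interval (bound := fun _ => C) ?_ ?_ ?_ ?_
    · filter_upwards [hS.mem_nhds hp] with x hx using (hcθ x hx).aestronglyMeasurable
    · filter_upwards [Metric.closedBall_mem_nhds p hr] with x hx
      exact Eventually.of_forall fun θ hθ => hC x hx θ (Set.uIoc_subset_uIcc hθ)
    · simp
    · exact Eventually.of_forall fun θ _ => (hd θ).continuousOn.continuousAt (hS.mem_nhds hp)
  · intro p hp i
    obtain ⟨r, hr, C, hrS, hC⟩ := hbd p hp
    have hmem : ∀ z ∈ Metric.closedBall (p i) r, update p i z ∈ Metric.closedBall p r := by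
      intro z hz
      rw [Metric.mem_closedBall, dist_pi_le_iff hr.le]
      intro j
      by_cases hj : j = i
      · subst hj; simpa using hz
      · simp [hj, hr.le]
    have hball : ∀ z ∈ Metric.ball (p i) (r / 2), ∀ w ∈ Metric.closedBall z (r / 2),
        w ∈ Metric.closedBall (p i) r := by
      intro z hz w hw
      rw [Metric.mem_closedBall] at *
      rw [Metric.mem_ball] at hz
      linarith [dist_triangle w z (p i)]
    have hsl : ∀ θ, ∀ z ∈ Metric.closedBall (p i) r,
        DifferentiableAt ℂ (fun z => g (update p i z) θ) z := fun θ z hz =>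
      differentiableAt_slice hS (hd θ) p i (hrS (hmem z hz))
    have key := intervalIntegral.hasDerivAt_integral_of_dominated_loc_of_deriv_le
      (𝕜 := ℂ) (μ := MeasureTheory.volume) (a := a) (b := b)
      (F := fun z θ => g (update p i z) θ) (x₀ := p i) (s := Metric.ball (p i) (r / 2))
      (F' := fun z θ => deriv (fun z => g (update p i z) θ) z) (bound := fun _ => C / (r / 2))
      (Metric.ball_mem_nhds _ (half_pos hr)) ?_ ?_ ?_ ?_ ?_ ?_
    · exact key.2.differentiableAt
    · filter_upwards [Metric.closedBall_mem_nhds (p i) hr] with z hz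
      exact (hcθ _ (hrS (hmem z hz))).aestronglyMeasurable
    · exact (hcθ _ (by simpa using hp)).intervalIntegrable _ _
    · refine (continuous_iff_continuousAt.2 fun θ => ?_).aestronglyMeasurable
      refine tendsto_deriv_of_continuousAt (g := fun θ z => g (update p i z) θ)
        (D := Metric.ball (p i) r) Metric.isOpen_ball ?_ ?_ (Metric.mem_ball_self hr)
      · intro z hz
        have h1 : ContinuousAt (uncurry g) (update p i z, θ) := hc.continuousAt
          (hopen.mem_nhds ⟨hrS (hmem z (Metric.ball_subset_closedBall hz)), trivial⟩)
        have h2 : ContinuousAt (fun y : ℝ × ℂ => (update p i y.2, y.1)) (θ, z) := by fun_prop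
        exact ContinuousAt.comp (f := fun y : ℝ × ℂ => (update p i y.2, y.1)) (x := (θ, z)) h1 h2
      · exact Eventually.of_forall fun θ z hz =>
          (hsl θ z (Metric.ball_subset_closedBall hz)).differentiableWithinAt
    · refine Eventually.of_forall fun θ hθ z hz => ?_
      refine Complex.norm_deriv_le_of_forall_mem_sphere_norm_le (half_pos hr) ?_ ?_
      · refine DifferentiableOn.diffContOnCl fun w hw => ?_
        rw [closure_ball _ (half_pos hr).ne'] at hw
        exact (hsl θ w (hball z hz w hw)).differentiableWithinAt
      · intro w hw
        exact hC _ (hmem w (hball z hz w (Metric.sphere_subset_closedBall hw))) θ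
          (Set.uIoc_subset_uIcc hθ)
    · simp
    · refine Eventually.of_forall fun θ hθ z hz => ?_
      exact (hsl θ z (hball z hz z (Metric.mem_closedBall_self (half_pos hr).le))).hasDerivAt

end

/-! ### Division of holomorphic functions -/

section

open Filter Asymptotics Function

variable {V : Type*} [Fintype V] [DecidableEq V]

/-- A point has a basis of neighbourhoods in which any single coordinate may be changed freely. -/
theorem exists_ball_update_mem {p : V → ℂ} {N : Set (V → ℂ)} (hN : N ∈ 𝓝 p) :
    ∃ r > 0, Metric.ball p r ⊆ N ∧ ∀ x ∈ Metric.ball p r, ∀ i, ∀ z ∈ Metric.ball (p i) r,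
      update x i z ∈ Metric.ball p r := by
  obtain ⟨r, hr, hrN⟩ := Metric.mem_nhds_iff.1 hN
  refine ⟨r, hr, hrN, fun x hx i z hz => ?_⟩
  rw [Metric.mem_ball, dist_pi_lt_iff hr] at *
  intro j
  by_cases hj : j = i
  · subst hj; simpa using hz
  · simpa [hj] using hx j

/-- Division of `G` by `x i - θ x` near a point of the graph `x i = θ x`, on which `G` vanishes. By
Cauchy's formula the quotient is `(2πi)⁻¹ ∮ G(z) (z - x i)⁻¹ (z - θ x)⁻¹ dz`, where `z` replaces the
coordinate `x i`, and this expression is holomorphic in `x`. -/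
theorem exists_eq_sub_mul_of_vanish {p : V → ℂ} {i : V} {G θ : (V → ℂ) → ℂ} {N : Set (V → ℂ)}
    (hN : N ∈ 𝓝 p) (hG : DifferentiableOn ℂ G N) (hθ : DifferentiableOn ℂ θ N) (hp : θ p = p i)
    (hv : ∀ x ∈ N, update x i (θ x) ∈ N → G (update x i (θ x)) = 0) :
    ∃ N' ∈ 𝓝 p, N' ⊆ N ∧ IsOpen N' ∧ ∃ H : (V → ℂ) → ℂ, DifferentiableOn ℂ H N' ∧
      ∀ x ∈ N', G x = (x i - θ x) * H x := by
  obtain ⟨r, hr, hrN, hupd⟩ := exists_ball_update_mem hN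
  have hGb := hG.mono hrN
  have hθb := hθ.mono hrN
  set ρ := r / 2 with hρ
  have hρ0 : 0 < ρ := half_pos hr
  set N' : Set (V → ℂ) := Metric.ball p ρ ∩ (Metric.ball p r ∩ θ ⁻¹' Metric.ball (p i) ρ) with hN'
  have hsub : N' ⊆ Metric.ball p r := fun x hx => hx.2.1
  have hN'o : IsOpen N' := Metric.isOpen_ball.inter
    (hθb.continuousOn.isOpen_inter_preimage Metric.isOpen_ball Metric.isOpen_ball)
  have hpN' : p ∈ N' := ⟨Metric.mem_ball_self hρ0, Metric.mem_ball_self hr, by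
    simp [hp, hρ0]⟩
  have hxi : ∀ x ∈ N', x i ∈ Metric.ball (p i) ρ := fun x hx =>
    (dist_pi_lt_iff hρ0).1 hx.1 i
  have hsph : ∀ z ∈ Metric.closedBall (p i) ρ, z ∈ Metric.ball (p i) r := fun z hz =>
    Metric.closedBall_subset_ball (by rw [hρ]; linarith) hz
  have hne : ∀ w ∈ Metric.ball (p i) ρ, ∀ t : ℝ, circleMap (p i) ρ t - w ≠ 0 := by
    intro w hw t h
    have h1 := circleMap_mem_sphere (p i) hρ0.le t
    rw [sub_eq_zero.1 h, Metric.mem_sphere] at h1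
    exact (Metric.mem_ball.1 hw).ne h1
  have hcm : ∀ t, circleMap (p i) ρ t ∈ Metric.closedBall (p i) ρ := fun t =>
    Metric.sphere_subset_closedBall (circleMap_mem_sphere (p i) hρ0.le t)
  refine ⟨N', hN'o.mem_nhds hpN', hsub.trans hrN, hN'o, fun x => (2 * Real.pi * Complex.I)⁻¹ *
    ∮ z in C(p i, ρ), (z - x i)⁻¹ * ((z - θ x)⁻¹ * G (update x i z)), ?_, ?_⟩
  · refine DifferentiableOn.const_mul ?_ _
    simp only [circleIntegral]
    apply differentiableOn_intervalIntegral hN'o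
    · have h1 : ContinuousOn (fun y : (V → ℂ) × ℝ => G (update y.1 i (circleMap (p i) ρ y.2)))
          (N' ×ˢ Set.univ) := by
        refine hGb.continuousOn.comp (f := fun y : (V → ℂ) × ℝ =>
          update y.1 i (circleMap (p i) ρ y.2)) ?_ ?_
        · have := continuous_circleMap (p i) ρ
          exact (by fun_prop : Continuous fun y : (V → ℂ) × ℝ =>
            update y.1 i (circleMap (p i) ρ y.2)).continuousOn
        · rintro ⟨x, t⟩ ⟨hx, -⟩
          exact hupd x (hsub hx) i _ (hsph _ (hcm t))
      have h2 : ContinuousOn (fun y : (V → ℂ) × ℝ => θ y.1) (N' ×ˢ Set.univ) :=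
        (hθb.continuousOn.mono hsub).comp continuous_fst.continuousOn fun y hy => hy.1
      have hcc := continuous_circleMap (p i) ρ
      have hcc' : Continuous (deriv (circleMap (p i) ρ)) := by
        have : deriv (circleMap (p i) ρ) = fun t => circleMap 0 ρ t * Complex.I := by
          ext t; simp
        rw [this]
        exact (continuous_circleMap 0 ρ).mul continuous_const
      simp only [smul_eq_mul]
      refine ContinuousOn.mul (by fun_prop) (ContinuousOn.mul (ContinuousOn.inv₀ (by fun_prop) ?_)
        (ContinuousOn.mul (ContinuousOn.inv₀
          ((hcc.comp continuous_snd).continuousOn.sub h2) ?_) h1))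
      · rintro ⟨x, t⟩ ⟨hx, -⟩
        exact hne _ (hxi x hx) t
      · rintro ⟨x, t⟩ ⟨hx, -⟩
        exact hne _ hx.2.2 t
    · intro t
      simp only [smul_eq_mul]
      refine DifferentiableOn.const_mul (DifferentiableOn.mul (DifferentiableOn.inv ?_ ?_)
        (DifferentiableOn.mul (DifferentiableOn.inv ?_ ?_) ?_)) _
      · fun_prop
      · intro x hx; exact hne _ (hxi x hx) t
      · exact DifferentiableOn.const_sub (hθb.mono hsub) _
      · intro x hx; exact hne _ hx.2.2 t
      · refine hGb.comp (f := fun x => update x i (circleMap (p i) ρ t)) ?_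
          fun x hx => hupd x (hsub hx) i _ (hsph _ (hcm t))
        refine (differentiable_pi.2 fun j => ?_ :
          Differentiable ℂ fun x : V → ℂ => update x i (circleMap (p i) ρ t)).differentiableOn
        by_cases hj : j = i
        · subst hj; simp
        · simp only [update_of_ne hj]; fun_prop
  · intro x hx
    have hGsl : DiffContOnCl ℂ (fun z => G (update x i z)) (Metric.ball (p i) ρ) := by
      apply DifferentiableOn.diffContOnCl
      rw [closure_ball _ hρ0.ne']
      intro z hz
      exact (differentiableAt_slice Metric.isOpen_ball hGb x i
        (hupd x (hsub hx) i _ (hsph _ hz))).differentiableWithinAt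
    have hθv : G (update x i (θ x)) = 0 := hv x (hrN (hsub hx)) (hrN (hupd x (hsub hx) i _
      (hsph _ (Metric.ball_subset_closedBall hx.2.2))))
    -- partial fractions reduce the integral to two values of `G`, the second of which is zero
    have hA := hGsl.circleIntegral_sub_inv_smul (hxi x hx)
    have hB := hGsl.circleIntegral_sub_inv_smul (w := θ x) hx.2.2
    simp only [update_eq_self, smul_eq_mul] at hA
    simp only [hθv, smul_eq_mul, mul_zero] at hB
    by_cases he : x i = θ x
    · rw [he, sub_self, zero_mul]
      rw [← he] at hθv; simpa using hθv
    · have he' : x i - θ x ≠ 0 := sub_ne_zero.2 he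
      have hint : ∀ w ∈ Metric.ball (p i) ρ,
          CircleIntegrable (fun z => (z - w)⁻¹ * G (update x i z)) (p i) ρ := by
        intro w hw
        refine ContinuousOn.circleIntegrable hρ0.le (ContinuousOn.mul (ContinuousOn.inv₀
          (by fun_prop) ?_) ?_)
        · intro z hz h
          rw [sub_eq_zero.1 h] at hz
          exact (Metric.mem_ball.1 hw).ne hz
        · have := hGsl.continuousOn
          rw [closure_ball _ hρ0.ne'] at this
          exact this.mono Metric.sphere_subset_closedBall
      have e : (∮ z in C(p i, ρ), (z - x i)⁻¹ * ((z - θ x)⁻¹ * G (update x i z))) =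
          (x i - θ x)⁻¹ * (∮ z in C(p i, ρ), ((z - x i)⁻¹ * G (update x i z) -
            (z - θ x)⁻¹ * G (update x i z))) := by
        rw [← circleIntegral.integral_const_mul]
        refine circleIntegral.integral_congr hρ0.le fun z hz => ?_
        have h1 : z - x i ≠ 0 := fun h => by
          rw [sub_eq_zero.1 h] at hz
          exact (Metric.mem_ball.1 (hxi x hx)).ne hz
        have h2 : z - θ x ≠ 0 := fun h => by
          rw [sub_eq_zero.1 h] at hz
          exact (Metric.mem_ball.1 hx.2.2).ne hz
        field_simp
        ring
      beta_reduce
      rw [e, circleIntegral.integral_sub (hint _ (hxi x hx)) (hint _ hx.2.2), hA, hB]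
      have := Complex.two_pi_I_ne_zero
      field_simp
      ring

/-- Division by `1 - u`, where `u` is a monomial in the variable `x i` up to a factor which is
independent of it. With an `n`-th root `r` of `u` near `p`, the hypersurface `u = 1` is the graph
`x i = x i / r x` there, whose right-hand side does not depend on `x i`. -/
theorem exists_eq_one_sub_mul_of_vanish {p : V → ℂ} {i : V} {n : ℕ} (hn : n ≠ 0)
    {G u : (V → ℂ) → ℂ} {N : Set (V → ℂ)} (hN : N ∈ 𝓝 p) (hG : DifferentiableOn ℂ G N)
    (hu : DifferentiableOn ℂ u N) (hp : u p = 1) (hpi : p i ≠ 0)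
    (hui : ∀ x z, u (update x i (x i * z)) = z ^ n * u x)
    (hv : ∀ x ∈ N, u x = 1 → G x = 0) :
    ∃ N' ∈ 𝓝 p, N' ⊆ N ∧ IsOpen N' ∧ ∃ H : (V → ℂ) → ℂ, DifferentiableOn ℂ H N' ∧
      ∀ x ∈ N', G x = (1 - u x) * H x := by
  obtain ⟨N₁, hN₁N, hN₁o, hpN₁⟩ := mem_nhds_iff.1 hN
  set N₂ : Set (V → ℂ) := N₁ ∩ u ⁻¹' Complex.slitPlane with hN₂
  have hN₂o : IsOpen N₂ := (hu.mono hN₁N).continuousOn.isOpen_inter_preimage hN₁o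
    Complex.isOpen_slitPlane
  have hpN₂ : p ∈ N₂ := ⟨hpN₁, by simp [hp]⟩
  set r : (V → ℂ) → ℂ := fun x => u x ^ ((n : ℂ)⁻¹) with hr
  have hrn : ∀ x, r x ^ n = u x := fun x => Complex.cpow_nat_inv_pow _ hn
  have hrp : r p = 1 := by simp [hr, hp]
  have hrd : DifferentiableOn ℂ r N₂ := fun x hx =>
    ((hu.mono hN₁N).mono Set.inter_subset_left x hx).cpow
      (differentiableWithinAt_const _) hx.2
  -- `1 - u = (1 - r) g`, where `g` does not vanish at `p`
  set g : (V → ℂ) → ℂ := fun x => ∑ k ∈ Finset.range n, r x ^ k with hg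
  have hgd : DifferentiableOn ℂ g N₂ := DifferentiableOn.fun_sum fun k _ => hrd.pow k
  have hgp : g p ≠ 0 := by simp [hg, hrp, hn]
  set N₃ : Set (V → ℂ) := N₂ ∩ (fun x => r x * g x * x i) ⁻¹' {0}ᶜ with hN₃
  have hd3 : DifferentiableOn ℂ (fun x => r x * g x * x i) N₂ := (hrd.mul hgd).mul (by fun_prop)
  have hN₃o : IsOpen N₃ := hd3.continuousOn.isOpen_inter_preimage hN₂o isOpen_compl_singleton
  have hpN₃ : p ∈ N₃ := ⟨hpN₂, by simp [hrp, hgp, hpi]⟩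
  have hN₃N : N₃ ⊆ N := fun x hx => hN₁N hx.1.1
  have hr0 : ∀ x ∈ N₃, r x ≠ 0 ∧ g x ≠ 0 ∧ x i ≠ 0 := fun x hx => by
    have := hx.2
    simp only [Set.mem_preimage, Set.mem_compl_iff, Set.mem_singleton_iff, mul_eq_zero,
      not_or] at this
    tauto
  obtain ⟨N', hN', hN'N₃, hN'o, H, hH, hGH⟩ := exists_eq_sub_mul_of_vanish
    (G := G) (θ := fun x => x i * (r x)⁻¹) (i := i) (hN₃o.mem_nhds hpN₃) (hG.mono hN₃N)
    (DifferentiableOn.mul (by fun_prop) (DifferentiableOn.inv (hrd.mono fun x hx => hx.1)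
      fun x hx => (hr0 x hx).1)) (by simp [hrp]) (by
        intro x hx hx'
        refine hv _ (hN₃N hx') ?_
        rw [hui, inv_pow, hrn, inv_mul_cancel₀]
        rw [← hrn]
        exact pow_ne_zero _ (hr0 x hx).1)
  refine ⟨N', hN', hN'N₃.trans hN₃N, hN'o, fun x => -(x i) * (r x)⁻¹ * (g x)⁻¹ * H x, ?_, ?_⟩
  · refine DifferentiableOn.mul (DifferentiableOn.mul (DifferentiableOn.mul (by fun_prop)
      (DifferentiableOn.inv (hrd.mono fun x hx => (hN'N₃ hx).1) fun x hx => (hr0 x (hN'N₃ hx)).1))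
      (DifferentiableOn.inv (hgd.mono fun x hx => (hN'N₃ hx).1)
        fun x hx => (hr0 x (hN'N₃ hx)).2.1)) hH
  · intro x hx
    obtain ⟨h1, h2, h3⟩ := hr0 x (hN'N₃ hx)
    have h4 : 1 - u x = (1 - r x) * g x := by
      rw [← hrn, hg]; exact (mul_neg_geom_sum (r x) n).symm
    rw [hGH x hx, h4]
    field_simp
    ring

end

/-! ### Taylor series on polydiscs -/

section

open Filter Asymptotics Function

variable {V : Type*} [Fintype V] [DecidableEq V]

theorem summable_prod_pow {r : V → ℝ} (h0 : ∀ i, 0 ≤ r i) (h1 : ∀ i, r i < 1) :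
    Summable fun a : V → ℕ => ∏ i, r i ^ a i := by
  refine summable_of_sum_le (c := ∏ i, (1 - r i)⁻¹)
    (fun a => Finset.prod_nonneg fun i _ => pow_nonneg (h0 i) _) fun T => ?_
  obtain ⟨N, hN⟩ : ∃ N, ∀ a ∈ T, ∀ i, a i < N := by
    refine ⟨T.sup (fun a => Finset.univ.sup a) + 1, fun a ha i => Nat.lt_succ_of_le ?_⟩
    exact (Finset.le_sup (f := a) (Finset.mem_univ i)).trans
      (Finset.le_sup (f := fun a : V → ℕ => Finset.univ.sup a) ha)
  calc ∑ a ∈ T, ∏ i, r i ^ a i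
      ≤ ∑ a ∈ Fintype.piFinset fun _ : V => Finset.range N, ∏ i, r i ^ a i := by
        refine Finset.sum_le_sum_of_subset_of_nonneg (fun a ha => ?_)
          fun a _ _ => Finset.prod_nonneg fun i _ => pow_nonneg (h0 i) _
        rw [Fintype.mem_piFinset]
        exact fun i => Finset.mem_range.2 (hN a ha i)
    _ = ∏ i, ∑ k ∈ Finset.range N, r i ^ k :=
        (Finset.prod_univ_sum (fun _ : V => Finset.range N) (fun i k => r i ^ k)).symm
    _ ≤ ∏ i, (1 - r i)⁻¹ := by
        refine Finset.prod_le_prod (fun i _ => Finset.sum_nonneg fun k _ => pow_nonneg (h0 i) _)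
          fun i _ => ?_
        rw [← tsum_geometric_of_lt_one (h0 i) (h1 i)]
        exact (summable_geometric_of_lt_one (h0 i) (h1 i)).sum_le_tsum _
          fun k _ => pow_nonneg (h0 i) _

/-- The Taylor coefficients in the variable `x i`, given by Cauchy's integral formula. -/
def partialTaylorCoeff (ρ : ℝ) (i : V) (m : ℕ) (f : (V → ℂ) → ℂ) (x : V → ℂ) : ℂ :=
  (2 * Real.pi * Complex.I)⁻¹ * ∮ z in C(0, ρ), (z ^ (m + 1))⁻¹ * f (update x i z)

theorem differentiableOn_partialTaylorCoeff {R : V → ℝ} {f : (V → ℂ) → ℂ}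
    (hf : DifferentiableOn ℂ f {x | ∀ i, ‖x i‖ < R i}) {ρ : ℝ} (hρ : 0 < ρ) {i : V}
    (hρR : ρ < R i) (m : ℕ) :
    DifferentiableOn ℂ (partialTaylorCoeff ρ i m f) {x | ∀ i, ‖x i‖ < R i} := by
  have hS : IsOpen {x : V → ℂ | ∀ i, ‖x i‖ < R i} := by
    rw [Set.ofPred_forall]
    exact isOpen_iInter_of_finite fun i => isOpen_lt (by fun_prop) continuous_const
  have hmem : ∀ x ∈ {x : V → ℂ | ∀ i, ‖x i‖ < R i}, ∀ t,
      update x i (circleMap 0 ρ t) ∈ {x : V → ℂ | ∀ i, ‖x i‖ < R i} := by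
    intro x hx t j
    by_cases hj : j = i
    · subst hj; simp [abs_of_pos hρ, hρR]
    · simpa [hj] using hx j
  have hcc := continuous_circleMap 0 ρ
  refine DifferentiableOn.const_mul ?_ _
  simp only [circleIntegral]
  apply differentiableOn_intervalIntegral hS
  · have h1 : ContinuousOn (fun y : (V → ℂ) × ℝ => f (update y.1 i (circleMap 0 ρ y.2)))
        ({x : V → ℂ | ∀ i, ‖x i‖ < R i} ×ˢ Set.univ) := by
      refine hf.continuousOn.comp (f := fun y : (V → ℂ) × ℝ =>
        update y.1 i (circleMap 0 ρ y.2)) ?_ ?_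
      · exact (by fun_prop : Continuous fun y : (V → ℂ) × ℝ =>
          update y.1 i (circleMap 0 ρ y.2)).continuousOn
      · rintro ⟨x, t⟩ ⟨hx, -⟩
        exact hmem x hx t
    have hcc' : Continuous (deriv (circleMap 0 ρ)) := by
      have : deriv (circleMap 0 ρ) = fun t => circleMap 0 ρ t * Complex.I := by
        ext t; simp
      rw [this]
      exact (continuous_circleMap 0 ρ).mul continuous_const
    simp only [smul_eq_mul]
    refine ContinuousOn.mul (by fun_prop) (ContinuousOn.mul (ContinuousOn.inv₀
        (by fun_prop) ?_) h1)
    rintro ⟨x, t⟩ -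
    exact pow_ne_zero _ (circleMap_ne_center hρ.ne')
  · intro t
    simp only [smul_eq_mul]
    refine DifferentiableOn.const_mul (DifferentiableOn.const_mul ?_ _) _
    refine hf.comp (f := fun x => update x i (circleMap 0 ρ t)) ?_ fun x hx => hmem x hx t
    refine (differentiable_pi.2 fun j => ?_ :
      Differentiable ℂ fun x : V → ℂ => update x i (circleMap 0 ρ t)).differentiableOn
    by_cases hj : j = i
    · subst hj; simp
    · simp only [update_of_ne hj]; fun_prop

omit [Fintype V] in
theorem norm_partialTaylorCoeff_le {f : (V → ℂ) → ℂ} {ρ M : ℝ} (hρ : 0 < ρ) {i : V} (m : ℕ)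
    {x : V → ℂ} (hM : ∀ z, ‖z‖ = ρ → ‖f (update x i z)‖ ≤ M) :
    ‖partialTaylorCoeff ρ i m f x‖ ≤ M * (ρ ^ m)⁻¹ := by
  have h := circleIntegral.norm_two_pi_i_inv_smul_integral_le_of_norm_le_const (c := 0) hρ.le
    (f := fun z => (z ^ (m + 1))⁻¹ * f (update x i z)) (C := (ρ ^ (m + 1))⁻¹ * M) ?_
  · calc _ ≤ ρ * ((ρ ^ (m + 1))⁻¹ * M) := h
      _ = M * (ρ ^ m)⁻¹ := by field_simp; ring
  · intro z hz
    have hz' : ‖z‖ = ρ := by simpa using hz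
    rw [norm_mul, norm_inv, norm_pow, hz']
    gcongr
    exact hM z hz'

theorem hasSum_partialTaylorCoeff {R : V → ℝ} {f : (V → ℂ) → ℂ}
    (hf : DifferentiableOn ℂ f {x | ∀ i, ‖x i‖ < R i}) {ρ : ℝ} (hρ : 0 < ρ) {i : V}
    (hρR : ρ < R i) {x : V → ℂ} (hx : ∀ i, ‖x i‖ < R i) (hxi : ‖x i‖ < ρ) :
    HasSum (fun m => partialTaylorCoeff ρ i m f x * x i ^ m) (f x) := by
  have hS : IsOpen {x : V → ℂ | ∀ i, ‖x i‖ < R i} := by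
    rw [Set.ofPred_forall]
    exact isOpen_iInter_of_finite fun i => isOpen_lt (by fun_prop) continuous_const
  have hd : DifferentiableOn ℂ (fun z => f (update x i z)) (Metric.closedBall 0 ρ) := by
    intro z hz
    refine (differentiableAt_slice hS hf x i fun j => ?_).differentiableWithinAt
    by_cases hj : j = i
    · subst hj
      rw [update_self]
      exact (mem_closedBall_zero_iff.1 hz).trans_lt hρR
    · simpa [hj] using hx j
  have h1 := hasSum_two_pi_I_cauchyPowerSeries_integral (f := fun z => f (update x i z))
    (c := 0) (R := ρ) (w := x i) (ContinuousOn.circleIntegrable hρ.le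
      (hd.continuousOn.mono Metric.sphere_subset_closedBall)) hxi
  have h2 := hd.circleIntegral_sub_inv_smul (w := x i) (by simpa using hxi)
  simp only [zero_add, smul_eq_mul, update_eq_self, sub_zero] at h1 h2
  rw [h2] at h1
  have h3 := h1.mul_left (2 * Real.pi * Complex.I)⁻¹
  rw [inv_mul_cancel_left₀ Complex.two_pi_I_ne_zero] at h3
  refine h3.congr_fun fun m => ?_
  rw [partialTaylorCoeff, mul_assoc, mul_comm _ (x i ^ m), ← circleIntegral.integral_const_mul]
  congr 1
  refine circleIntegral.integral_congr hρ.le fun z hz => ?_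
  have hz0 : z ≠ 0 := by
    rintro rfl
    simp at hz; exact hρ.ne hz
  rw [div_pow]
  field_simp
  ring

omit [Fintype V] in
/-- A sum over multi-indices may be computed by summing over the `i`-th index first. -/
theorem hasSum_of_hasSum_update (i : V) {F g : (V → ℕ) → ℂ} {t : ℂ} (hF : Summable F)
    (hg0 : ∀ a, a i ≠ 0 → g a = 0) (hg : HasSum g t)
    (h : ∀ a, a i = 0 → HasSum (fun m => F (update a i m)) (g a)) : HasSum F t := by
  set e : ({a : V → ℕ // a i = 0} × ℕ) ≃ (V → ℕ) :=
    { toFun := fun p => update p.1.1 i p.2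
      invFun := fun a => (⟨update a i 0, by simp⟩, a i)
      left_inv := by
        rintro ⟨⟨a, ha⟩, m⟩
        simp [← ha]
      right_inv := by intro a; simp } with he
  have h1 := ((e.summable_iff (f := F)).2 hF).hasSum
  have h2 : HasSum (fun b : {a : V → ℕ // a i = 0} => g b) (∑' p, (F ∘ e) p) :=
    h1.prod_fiberwise fun b => h b.1 b.2
  have h3 : HasSum (fun b : {a : V → ℕ // a i = 0} => g b) t := by
    refine (Subtype.val_injective.hasSum_iff (f := g) fun a ha => hg0 a fun hai => ha ?_).2 hg
    exact ⟨⟨a, hai⟩, rfl⟩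
  rw [h2.unique h3] at h1
  exact (e.hasSum_iff (f := F)).1 h1

/-- A holomorphic function on a polydisc is the sum of its Taylor series on each smaller polydisc.
The variables are expanded one after the other. -/
theorem exists_hasSum_of_differentiableOn {R R' : V → ℝ} (hR : ∀ i, 0 < R i)
    (hRR' : ∀ i, R i < R' i) {f : (V → ℂ) → ℂ}
    (hf : DifferentiableOn ℂ f {x | ∀ i, ‖x i‖ < R' i}) :
    ∃ c : (V → ℕ) → ℂ, ∀ x : V → ℂ, (∀ i, ‖x i‖ < R i) →
      HasSum (fun a => c a * ∏ i, x i ^ a i) (f x) := by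
  set K : Set (V → ℂ) := {x | ∀ i, ‖x i‖ ≤ R i} with hK
  have hKc : IsCompact K := by
    have : K = Set.pi Set.univ fun i => Metric.closedBall (0 : ℂ) (R i) := by
      ext x; simp [hK]
    rw [this]
    exact isCompact_univ_pi fun i => isCompact_closedBall _ _
  have hKS : K ⊆ {x | ∀ i, ‖x i‖ < R' i} := fun x hx i => (hx i).trans_lt (hRR' i)
  obtain ⟨M, hM⟩ := hKc.exists_bound_of_continuousOn (hf.continuousOn.mono hKS)
  -- `c a` is the Taylor coefficient with respect to the variables in `s`: a function of the other
  -- variables, which is zero unless `a` is supported in `s`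
  have claim : ∀ s : Finset V, ∃ c : (V → ℕ) → (V → ℂ) → ℂ,
      (∀ a, DifferentiableOn ℂ (c a) {x | ∀ i, ‖x i‖ < R' i}) ∧
      (∀ a, ∀ x ∈ K, ‖c a x‖ ≤ M * ∏ i, (R i ^ a i)⁻¹) ∧
      (∀ a x y, (∀ j ∉ s, x j = y j) → c a x = c a y) ∧
      (∀ a, ∀ i ∉ s, a i ≠ 0 → c a = 0) ∧
      (∀ x : V → ℂ, (∀ i, ‖x i‖ < R i) → HasSum (fun a => c a x * ∏ i, x i ^ a i) (f x)) := by
    intro s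
    induction s using Finset.induction_on with
    | empty =>
      refine ⟨fun a => if a = 0 then f else 0, ?_, ?_, ?_, ?_, ?_⟩
      · intro a
        by_cases ha : a = 0
        · simpa [ha] using hf
        · simp [ha]
      · intro a x hx
        by_cases ha : a = 0
        · simpa [ha] using hM x hx
        · have : 0 ≤ M := (norm_nonneg _).trans (hM x hx)
          simp only [ha, if_false, Pi.zero_apply, norm_zero]
          exact mul_nonneg this (Finset.prod_nonneg fun i _ => inv_nonneg.2
            (pow_nonneg (hR i).le _))
      · intro a x y h
        rw [funext fun j => h j (by simp)]
      · intro a i _ hi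
        have : a ≠ 0 := fun h => hi (by simp [h])
        simp [this]
      · intro x hx
        convert hasSum_single (f := fun a : V → ℕ => (if a = 0 then f else 0) x * ∏ i, x i ^ a i)
          0 ?_ using 1
        · simp
        · intro a ha; simp [ha]
    | insert i s hi ih =>
      obtain ⟨c, hcd, hcb, hcs, hc0, hcsum⟩ := ih
      have hb : ∀ a, ∀ x ∈ K, ‖partialTaylorCoeff (R i) i (a i) (c (update a i 0)) x‖ ≤
          M * ∏ j, (R j ^ a j)⁻¹ := by
        intro a x hx
        have h1 := norm_partialTaylorCoeff_le (f := c (update a i 0)) (x := x) (i := i) (hR i)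
          (a i) (M := M * ∏ j, (R j ^ (update a i 0) j)⁻¹) ?_
        · refine h1.trans_eq ?_
          rw [mul_assoc]
          congr 1
          rw [← Finset.mul_prod_erase _ _ (Finset.mem_univ i),
            ← Finset.mul_prod_erase _ (fun j => (R j ^ a j)⁻¹) (Finset.mem_univ i)]
          simp only [update_self, pow_zero, inv_one, one_mul]
          rw [mul_comm]
          congr 1
          refine Finset.prod_congr rfl fun j hj => ?_
          rw [update_of_ne (Finset.ne_of_mem_erase hj)]
        · intro z hz
          refine hcb _ _ fun j => ?_
          by_cases hj : j = i
          · subst hj; simp [hz]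
          · simpa [hj] using hx j
      refine ⟨fun a => partialTaylorCoeff (R i) i (a i) (c (update a i 0)), ?_, hb, ?_, ?_, ?_⟩
      · exact fun a => differentiableOn_partialTaylorCoeff (hcd _) (hR i) (hRR' i) _
      · intro a x y h
        simp only [partialTaylorCoeff]
        congr 1
        refine circleIntegral.integral_congr (hR i).le fun z _ => ?_
        rw [hcs _ (update x i z) (update y i z)]
        intro j hj
        by_cases hji : j = i
        · subst hji; simp
        · simp only [update_of_ne hji]
          exact h j (by simp [hj, hji])
      · intro a j hj haj
        simp only [Finset.mem_insert, not_or] at hj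
        beta_reduce
        rw [hc0 (update a i 0) j hj.2 (by rwa [update_of_ne hj.1])]
        ext x
        simp [partialTaylorCoeff, circleIntegral]
      · intro x hx
        have hxK : x ∈ K := fun j => (hx j).le
        have hsum : Summable fun a : V → ℕ =>
            partialTaylorCoeff (R i) i (a i) (c (update a i 0)) x * ∏ j, x j ^ a j := by
          refine ((summable_prod_pow (r := fun j => ‖x j‖ / R j)
            (fun j => div_nonneg (norm_nonneg _) (hR j).le)
            (fun j => (div_lt_one (hR j)).2 (hx j))).mul_left M).of_norm_bounded fun a => ?_
          rw [norm_mul, norm_prod]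
          calc _ ≤ (M * ∏ j, (R j ^ a j)⁻¹) * ∏ j, ‖x j ^ a j‖ := by gcongr; exact hb a x hxK
            _ = M * ∏ j, (‖x j‖ / R j) ^ a j := by
              rw [mul_assoc, ← Finset.prod_mul_distrib]
              congr 1
              refine Finset.prod_congr rfl fun j _ => ?_
              rw [norm_pow, div_pow]; field_simp
        refine hasSum_of_hasSum_update i hsum (fun a ha => ?_) (hcsum x hx) fun a ha => ?_
        · rw [hc0 a i hi ha, Pi.zero_apply, zero_mul]
        · have h3 := (hasSum_partialTaylorCoeff (hcd a) (hR i) (hRR' i)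
            (fun j => (hx j).trans (hRR' j)) (hx i)).mul_right (∏ j, x j ^ a j)
          refine h3.congr_fun fun m => ?_
          have : update a i 0 = a := by rw [← ha, update_eq_self]
          simp only [update_self, update_idem, this, mul_assoc]
          congr 1
          rw [← Finset.mul_prod_erase _ _ (Finset.mem_univ i),
            ← Finset.mul_prod_erase _ (fun j => x j ^ a j) (Finset.mem_univ i), ha, pow_zero,
            one_mul, update_self]
          congr 1
          refine Finset.prod_congr rfl fun j hj => ?_
          rw [update_of_ne (Finset.ne_of_mem_erase hj)]
  obtain ⟨c, -, -, hcs, -, hcsum⟩ := claim Finset.univ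
  refine ⟨fun a => c a 0, fun x hx => ?_⟩
  refine (hcsum x hx).congr_fun fun a => ?_
  rw [hcs a x 0 (by simp)]

end

/-! ### Uniqueness of Laurent coefficients -/

section

open Filter Asymptotics Function

variable {V : Type*} [Fintype V] [DecidableEq V]

open MeasureTheory AddCircle in
omit [DecidableEq V] in
/-- Uniqueness of the coefficients of a Laurent series which converges absolutely on a torus:
integration against characters of the torus extracts the coefficients. -/
theorem laurent_coeff_eq_zero {r : V → ℝ} (hr : ∀ i, 0 < r i) {e : (V → ℤ) → ℂ}
    (h : ∀ x : V → ℂ, (∀ i, ‖x i‖ = r i) → HasSum (fun a => e a * ∏ i, x i ^ a i) 0) (b : V → ℤ) :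
    e b = 0 := by
  classical
  set μ : Measure (V → AddCircle (1 : ℝ)) := Measure.pi fun _ => haarAddCircle with hμ
  set X : (V → AddCircle (1 : ℝ)) → V → ℂ := fun t i => r i * fourier 1 (t i) with hX
  have hXn : ∀ t i, ‖X t i‖ = r i := fun t i => by
    simp [hX, fourier_apply, abs_of_pos (hr i), Circle.norm_coe]
  have hXp : ∀ t (a : V → ℤ), ∏ i, X t i ^ a i =
      (∏ i, (r i : ℂ) ^ a i) * ∏ i, fourier (a i) (t i) := by
    intro t a
    rw [← Finset.prod_mul_distrib]
    refine Finset.prod_congr rfl fun i _ => ?_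
    simp only [hX, mul_zpow, fourier_apply, one_smul]
    rw [toCircle_zsmul, Circle.coe_zpow]
  set F : (V → ℤ) → (V → AddCircle (1 : ℝ)) → ℂ := fun a t =>
    (e a * ∏ i, (r i : ℂ) ^ a i) * ∏ i, fourier (a i - b i) (t i) with hF
  have hFs : ∀ t, HasSum (fun a => F a t) 0 := by
    intro t
    have h1 := (h (X t) (hXn t)).mul_right (∏ i, fourier (-b i) (t i))
    rw [zero_mul] at h1
    refine h1.congr_fun fun a => ?_
    rw [hXp, hF]
    simp only [mul_assoc]
    congr 2
    rw [← Finset.prod_mul_distrib]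
    refine Finset.prod_congr rfl fun i _ => ?_
    rw [sub_eq_add_neg, fourier_add]
  have hFn : ∀ a t, ‖F a t‖ = ‖e a * ∏ i, (r i : ℂ) ^ a i‖ := by
    intro a t
    simp [hF, norm_prod, fourier_apply, Circle.norm_coe]
  have hsum : Summable fun a => ‖e a * ∏ i, (r i : ℂ) ^ a i‖ := by
    refine ((hFs 0).summable.norm).congr fun a => hFn a 0
  have hFc : ∀ a, Continuous (F a) := fun a => by
    simp only [hF]; fun_prop
  have hint := hasSum_integral_of_summable_integral_norm (μ := μ) (F := F)
    (fun a => Integrable.of_bound (hFc a).aestronglyMeasurable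
      (‖e a * ∏ i, (r i : ℂ) ^ a i‖) (Eventually.of_forall fun t => (hFn a t).le))
    (by simpa only [hFn, integral_const, probReal_univ, one_smul] using hsum)
  simp only [(hFs _).tsum_eq, integral_zero] at hint
  have hval : ∀ a, ∫ t, F a t ∂μ = if a = b then e b * ∏ i, (r i : ℂ) ^ b i else 0 := by
    intro a
    simp only [hF, integral_const_mul, hμ]
    rw [integral_fintype_prod_eq_prod (𝕜 := ℂ) (fun i (t : AddCircle (1 : ℝ)) =>
      (fourier (a i - b i) t : ℂ))]
    split_ifs with hab
    · subst hab; simp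
    · obtain ⟨i, hi⟩ := Function.ne_iff.1 hab
      refine mul_eq_zero_of_right _ (Finset.prod_eq_zero (Finset.mem_univ i) ?_)
      exact integral_eq_zero_of_add_right_eq_neg (μ := haarAddCircle)
        (fourier_add_half_inv_index (sub_ne_zero.2 hi) one_pos)
  simp only [hval] at hint
  have h0 := (hasSum_ite_eq b _).unique hint
  refine (mul_eq_zero.1 h0).resolve_right (Finset.prod_ne_zero_iff.2 fun i _ => ?_)
  exact zpow_ne_zero _ (by exact_mod_cast (hr i).ne')

end

/-! ### Roots and lengths in the Weyl group -/

section

open Function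

variable {V : Type*} [Fintype V] [DecidableEq V] (Γ : SimpleGraph V) [DecidableRel Γ.Adj]

omit [Fintype V] in
/-- The relations of the Coxeter group of `Γ`, written as braid relations instead of powers. -/
theorem isLiftable_coxeterMatrix {G : Type*} [Monoid G] {f : V → G} (hsq : ∀ i, f i * f i = 1)
    (hbraid : ∀ i j, Γ.Adj i j → f i * f j * f i = f j * f i * f j)
    (hcomm : ∀ i j, i ≠ j → ¬Γ.Adj i j → f i * f j = f j * f i) :
    (coxeterMatrix Γ).IsLiftable f := by
  intro i j
  by_cases hij : i = j
  · subst hij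
    simp [coxeterMatrix, hsq]
  by_cases hadj : Γ.Adj i j
  · have h3 : (coxeterMatrix Γ).M i j = 3 := by simp [coxeterMatrix, hij, hadj]
    rw [h3]
    calc (f i * f j) ^ 3 = (f i * f j * f i) * (f j * f i * f j) := by
          simp only [pow_succ, pow_zero, one_mul, mul_assoc]
      _ = (f i * f j * f i) * (f i * f j * f i) := by rw [hbraid i j hadj]
      _ = f i * (f j * (f i * f i) * f j) * f i := by simp only [mul_assoc]
      _ = 1 := by rw [hsq, mul_one, hsq, mul_one, hsq]
  · have h2 : (coxeterMatrix Γ).M i j = 2 := by simp [coxeterMatrix, hij, hadj]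
    rw [h2]
    calc (f i * f j) ^ 2 = (f i * f j) * (f j * f i) := by rw [pow_two, hcomm i j hij hadj]
      _ = f i * (f j * f j) * f i := by simp only [mul_assoc]
      _ = 1 := by rw [hsq, mul_one, hsq]

/-- The pairing of a vector of the root lattice with the `i`-th simple coroot. -/
def coroot (i : V) (α : V → ℤ) : ℤ := 2 * α i - ∑ j ∈ Γ.neighborFinset i, α j

theorem reflection_eq_sub (i : V) (α : V → ℤ) :
    reflection Γ i α = α - Pi.single i (coroot Γ i α) := by
  ext k
  by_cases hk : k = i
  · subst hk; simp [reflection, coroot]; ring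
  · simp [reflection, hk]

theorem coroot_sub (i : V) (α β : V → ℤ) :
    coroot Γ i (α - β) = coroot Γ i α - coroot Γ i β := by
  simp [coroot, Finset.sum_sub_distrib]; ring

theorem coroot_single (i j : V) (m : ℤ) :
    coroot Γ i (Pi.single j m) = if i = j then 2 * m else if Γ.Adj i j then -m else 0 := by
  by_cases hij : i = j
  · subst hij
    have : ∑ k ∈ Γ.neighborFinset i, (Pi.single i m : V → ℤ) k = 0 :=
      Finset.sum_eq_zero fun k hk => by
        rw [Pi.single_eq_of_ne]
        rintro rfl
        simp at hk
    simp [coroot, this]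
  · have h1 : ∑ k ∈ Γ.neighborFinset i, (Pi.single j m : V → ℤ) k =
        if Γ.Adj i j then m else 0 := by
      simp [Pi.single_apply]
    simp only [coroot, Pi.single_eq_of_ne hij, hij, if_false, h1]
    split_ifs <;> simp

/-- The simple reflection as a linear map. -/
def reflectionEnd (i : V) : Module.End ℤ (V → ℤ) where
  toFun := reflection Γ i
  map_add' α β := by
    ext k
    by_cases hk : k = i
    · subst hk; simp [reflection, Finset.sum_add_distrib]; ring
    · simp [reflection, hk]
  map_smul' c α := by
    ext k
    by_cases hk : k = i
    · subst hk; simp [reflection, ← Finset.mul_sum]; ring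
    · simp [reflection, hk]

@[simp]
theorem reflectionEnd_apply (i : V) (α : V → ℤ) : reflectionEnd Γ i α = reflection Γ i α := rfl

@[simp]
theorem reflection_reflection (i : V) (α : V → ℤ) : reflection Γ i (reflection Γ i α) = α := by
  simp only [reflection_eq_sub, coroot_sub, coroot_single, if_true]
  ext k
  by_cases hk : k = i
  · subst hk; simp; ring
  · simp [hk]

theorem reflection_braid {i j : V} (h : Γ.Adj i j) (α : V → ℤ) :
    reflection Γ i (reflection Γ j (reflection Γ i α)) =
      reflection Γ j (reflection Γ i (reflection Γ j α)) := by
  have hne := h.ne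
  have hne' := h.ne'
  simp only [reflection_eq_sub, coroot_sub, coroot_single, if_true, h, h.symm, hne, hne', if_false]
  ext k
  by_cases hk : k = i
  · subst hk; simp [hne]; ring
  · by_cases hk' : k = j
    · subst hk'; simp [hk]; ring
    · simp [hk, hk']

theorem reflection_comm {i j : V} (hij : i ≠ j) (h : ¬Γ.Adj i j) (α : V → ℤ) :
    reflection Γ i (reflection Γ j α) = reflection Γ j (reflection Γ i α) := by
  have h' : ¬Γ.Adj j i := fun h' => h h'.symm
  simp only [reflection_eq_sub, coroot_sub, coroot_single, h, h', hij, hij.symm, if_false,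
    sub_zero]
  abel

theorem reflection_single_self (i : V) :
    reflection Γ i (Pi.single i 1) = -Pi.single i 1 := by
  rw [reflection_eq_sub, coroot_single, if_pos rfl]
  ext k
  by_cases hk : k = i
  · subst hk; simp
  · simp [hk]

theorem reflection_single_of_adj {i j : V} (h : Γ.Adj i j) :
    reflection Γ i (Pi.single j 1) = Pi.single i 1 + Pi.single j 1 := by
  rw [reflection_eq_sub, coroot_single, if_neg h.ne, if_pos h]
  ext k
  by_cases hk : k = i
  · subst hk; simp; ring
  · simp [hk]

theorem reflection_single_of_not_adj {i j : V} (hij : i ≠ j) (h : ¬Γ.Adj i j) :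
    reflection Γ i (Pi.single j 1) = Pi.single j 1 := by
  rw [reflection_eq_sub, coroot_single, if_neg hij, if_neg h]
  simp

theorem reflection_of_ne {i k : V} (hk : k ≠ i) (α : V → ℤ) : reflection Γ i α k = α k := by
  simp [reflection, hk]

/-- The action of the Weyl group on the root lattice. -/
def rootAction : (coxeterMatrix Γ).Group →* Module.End ℤ (V → ℤ) :=
  (weylSystem Γ).lift ⟨reflectionEnd Γ, isLiftable_coxeterMatrix Γ
    (fun i => LinearMap.ext fun α => by simp)
    (fun i j h => LinearMap.ext fun α => by simpa using reflection_braid Γ h α)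
    (fun i j hij h => LinearMap.ext fun α => by simpa using reflection_comm Γ hij h α)⟩

@[simp]
theorem rootAction_simple (i : V) (α : V → ℤ) :
    rootAction Γ ((weylSystem Γ).simple i) α = reflection Γ i α := by
  rw [rootAction, CoxeterSystem.lift_apply_simple]; rfl

theorem rootAction_mul_simple (w : (coxeterMatrix Γ).Group) (i : V) (α : V → ℤ) :
    rootAction Γ (w * (weylSystem Γ).simple i) α = rootAction Γ w (reflection Γ i α) := by
  rw [map_mul, Module.End.mul_apply, rootAction_simple]

@[simp]
theorem rootAction_inv_apply (w : (coxeterMatrix Γ).Group) (α : V → ℤ) :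
    rootAction Γ w⁻¹ (rootAction Γ w α) = α := by
  rw [← Module.End.mul_apply, ← map_mul, inv_mul_cancel, map_one, Module.End.one_apply]

@[simp]
theorem rootAction_apply_inv (w : (coxeterMatrix Γ).Group) (α : V → ℤ) :
    rootAction Γ w (rootAction Γ w⁻¹ α) = α := by
  rw [← Module.End.mul_apply, ← map_mul, mul_inv_cancel, map_one, Module.End.one_apply]

theorem isRoot_rootAction {α : V → ℤ} (hα : IsRoot Γ α) (w : (coxeterMatrix Γ).Group) :
    IsRoot Γ (rootAction Γ w α) := by
  induction w using (weylSystem Γ).simple_induction_left with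
  | one => simpa using hα
  | mul_simple_left w i ih =>
    rw [map_mul, Module.End.mul_apply, rootAction_simple]
    exact .reflect i _ ih

theorem isRoot_iff (α : V → ℤ) :
    IsRoot Γ α ↔ ∃ w i, α = rootAction Γ w (Pi.single i 1) := by
  constructor
  · intro h
    induction h with
    | simple i => exact ⟨1, i, by simp⟩
    | reflect i α _ ih =>
      obtain ⟨w, j, rfl⟩ := ih
      exact ⟨(weylSystem Γ).simple i * w, j, by
        rw [map_mul, Module.End.mul_apply, rootAction_simple]⟩
  · rintro ⟨w, i, rfl⟩
    exact isRoot_rootAction Γ (.simple i) w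

variable {Γ} in
theorem IsRoot.ne_zero {α : V → ℤ} (hα : IsRoot Γ α) : α ≠ 0 := by
  obtain ⟨w, i, rfl⟩ := (isRoot_iff Γ α).1 hα
  intro h
  have h1 := rootAction_inv_apply Γ w (Pi.single i 1)
  rw [h, map_zero] at h1
  simpa using congr_fun h1 i

/-- The key link between lengths and roots: `w` sends the `i`-th simple root to a positive root
if `w σ_i` is longer than `w`. It follows by induction on the length of `w`, by taking the
decomposition of `w` along the rank two subgroup generated by `σ_i` and a right descent of `w`. -/
theorem rootAction_single_nonneg (w : (coxeterMatrix Γ).Group) (i : V)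
    (h : (weylSystem Γ).length w < (weylSystem Γ).length (w * (weylSystem Γ).simple i)) :
    0 ≤ rootAction Γ w (Pi.single i 1) := by
  set cs := weylSystem Γ with hcs
  induction hn : cs.length w using Nat.strong_induction_on generalizing w i with
  | _ n ih =>
  subst hn
  by_cases hw : w = 1
  · subst hw
    rw [map_one, Module.End.one_apply]
    exact Pi.single_nonneg.2 zero_le_one
  obtain ⟨j, hj⟩ := cs.exists_rightDescent_of_ne_one hw
  have hij : i ≠ j := by
    rintro rfl
    exact absurd hj (by rw [CoxeterSystem.IsRightDescent]; omega)
  rw [CoxeterSystem.isRightDescent_iff] at hj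
  set v := w * cs.simple j with hv
  have hwv : w = v * cs.simple j := by rw [hv]; simp
  have hvj : cs.length v < cs.length (v * cs.simple j) := by rw [← hwv]; omega
  -- peel off letters of the subgroup generated by `σ_i` and `σ_j` from the right of `w = v σ_j`
  rcases cs.length_mul_simple v i with hvi | hvi
  · have h1 := ih _ (by omega) v i (by omega) rfl
    have h2 := ih _ (by omega) v j hvj rfl
    rw [hwv, rootAction_mul_simple]
    by_cases hadj : Γ.Adj j i
    · rw [reflection_single_of_adj Γ hadj, map_add]
      exact add_nonneg h2 h1
    · rwa [reflection_single_of_not_adj Γ hij.symm hadj]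
  · set v' := v * cs.simple i with hv'
    have hvv' : v = v' * cs.simple i := by rw [hv']; simp
    by_cases hadj : Γ.Adj i j
    · have e : rootAction Γ w (Pi.single i 1) = rootAction Γ v' (Pi.single j 1) := by
        rw [hwv, hvv', rootAction_mul_simple, rootAction_mul_simple,
          reflection_single_of_adj Γ hadj.symm]
        have := reflectionEnd_apply Γ i (Pi.single j 1 + Pi.single i 1)
        rw [← this, map_add, reflectionEnd_apply, reflectionEnd_apply,
          reflection_single_of_adj Γ hadj, reflection_single_self]
        congr 1
        abel
      rw [e]
      rcases cs.length_mul_simple v' j with hvj' | hvj'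
      · exact ih _ (by omega) v' j (by omega) rfl
      · -- `w` would end in the longest element of the rank two subgroup, hence in `σ_i`
        exfalso
        set v'' := v' * cs.simple j with hv''
        have hv'v'' : v' = v'' * cs.simple j := by rw [hv'']; simp
        have hb : cs.simple j * cs.simple i * cs.simple j * cs.simple i =
            cs.simple i * cs.simple j := by
          have h3 := cs.simple_mul_simple_pow j i
          have hM : (coxeterMatrix Γ).M j i = 3 := by
            simp [coxeterMatrix, hadj.symm, hij.symm]
          rw [hM] at h3
          have h4 : (cs.simple j * cs.simple i * cs.simple j * cs.simple i) *
              (cs.simple j * cs.simple i) = 1 := by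
            rw [← h3]; simp only [pow_succ, pow_zero, one_mul, mul_assoc]
          have h5 := eq_inv_of_mul_eq_one_left h4
          rw [h5, mul_inv_rev, cs.inv_simple, cs.inv_simple]
        have e2 : w * cs.simple i = v'' * cs.simple i * cs.simple j := by
          rw [hwv, hvv', hv'v'']
          simp only [mul_assoc] at hb ⊢
          rw [hb]
        have l1 := cs.length_mul_simple (v'' * cs.simple i) j
        have l2 := cs.length_mul_simple v'' i
        rw [← e2] at l1
        omega
    · -- `σ_i` and `σ_j` commute, so that `σ_i` would be a right descent of `w`
      exfalso
      have hc : cs.simple i * cs.simple j = cs.simple j * cs.simple i := by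
        have h3 := cs.simple_mul_simple_pow i j
        have hM : (coxeterMatrix Γ).M i j = 2 := by simp [coxeterMatrix, hadj, hij]
        rw [hM, pow_two] at h3
        have h5 := eq_inv_of_mul_eq_one_left h3
        rw [h5, mul_inv_rev, cs.inv_simple, cs.inv_simple]
      have e2 : w * cs.simple i = v' * cs.simple j := by
        rw [hwv, hvv']
        rw [mul_assoc, mul_assoc, ← hc]
        simp only [mul_assoc, hv']
        rw [← mul_assoc (cs.simple i) (cs.simple i), cs.simple_mul_simple_self, one_mul]
      have l1 := cs.length_mul_simple v' j
      rw [← e2] at l1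
      omega

theorem rootAction_single_nonpos (w : (coxeterMatrix Γ).Group) (i : V)
    (h : (weylSystem Γ).length (w * (weylSystem Γ).simple i) < (weylSystem Γ).length w) :
    rootAction Γ w (Pi.single i 1) ≤ 0 := by
  have h1 := rootAction_single_nonneg Γ (w * (weylSystem Γ).simple i) i
    (by rwa [(weylSystem Γ).simple_mul_simple_cancel_right])
  rw [rootAction_mul_simple, reflection_single_self, map_neg] at h1
  exact neg_nonneg.1 h1

variable {Γ} in
/-- Every root is positive or negative. -/
theorem IsRoot.nonneg_or_nonpos {α : V → ℤ} (hα : IsRoot Γ α) : 0 ≤ α ∨ α ≤ 0 := by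
  obtain ⟨w, i, rfl⟩ := (isRoot_iff Γ α).1 hα
  rcases (weylSystem Γ).length_mul_simple w i with h | h
  · exact .inl (rootAction_single_nonneg Γ w i (by omega))
  · exact .inr (rootAction_single_nonpos Γ w i (by omega))

variable {Γ} in
/-- A real root proportional to a simple root is that root up to sign. -/
theorem IsRoot.eq_single_or_neg {α : V → ℤ} (hα : IsRoot Γ α) {i : V}
    (h : ∀ k, k ≠ i → α k = 0) : α = Pi.single i 1 ∨ α = -Pi.single i 1 := by
  have h1 : α = α i • Pi.single i 1 := by
    ext k
    by_cases hk : k = i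
    · subst hk; simp
    · simp [hk, h k hk]
  obtain ⟨w, j, hw⟩ := (isRoot_iff Γ α).1 hα
  have h2 : α i * rootAction Γ w⁻¹ (Pi.single i 1) j = 1 := by
    have h3 := rootAction_inv_apply Γ w (Pi.single j 1)
    rw [← hw, h1, map_smul] at h3
    simpa using congr_fun h3 j
  rcases Int.eq_one_or_neg_one_of_mul_eq_one h2 with h3 | h3
  · left; rw [h1, h3]; simp
  · right; rw [h1, h3]; simp

theorem single_mem_posRoots (i : V) : Pi.single i 1 ∈ posRoots Γ :=
  ⟨.simple i, Pi.single_nonneg.2 zero_le_one⟩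

theorem reflection_mem_posRoots {α : V → ℤ} (hα : α ∈ posRoots Γ) {i : V}
    (hi : α ≠ Pi.single i 1) : reflection Γ i α ∈ posRoots Γ := by
  have hr : IsRoot Γ (reflection Γ i α) := .reflect i α hα.1
  refine ⟨hr, hr.nonneg_or_nonpos.resolve_right fun hneg => ?_⟩
  have h0 : ∀ k, k ≠ i → α k = 0 := fun k hk => by
    have h1 := hneg k
    rw [reflection_of_ne Γ hk] at h1
    exact le_antisymm h1 (hα.2 k)
  rcases hα.1.eq_single_or_neg h0 with h | h
  · exact hi h
  · have := hα.2 i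
    rw [h] at this
    simp at this

theorem reflection_ne_single {α : V → ℤ} (hα : α ∈ posRoots Γ) {i : V} :
    reflection Γ i α ≠ Pi.single i 1 := by
  intro h
  have h1 : α = -Pi.single i 1 := by
    rw [← reflection_reflection Γ i α, h, reflection_single_self]
  have := hα.2 i
  rw [h1] at this
  simp at this

/-- Distinct positive roots are not proportional: some two by two minor does not vanish. -/
theorem exists_minor_ne_zero {α β : V → ℤ} (hα : α ∈ posRoots Γ) (hβ : β ∈ posRoots Γ)
    (h : α ≠ β) : ∃ j k, α j * β k ≠ α k * β j := by
  by_contra! hcon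
  obtain ⟨k, hk⟩ := Function.ne_iff.1 hα.1.ne_zero
  obtain ⟨w, i, hw⟩ := (isRoot_iff Γ α).1 hα.1
  have h1 : β k • α = α k • β := by
    ext j
    simp only [Pi.smul_apply, smul_eq_mul]
    rw [mul_comm, hcon j k]
  have h2 : β k • Pi.single i 1 = α k • rootAction Γ w⁻¹ β := by
    have := congr_arg (rootAction Γ w⁻¹) h1
    rwa [map_smul, map_smul, show rootAction Γ w⁻¹ α = Pi.single i 1 by
      rw [hw, rootAction_inv_apply]] at this
  have h3 : ∀ j, j ≠ i → rootAction Γ w⁻¹ β j = 0 := by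
    intro j hj
    have := congr_fun h2 j
    simp only [Pi.smul_apply, smul_eq_mul, Pi.single_eq_of_ne hj, mul_zero] at this
    exact (mul_eq_zero.1 this.symm).resolve_left hk
  rcases (isRoot_rootAction Γ hβ.1 w⁻¹).eq_single_or_neg h3 with h4 | h4
  · apply h
    rw [hw, ← h4, rootAction_apply_inv]
  · have h5 : β = -α := by rw [hw, ← map_neg, ← h4, rootAction_apply_inv]
    have h6 := hα.2 k
    have h7 := hβ.2 k
    rw [h5] at h7
    simp only [Pi.neg_apply, Pi.zero_apply] at *
    omega

/-! ### Inversions -/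

/-- The inversions of `w`: the positive roots which `w` makes negative. -/
def inversions (w : (coxeterMatrix Γ).Group) : Set (V → ℤ) :=
  {γ | γ ∈ posRoots Γ ∧ rootAction Γ w γ ≤ 0}

/-- The inversions of a word, listed by peeling off letters from the right. -/
def invRoots (ω : List V) : List (V → ℤ) :=
  ω.foldl (fun L i => Pi.single i 1 :: L.map (reflection Γ i)) []

theorem invRoots_concat (ω : List V) (i : V) :
    invRoots Γ (ω ++ [i]) = Pi.single i 1 :: (invRoots Γ ω).map (reflection Γ i) := by
  simp [invRoots]

theorem isReduced_of_concat {ω : List V} {i : V} (h : (weylSystem Γ).IsReduced (ω ++ [i])) :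
    (weylSystem Γ).IsReduced ω ∧ (weylSystem Γ).length ((weylSystem Γ).wordProd ω) <
      (weylSystem Γ).length ((weylSystem Γ).wordProd ω * (weylSystem Γ).simple i) := by
  have h1 : (weylSystem Γ).IsReduced ω := by simpa using h.take ω.length
  refine ⟨h1, ?_⟩
  have h2 := h.eq
  rw [CoxeterSystem.wordProd_append, CoxeterSystem.wordProd_singleton] at h2
  rw [h2, h1.eq]
  simp

/-- For a reduced word, `invRoots` lists the inversions of the group element, without repetitions.
-/
theorem invRoots_spec {ω : List V} (h : (weylSystem Γ).IsReduced ω) :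
    (invRoots Γ ω).Nodup ∧
      ∀ γ, γ ∈ invRoots Γ ω ↔ γ ∈ inversions Γ ((weylSystem Γ).wordProd ω) := by
  induction ω using List.reverseRecOn with
  | nil =>
    refine ⟨by simp [invRoots], fun γ => ?_⟩
    simp only [invRoots, List.foldl_nil, List.not_mem_nil, CoxeterSystem.wordProd_nil, inversions,
      map_one, Module.End.one_apply, Set.mem_ofPred_eq, false_iff, not_and]
    intro h1 h2
    exact h1.1.ne_zero (le_antisymm h2 h1.2)
  | append_singleton ω i ih =>
    obtain ⟨h1, h2⟩ := isReduced_of_concat Γ h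
    obtain ⟨hnd, hmem⟩ := ih h1
    have hpos := rootAction_single_nonneg Γ _ i h2
    have hne : ∀ δ ∈ inversions Γ ((weylSystem Γ).wordProd ω), δ ≠ Pi.single i 1 := by
      rintro δ hδ rfl
      exact (isRoot_rootAction Γ (IsRoot.simple i) _).ne_zero (le_antisymm hδ.2 hpos)
    rw [invRoots_concat]
    constructor
    · rw [List.nodup_cons]
      refine ⟨?_, hnd.map fun a b hab => ?_⟩
      · intro hm
        obtain ⟨δ, hδ, he⟩ := List.mem_map.1 hm
        exact reflection_ne_single Γ ((hmem δ).1 hδ).1 he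
      · rw [← reflection_reflection Γ i a, hab, reflection_reflection]
    · intro γ
      rw [List.mem_cons, CoxeterSystem.wordProd_append, CoxeterSystem.wordProd_singleton]
      simp only [inversions, Set.mem_ofPred_eq, rootAction_mul_simple]
      constructor
      · rintro (rfl | hm)
        · refine ⟨single_mem_posRoots Γ i, ?_⟩
          rw [reflection_single_self, map_neg]
          exact neg_nonpos.2 hpos
        · obtain ⟨δ, hδ, rfl⟩ := List.mem_map.1 hm
          have hδ' := (hmem δ).1 hδ
          rw [reflection_reflection]
          exact ⟨reflection_mem_posRoots Γ hδ'.1 (hne δ hδ'), hδ'.2⟩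
      · rintro ⟨h3, h4⟩
        by_cases hγ : γ = Pi.single i 1
        · exact .inl hγ
        · refine .inr (List.mem_map.2 ⟨reflection Γ i γ, (hmem _).2
            ⟨reflection_mem_posRoots Γ h3 hγ, h4⟩, reflection_reflection Γ i γ⟩)

/-- An element of the Weyl group is determined by its inversions. The right descents can be read off
from the inversions, so induction on the length applies. -/
theorem inversions_injective : Function.Injective (inversions Γ) := by
  set cs := weylSystem Γ with hcs
  have hdesc : ∀ w i, cs.IsRightDescent w i ↔ Pi.single i 1 ∈ inversions Γ w := by
    intro w i
    constructor
    · intro h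
      exact ⟨single_mem_posRoots Γ i, rootAction_single_nonpos Γ w i h⟩
    · intro h
      by_contra hcon
      rw [CoxeterSystem.not_isRightDescent_iff] at hcon
      have h1 := rootAction_single_nonneg Γ w i (by rw [← hcs]; omega)
      exact (isRoot_rootAction Γ (IsRoot.simple i) _).ne_zero (le_antisymm h.2 h1)
  have hsub : ∀ w w' i, inversions Γ w = inversions Γ w' → cs.IsRightDescent w i →
      inversions Γ (w * cs.simple i) ⊆ inversions Γ (w' * cs.simple i) := by
    rintro w w' i h hd γ ⟨h1, h2⟩
    rw [rootAction_mul_simple] at h2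
    refine ⟨h1, ?_⟩
    rw [rootAction_mul_simple]
    have hne : γ ≠ Pi.single i 1 := by
      rintro rfl
      rw [reflection_single_self, map_neg] at h2
      exact (isRoot_rootAction Γ (IsRoot.simple i) w).ne_zero
        (le_antisymm ((hdesc w i).1 hd).2 (neg_nonpos.1 h2))
    have h3 : reflection Γ i γ ∈ inversions Γ w := ⟨reflection_mem_posRoots Γ h1 hne, h2⟩
    rw [h] at h3
    exact h3.2
  intro w w' h
  induction hn : cs.length w using Nat.strong_induction_on generalizing w w' with
  | _ n ih =>
  subst hn
  by_cases hw : w = 1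
  · subst hw
    by_contra hw'
    obtain ⟨i, hi⟩ := cs.exists_rightDescent_of_ne_one (w := w') (Ne.symm hw')
    rw [hdesc, ← h, ← hdesc] at hi
    exact cs.not_isRightDescent_one i hi
  · obtain ⟨i, hi⟩ := cs.exists_rightDescent_of_ne_one hw
    have hi' : cs.IsRightDescent w' i := by rw [hdesc, ← h, ← hdesc]; exact hi
    have h1 := ih _ hi (w := w * cs.simple i) (w' := w' * cs.simple i)
      ((hsub w w' i h hi).antisymm (hsub w' w i h.symm hi')) rfl
    exact mul_right_cancel h1

end

/-! ### Normalized monomials -/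

section

open Function Filter

variable {V : Type*} [Fintype V] [DecidableEq V] (Γ : SimpleGraph V) [DecidableRel Γ.Adj]

theorem sqrtq_sq (q : ℕ) : sqrtq q ^ 2 = q := by
  rw [sqrtq, ← Complex.ofReal_pow, Real.sq_sqrt (Nat.cast_nonneg q)]
  simp

theorem sqrtq_ne_zero {q : ℕ} (hq : 0 < q) : sqrtq q ≠ 0 := by
  intro h
  have := sqrtq_sq q
  rw [h, zero_pow two_ne_zero] at this
  exact hq.ne' (by exact_mod_cast this.symm)

omit [DecidableEq V] in
/-- The monomial `x ^ α`, normalized by `q ^ (ht α / 2)`. With this normalization the action of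
the Weyl group on monomials does not involve `q`. -/
def sv (q : ℕ) (x : V → ℂ) (α : V → ℤ) : ℂ := sqrtq q ^ height α * monomial x α

omit [DecidableEq V] in
theorem monomial_two_smul (x : V → ℂ) (α : V → ℤ) : monomial x (2 • α) = monomial x α ^ 2 := by
  simp only [monomial, ← Finset.prod_pow]
  refine Finset.prod_congr rfl fun i _ => ?_
  rw [Pi.smul_apply, nsmul_eq_mul, mul_comm, zpow_mul]
  norm_cast

omit [DecidableEq V] in
theorem factorDelta_eq (q : ℕ) (x : V → ℂ) (α : V → ℤ) :
    factorDelta q x α = 1 - sv q x α ^ 2 := by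
  rw [factorDelta, monomial_two_smul, sv, mul_pow, ← sqrtq_sq q]
  congr 2
  rw [← zpow_natCast, ← zpow_natCast, ← zpow_mul, ← zpow_mul, mul_comm]

omit [DecidableEq V] in
theorem factorD_eq {q : ℕ} (hq : 0 < q) (x : V → ℂ) (α : V → ℤ) :
    factorD q x α = 1 - q * sv q x α ^ 2 := by
  have h := factorDelta_eq q x α
  rw [factorDelta, sub_right_inj] at h
  rw [factorD, zpow_add_one₀ (by exact_mod_cast hq.ne'), ← h]
  ring

omit [DecidableEq V] in
theorem sv_eq_prod {q : ℕ} (hq : 0 < q) (x : V → ℂ) (α : V → ℤ) :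
    sv q x α = ∏ i, (sqrtq q * x i) ^ α i := by
  have h : ∀ s : Finset V, ∏ i ∈ s, sqrtq q ^ α i = sqrtq q ^ ∑ i ∈ s, α i := by
    classical
    intro s
    induction s using Finset.induction_on with
    | empty => simp
    | insert i s hi ih =>
      rw [Finset.prod_insert hi, Finset.sum_insert hi, zpow_add₀ (sqrtq_ne_zero hq), ih]
  simp only [mul_zpow, Finset.prod_mul_distrib]
  rw [h, sv, height, monomial]

theorem sv_single {q : ℕ} (hq : 0 < q) (x : V → ℂ) (i : V) :
    sv q x (Pi.single i 1) = sqrtq q * x i := by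
  rw [sv_eq_prod hq, Finset.prod_eq_single i]
  · simp
  · intro j _ hj; simp [hj]
  · simp

theorem sv_sigma {q : ℕ} (hq : 0 < q) {x : V → ℂ} (hx : ∀ i, x i ≠ 0) (i : V) (α : V → ℤ) :
    sv q (sigma Γ q i x) α = sv q x (reflection Γ i α) := by
  have hs := sqrtq_ne_zero hq
  have hs2 := sqrtq_sq q
  have hX : ∀ j, sqrtq q * x j ≠ 0 := fun j => mul_ne_zero hs (hx j)
  rw [sv_eq_prod hq, sv_eq_prod hq]
  have h1 : ∀ j, (sqrtq q * sigma Γ q i x j) ^ α j =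
      (sqrtq q * x i) ^ (if j = i then -α i else if Γ.Adj i j then α j else 0) *
        (if j = i then 1 else (sqrtq q * x j) ^ α j) := by
    intro j
    by_cases hj : j = i
    · subst hj
      simp only [sigma, if_true, mul_one, zpow_neg]
      rw [← inv_zpow]
      congr 1
      rw [← hs2]
      have := hx j
      field_simp
    · by_cases hadj : Γ.Adj i j
      · simp only [sigma, hj, if_false, hadj, if_true]
        rw [← mul_zpow]
        congr 1
        ring
      · simp [sigma, hj, hadj]
  have hz : ∀ (s : Finset V) (e : V → ℤ),
      ∏ j ∈ s, (sqrtq q * x i) ^ e j = (sqrtq q * x i) ^ ∑ j ∈ s, e j := by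
    intro s e
    induction s using Finset.induction_on with
    | empty => simp
    | insert i s hi ih =>
      rw [Finset.prod_insert hi, Finset.sum_insert hi, zpow_add₀ (hX _), ih]
  rw [Finset.prod_congr rfl fun j _ => h1 j, Finset.prod_mul_distrib, hz,
    ← Finset.mul_prod_erase _ (fun j => (sqrtq q * x j) ^ reflection Γ i α j) (Finset.mem_univ i),
    ← Finset.mul_prod_erase _ (fun j => if j = i then 1 else (sqrtq q * x j) ^ α j)
      (Finset.mem_univ i)]
  simp only [if_true, one_mul]
  congr 1
  · congr 1
    rw [← Finset.add_sum_erase _ _ (Finset.mem_univ i)]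
    simp only [if_true, reflection, update_self]
    have h2 : ∑ j ∈ Finset.univ.erase i, (if j = i then -α i else if Γ.Adj i j then α j else 0) =
        ∑ j ∈ Γ.neighborFinset i, α j := by
      have h3 : Γ.neighborFinset i = Finset.filter (fun j => Γ.Adj i j) (Finset.univ.erase i) := by
        ext j
        simp only [SimpleGraph.mem_neighborFinset, Finset.mem_filter, Finset.mem_erase,
          Finset.mem_univ, and_true]
        exact ⟨fun h => ⟨h.ne', h⟩, fun h => h.2⟩
      rw [h3, Finset.sum_filter]
      refine Finset.sum_congr rfl fun j hj => ?_
      rw [if_neg (Finset.ne_of_mem_erase hj)]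
    rw [h2]; ring
  · refine Finset.prod_congr rfl fun j hj => ?_
    have hj' := Finset.ne_of_mem_erase hj
    rw [if_neg hj', reflection_of_ne Γ hj']

theorem sv_epsilon (q : ℕ) (x : V → ℂ) (i : V) (α : V → ℤ) :
    sv q (epsilon Γ i x) α = (-1) ^ (∑ j ∈ Γ.neighborFinset i, α j) * sv q x α := by
  have h1 : ∀ j, epsilon Γ i x j ^ α j = (if Γ.Adj i j then (-1 : ℂ) ^ α j else 1) * x j ^ α j := by
    intro j
    by_cases hadj : Γ.Adj i j
    · simp only [epsilon, hadj, if_true]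
      rw [← mul_zpow]; simp
    · simp [epsilon, hadj]
  have hz : ∀ (s : Finset V), ∏ j ∈ s, (-1 : ℂ) ^ α j = (-1) ^ ∑ j ∈ s, α j := by
    intro s
    induction s using Finset.induction_on with
    | empty => simp
    | insert i s hi ih =>
      rw [Finset.prod_insert hi, Finset.sum_insert hi, zpow_add₀ (by simp), ih]
  simp only [sv, monomial]
  rw [Finset.prod_congr rfl fun j _ => h1 j, Finset.prod_mul_distrib, ← Finset.prod_filter, ← hz,
    show Finset.filter (fun j => Γ.Adj i j) Finset.univ = Γ.neighborFinset i by ext j; simp]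
  ring

theorem sv_epsilon_sq (q : ℕ) (x : V → ℂ) (i : V) (α : V → ℤ) :
    sv q (epsilon Γ i x) α ^ 2 = sv q x α ^ 2 := by
  rw [sv_epsilon, mul_pow, ← zpow_natCast, ← zpow_mul, mul_comm _ ((2 : ℕ) : ℤ), zpow_mul]
  simp

omit [DecidableEq V] in
theorem sv_eq_natPow (q : ℕ) (x : V → ℂ) {α : V → ℤ} (hα : 0 ≤ α) :
    sv q x α = sqrtq q ^ height α * ∏ i, x i ^ (α i).toNat := by
  rw [sv, monomial]
  congr 1
  refine Finset.prod_congr rfl fun i _ => ?_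
  rw [← zpow_natCast, Int.toNat_of_nonneg (hα i)]

omit [DecidableEq V] in
theorem sv_add {q : ℕ} (hq : 0 < q) (x : V → ℂ) {α β : V → ℤ} (hα : 0 ≤ α) (hβ : 0 ≤ β) :
    sv q x (α + β) = sv q x α * sv q x β := by
  rw [sv_eq_natPow q x hα, sv_eq_natPow q x hβ, sv_eq_natPow q x (add_nonneg hα hβ)]
  have h1 : height (α + β) = height α + height β := by simp [height, Finset.sum_add_distrib]
  have h2 : ∀ i, x i ^ ((α + β) i).toNat = x i ^ (α i).toNat * x i ^ (β i).toNat := fun i => by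
    rw [Pi.add_apply, Int.toNat_add (hα i) (hβ i), pow_add]
  rw [h1, zpow_add₀ (sqrtq_ne_zero hq), Finset.prod_congr rfl fun i _ => h2 i,
    Finset.prod_mul_distrib]
  ring

omit [DecidableEq V] in
theorem differentiable_sv (q : ℕ) {α : V → ℤ} (hα : 0 ≤ α) :
    Differentiable ℂ fun x : V → ℂ => sv q x α := by
  simp only [fun x => sv_eq_natPow q x hα]
  rw [← differentiableOn_univ]
  refine DifferentiableOn.const_mul (differentiableOn_finset_prod _ fun i _ => ?_) _
  exact (by fun_prop : Differentiable ℂ fun x : V → ℂ => x i ^ (α i).toNat).differentiableOn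

omit [DecidableEq V] in
theorem norm_sv_mono (q : ℕ) {x y : V → ℂ} (h : ∀ i, ‖y i‖ ≤ ‖x i‖) {α : V → ℤ} (hα : 0 ≤ α) :
    ‖sv q y α‖ ≤ ‖sv q x α‖ := by
  rw [sv_eq_natPow q x hα, sv_eq_natPow q y hα, norm_mul, norm_mul, norm_prod, norm_prod]
  refine mul_le_mul_of_nonneg_left (Finset.prod_le_prod (fun i _ => norm_nonneg _) fun i _ => ?_)
    (norm_nonneg _)
  rw [norm_pow, norm_pow]
  exact pow_le_pow_left₀ (norm_nonneg _) (h i) _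

/-- The properties of the domain `U` on which the average is studied: it is open, complete Reinhardt
(in particular stable under the sign changes `ε_i`), stable under the `σ_i` on the torus, contains
the coordinate axes, and the normalized monomials attached to the positive roots are locally
uniformly summable on it. -/
structure IsGoodDomain (q : ℕ) (U : Set (V → ℂ)) : Prop where
  isOpen : IsOpen U
  reinhardt : ∀ x ∈ U, ∀ y : V → ℂ, (∀ i, ‖y i‖ ≤ ‖x i‖) → y ∈ U
  sigma_mem : ∀ x ∈ U, (∀ i, x i ≠ 0) → ∀ i, sigma Γ q i x ∈ U
  single_mem : ∀ i z, Pi.single i z ∈ U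
  summable : ∀ p ∈ U, ∃ N ∈ 𝓝 p, ∃ κ : posRoots Γ → ℝ, Summable κ ∧
    ∀ γ : posRoots Γ, ∀ x ∈ N, ‖sv q x γ‖ ≤ κ γ

/-! ### The quadratic form and finite type -/

/-- The quadratic form of the root lattice, normalized to be `2` on the simple roots. -/
def rootForm (α : V → ℤ) : ℤ := ∑ k, α k * coroot Γ k α

theorem coroot_symm (α : V → ℤ) (i : V) (t : ℤ) :
    ∑ k, α k * coroot Γ k (Pi.single i t) = t * coroot Γ i α := by
  simp only [coroot_single]
  rw [← Finset.add_sum_erase _ _ (Finset.mem_univ i), if_pos rfl, coroot]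
  have h3 : Γ.neighborFinset i = Finset.filter (fun j => Γ.Adj j i) (Finset.univ.erase i) := by
    ext j
    simp only [SimpleGraph.mem_neighborFinset, Finset.mem_filter, Finset.mem_erase,
      Finset.mem_univ, and_true]
    exact ⟨fun h => ⟨h.ne', h.symm⟩, fun h => h.2.symm⟩
  have : ∑ k ∈ Finset.univ.erase i, α k * (if k = i then 2 * t else if Γ.Adj k i then -t else 0) =
      -t * ∑ j ∈ Γ.neighborFinset i, α j := by
    rw [h3, Finset.sum_filter, Finset.mul_sum]
    refine Finset.sum_congr rfl fun j hj => ?_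
    rw [if_neg (Finset.ne_of_mem_erase hj)]
    split_ifs <;> ring
  rw [this]; ring

theorem rootForm_reflection (i : V) (α : V → ℤ) :
    rootForm Γ (reflection Γ i α) = rootForm Γ α := by
  rw [reflection_eq_sub]
  set t := coroot Γ i α with ht
  have h1 : rootForm Γ (α - Pi.single i t) = rootForm Γ α - ∑ k, α k * coroot Γ k (Pi.single i t)
      - t * coroot Γ i α + t * coroot Γ i (Pi.single i t) := by
    simp only [rootForm, coroot_sub, Pi.sub_apply, mul_sub, sub_mul, Finset.sum_sub_distrib]
    have h2 : ∀ f : V → ℤ, ∑ k, (Pi.single i t : V → ℤ) k * f k = t * f i := by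
      intro f
      rw [Finset.sum_eq_single i] <;> simp +contextual
    rw [h2, h2]; ring
  rw [h1, coroot_symm, coroot_single, if_pos rfl, ← ht]
  ring

variable {Γ} in
/-- All real roots have the same length. -/
theorem IsRoot.rootForm_eq {α : V → ℤ} (hα : IsRoot Γ α) : rootForm Γ α = 2 := by
  induction hα with
  | simple i =>
    rw [rootForm, coroot_symm, coroot_single, if_pos rfl]; norm_num
  | reflect i α _ ih => rw [rootForm_reflection, ih]

theorem cartan_mulVec_apply (v : V → ℝ) (i : V) :
    (cartan Γ).mulVec v i = 2 * v i - ∑ j ∈ Γ.neighborFinset i, v j := by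
  simp [cartan, Matrix.sub_mulVec, Matrix.smul_mulVec, SimpleGraph.adjMatrix_mulVec_apply]

theorem cartan_mulVec_intCast (α : V → ℤ) (i : V) :
    (cartan Γ).mulVec (fun k => (α k : ℝ)) i = coroot Γ i α := by
  rw [cartan_mulVec_apply, coroot]; push_cast; ring

theorem dotProduct_cartan_intCast (α : V → ℤ) :
    (fun k => (α k : ℝ)) ⬝ᵥ (cartan Γ).mulVec (fun k => (α k : ℝ)) = rootForm Γ α := by
  simp only [dotProduct, cartan_mulVec_intCast, rootForm]; push_cast; rfl

omit [DecidableEq V] in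
/-- A quadratic form which is positive on the nonzero vectors of a closed set stable under scaling
has bounded sublevel sets there. -/
theorem exists_norm_le_of_form_le {C : Matrix V V ℝ} {L : Set (V → ℝ)} (hL : IsClosed L)
    (hLs : ∀ v ∈ L, ∀ c : ℝ, c • v ∈ L)
    (hpos : ∀ v ∈ L, v ≠ 0 → 0 < v ⬝ᵥ C.mulVec v) (M : ℝ) :
    ∃ B : ℝ, ∀ v ∈ L, v ⬝ᵥ C.mulVec v ≤ M → ‖v‖ ≤ B := by
  have hcont : Continuous fun v : V → ℝ => v ⬝ᵥ C.mulVec v := by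
    simp only [dotProduct, Matrix.mulVec]; fun_prop
  have hscale : ∀ (c : ℝ) (v : V → ℝ), (c • v) ⬝ᵥ C.mulVec (c • v) = c ^ 2 * (v ⬝ᵥ C.mulVec v) := by
    intro c v
    rw [Matrix.mulVec_smul, smul_dotProduct, dotProduct_smul, smul_eq_mul, smul_eq_mul]; ring
  have hK : IsCompact (Metric.sphere (0 : V → ℝ) 1 ∩ L) := (isCompact_sphere 0 1).inter_right hL
  have hv0 : ∀ v ∈ L, v ≠ 0 → ‖v‖⁻¹ • v ∈ Metric.sphere (0 : V → ℝ) 1 ∩ L := by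
    intro v hv hne
    refine ⟨?_, hLs v hv _⟩
    rw [mem_sphere_zero_iff_norm, norm_smul, norm_inv, norm_norm,
      inv_mul_cancel₀ (norm_ne_zero_iff.2 hne)]
  rcases (Metric.sphere (0 : V → ℝ) 1 ∩ L).eq_empty_or_nonempty with he | hne
  · refine ⟨0, fun v hv _ => ?_⟩
    by_contra hcon
    have hne : v ≠ 0 := by rintro rfl; simp at hcon
    have := hv0 v hv hne
    rw [he] at this
    exact this
  · obtain ⟨u, hu, hmin⟩ := hK.exists_isMinOn hne hcont.continuousOn
    have hu0 : u ≠ 0 := by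
      rintro rfl
      simpa using hu.1
    set c := u ⬝ᵥ C.mulVec u with hc
    have hc0 : 0 < c := hpos u hu.2 hu0
    refine ⟨max 1 (M / c), fun v hv hM => ?_⟩
    by_cases hv1 : ‖v‖ ≤ 1
    · exact hv1.trans (le_max_left _ _)
    · push Not at hv1
      have hne : v ≠ 0 := by rintro rfl; simp at hv1; linarith
      have h1 : c ≤ (‖v‖⁻¹) ^ 2 * (v ⬝ᵥ C.mulVec v) := by
        rw [← hscale]; exact hmin (hv0 v hv hne)
      have h2 : c * ‖v‖ ^ 2 ≤ v ⬝ᵥ C.mulVec v := by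
        have h3 : 0 < ‖v‖ := by linarith
        calc c * ‖v‖ ^ 2 ≤ ((‖v‖⁻¹) ^ 2 * (v ⬝ᵥ C.mulVec v)) * ‖v‖ ^ 2 := by gcongr
          _ = v ⬝ᵥ C.mulVec v := by field_simp
      refine le_max_of_le_right ?_
      rw [le_div_iff₀ hc0]
      nlinarith [mul_pos hc0 (one_pos.trans hv1)]

theorem finite_of_intCast_norm_le {S : Set (V → ℤ)} {B : ℝ}
    (h : ∀ α ∈ S, ‖fun k => (α k : ℝ)‖ ≤ B) : S.Finite := by
  refine (Set.finite_Icc (fun _ => -⌈B⌉) (fun _ => ⌈B⌉) : (Set.Icc (fun _ : V => -⌈B⌉)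
    (fun _ => ⌈B⌉)).Finite).subset fun α hα => ?_
  have h1 : ∀ k, |(α k : ℝ)| ≤ ⌈B⌉ := fun k =>
    ((norm_le_pi_norm (fun k => (α k : ℝ)) k).trans (h α hα)).trans (Int.le_ceil B)
  refine ⟨fun k => ?_, fun k => ?_⟩
  · have := (abs_le.1 (h1 k)).1; exact_mod_cast this
  · have := (abs_le.1 (h1 k)).2; exact_mod_cast this

omit [DecidableEq V] in
theorem exists_bound_sv (q : ℕ) (p : V → ℂ) {α : V → ℤ} (hα : 0 ≤ α) :
    ∃ C : ℝ, 0 ≤ C ∧ ∀ x ∈ Metric.closedBall p 1, ‖sv q x α‖ ≤ C := by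
  obtain ⟨C, hC⟩ := (isCompact_closedBall p 1).exists_bound_of_continuousOn
    (differentiable_sv q hα).continuous.continuousOn
  exact ⟨C, (norm_nonneg _).trans (hC p (by simp)), hC⟩

theorem isGoodDomain_of_isFiniteType (h : IsFiniteType Γ) {q : ℕ} :
    IsGoodDomain Γ q Set.univ where
  isOpen := isOpen_univ
  reinhardt := fun _ _ _ _ => trivial
  sigma_mem := fun _ _ _ _ => trivial
  single_mem := fun _ _ => trivial
  summable := by
    obtain ⟨B, hB⟩ := exists_norm_le_of_form_le (C := cartan Γ) isClosed_univ
      (fun _ _ _ => trivial) (fun v _ hv => by simpa using h.2.dotProduct_mulVec_pos hv) 2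
    have hfin : (posRoots Γ).Finite := finite_of_intCast_norm_le (B := B) fun α hα =>
      hB _ trivial (by rw [dotProduct_cartan_intCast, hα.1.rootForm_eq]; norm_num)
    have : Finite (posRoots Γ) := hfin
    intro p _
    choose C _ hC using fun γ : posRoots Γ => exists_bound_sv q p γ.2.2
    exact ⟨_, Metric.closedBall_mem_nhds p one_pos, C, Summable.of_finite, hC⟩

end

/-! ### Affine type -/

section

open Function Filter

variable {V : Type*} [Fintype V] [DecidableEq V] (Γ : SimpleGraph V) [DecidableRel Γ.Adj]

omit [DecidableEq V] in
theorem sum_mul_coroot_comm (α β : V → ℤ) :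
    ∑ k, α k * coroot Γ k β = ∑ k, β k * coroot Γ k α := by
  have h : ∀ (k : V) (γ : V → ℤ), coroot Γ k γ = 2 * γ k - ∑ j, if Γ.Adj k j then γ j else 0 := by
    intro k γ
    rw [coroot, ← Finset.sum_filter]
    congr 2
    ext j; simp
  simp only [h, mul_sub, Finset.sum_sub_distrib, Finset.mul_sum]
  congr 1
  · exact Finset.sum_congr rfl fun k _ => by ring
  · rw [Finset.sum_comm]
    refine Finset.sum_congr rfl fun k _ => Finset.sum_congr rfl fun j _ => ?_
    simp only [Γ.adj_comm k j]
    split_ifs <;> ring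

theorem reflection_eq_self_iff (i : V) (δ : V → ℤ) :
    reflection Γ i δ = δ ↔ coroot Γ i δ = 0 := by
  rw [reflection_eq_sub]
  constructor
  · intro h
    simpa using congr_fun h i
  · intro h
    simp [h]

variable {Γ}

theorem coroot_eq_zero_of_mem {δ : V → ℤ} (hδ : δ ∈ invariantVectors Γ) (i : V) :
    coroot Γ i δ = 0 := (reflection_eq_self_iff Γ i δ).1 (hδ.2 i)

/-- A nonnegative null vector with a zero coordinate vanishes at the neighbours of that vertex, and
hence everywhere. -/
theorem eq_zero_of_mulVec_eq_zero_of_nonneg (hc : Γ.Connected) {v : V → ℝ} (hv : 0 ≤ v)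
    (h : (cartan Γ).mulVec v = 0) {i : V} (hi : v i = 0) : v = 0 := by
  ext j
  obtain ⟨p⟩ := hc.preconnected i j
  induction p with
  | nil => exact hi
  | @cons a b c hab p ih =>
    refine ih ?_
    have h1 := congr_fun h a
    rw [cartan_mulVec_apply, hi] at h1
    simp only [mul_zero, zero_sub, Pi.zero_apply, neg_eq_zero] at h1
    exact (Finset.sum_eq_zero_iff_of_nonneg fun j _ => hv j).1 h1 b (by simpa using hab)

/-- The null space of a positive semidefinite Cartan matrix is stable under taking absolute values,
because the off-diagonal entries are not positive, so that `|v|` has at most the norm of `v`. -/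
theorem cartan_mulVec_abs (hp : (cartan Γ).PosSemidef) {v : V → ℝ}
    (h : (cartan Γ).mulVec v = 0) : (cartan Γ).mulVec |v| = 0 := by
  rw [← hp.dotProduct_mulVec_zero_iff]
  refine le_antisymm ?_ (by simpa using hp.dotProduct_mulVec_nonneg |v|)
  have h0 : v ⬝ᵥ (cartan Γ).mulVec v = 0 := by rw [h]; simp
  rw [← h0]
  simp only [star_trivial, dotProduct, cartan_mulVec_apply]
  refine Finset.sum_le_sum fun i _ => ?_
  rw [mul_sub, mul_sub, Finset.mul_sum, Finset.mul_sum]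
  refine sub_le_sub (le_of_eq ?_) (Finset.sum_le_sum fun j _ => ?_)
  · simp only [Pi.abs_apply]
    nlinarith [abs_mul_abs_self (v i)]
  · simp only [Pi.abs_apply]
    rw [← abs_mul]
    exact le_abs_self _

theorem eq_zero_of_mulVec_eq_zero (hc : Γ.Connected) (hp : (cartan Γ).PosSemidef) {v : V → ℝ}
    (h : (cartan Γ).mulVec v = 0) {i : V} (hi : v i = 0) : v = 0 := by
  have := eq_zero_of_mulVec_eq_zero_of_nonneg hc (abs_nonneg v) (cartan_mulVec_abs hp h)
    (i := i) (by simp [hi])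
  ext k
  simpa using congr_fun this k

theorem mulVec_intCast_eq_zero {δ : V → ℤ} (h : ∀ i, coroot Γ i δ = 0) :
    (cartan Γ).mulVec (fun k => (δ k : ℝ)) = 0 := by
  ext i
  rw [cartan_mulVec_intCast, h i]; simp

theorem pos_of_mem_invariantVectors (hc : Γ.Connected) {δ : V → ℤ}
    (hδ : δ ∈ invariantVectors Γ) (i : V) : 0 < δ i := by
  refine lt_of_le_of_ne (hδ.1.le i) fun hi => hδ.1.ne' ?_
  have h1 := eq_zero_of_mulVec_eq_zero_of_nonneg hc (v := fun k => (δ k : ℝ))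
    (fun k => by simpa using hδ.1.le k) (mulVec_intCast_eq_zero (coroot_eq_zero_of_mem hδ))
    (i := i) (by simp [← hi])
  ext k
  simpa using congr_fun h1 k

theorem invariantVectors_nonempty (h : IsAffineType Γ) : (invariantVectors Γ).Nonempty := by
  obtain ⟨hc, hp, hdet⟩ := h
  set A : Matrix V V ℤ := (2 : ℤ) • (1 : Matrix V V ℤ) - Γ.adjMatrix ℤ with hA
  have hmap : (Int.castRingHom ℝ).mapMatrix A = cartan Γ := by
    ext i j
    simp only [RingHom.mapMatrix_apply, Matrix.map_apply, hA, cartan, Matrix.sub_apply,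
      Matrix.smul_apply, Matrix.one_apply, SimpleGraph.adjMatrix_apply]
    split_ifs <;> norm_num
  have hdetA : A.det = 0 := by
    have := (Int.castRingHom ℝ).map_det A
    rw [hmap, hdet] at this
    simpa using this
  obtain ⟨v, hv0, hv⟩ := Matrix.exists_mulVec_eq_zero_iff.2 hdetA
  have hv1 : ∀ i, coroot Γ i v = 0 := by
    intro i
    have := congr_fun hv i
    rw [hA] at this
    simpa [Matrix.sub_mulVec, Matrix.smul_mulVec, SimpleGraph.adjMatrix_mulVec_apply, coroot]
      using this
  have h2 := cartan_mulVec_abs hp (mulVec_intCast_eq_zero hv1)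
  refine ⟨|v|, lt_of_le_of_ne (abs_nonneg v) fun h0 => hv0 (by
    ext k; simpa using (congr_fun h0 k).symm), fun i => (reflection_eq_self_iff Γ i _).2 ?_⟩
  have h3 := congr_fun h2 i
  have h4 : |fun k => (v k : ℝ)| = fun k => ((|v| k : ℤ) : ℝ) := by ext k; simp
  rw [h4, cartan_mulVec_intCast] at h3
  simpa using h3

/-- The null space is a line, so the invariant vectors are proportional to each other. -/
theorem exists_isLeast_invariantVectors (h : IsAffineType Γ) :
    ∃ α₀, IsLeast (invariantVectors Γ) α₀ := by
  obtain ⟨i⟩ := h.1.nonempty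
  obtain ⟨δ, hδ, hmin⟩ := exists_minimalFor_of_wellFoundedLT (· ∈ invariantVectors Γ)
    (fun δ => (δ i).toNat) (invariantVectors_nonempty h)
  refine ⟨δ, hδ, fun δ' hδ' k => ?_⟩
  have hi := pos_of_mem_invariantVectors h.1 hδ i
  have hi' := pos_of_mem_invariantVectors h.1 hδ' i
  have hle : δ i ≤ δ' i := by
    by_contra hcon
    have := hmin hδ' (by simp only; omega)
    simp only at this
    omega
  -- the combination of the two vectors which vanishes at `i` is zero
  have h1 := eq_zero_of_mulVec_eq_zero h.1 h.2.1
    (v := (δ i : ℝ) • (fun k => (δ' k : ℝ)) - (δ' i : ℝ) • (fun k => (δ k : ℝ))) (by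
      rw [Matrix.mulVec_sub, Matrix.mulVec_smul, Matrix.mulVec_smul,
        mulVec_intCast_eq_zero (coroot_eq_zero_of_mem hδ),
        mulVec_intCast_eq_zero (coroot_eq_zero_of_mem hδ')]
      simp) (i := i) (by simp; ring)
  have h2 : δ i * δ' k - δ' i * δ k = 0 := by
    have := congr_fun h1 k
    simp only [Pi.sub_apply, Pi.smul_apply, smul_eq_mul, Pi.zero_apply] at this
    exact_mod_cast this
  have h3 := pos_of_mem_invariantVectors h.1 hδ k
  nlinarith

theorem rootForm_sub_of_coroot_eq_zero {δ : V → ℤ} (h : ∀ i, coroot Γ i δ = 0) (α : V → ℤ) :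
    rootForm Γ (α - δ) = rootForm Γ α := by
  have h1 : ∑ k, δ k * coroot Γ k α = 0 := by
    rw [sum_mul_coroot_comm]; simp [h]
  simp [rootForm, coroot_sub, h, sub_mul, Finset.sum_sub_distrib, h1]

/-- In affine type the positive roots lie in finitely many strings `β + n δ`. Subtract `δ` as often
as possible; what remains has a coordinate smaller than that of `δ`, so it is close to the
hyperplane where that coordinate vanishes, on which the form is positive definite. -/
theorem exists_finite_strings (hΓ : IsAffineType Γ) {δ : V → ℤ} (hδ : δ ∈ invariantVectors Γ) :
    ∃ S : Set (V → ℤ), S.Finite ∧ (∀ β ∈ S, 0 ≤ β) ∧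
      ∀ γ ∈ posRoots Γ, ∃ β ∈ S, ∃ n : ℕ, γ = β + n • δ := by
  have hker := coroot_eq_zero_of_mem hδ
  have hpos := pos_of_mem_invariantVectors hΓ.1 hδ
  refine ⟨{β | 0 ≤ β ∧ ¬ δ ≤ β ∧ rootForm Γ β = 2}, ?_, fun β h => h.1, ?_⟩
  · have hsub : {β | 0 ≤ β ∧ ¬ δ ≤ β ∧ rootForm Γ β = 2} ⊆
        ⋃ k, {β : V → ℤ | 0 ≤ β ∧ β k < δ k ∧ rootForm Γ β = 2} := by
      rintro β ⟨h0, h1, h2⟩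
      rw [Pi.le_def] at h1
      push Not at h1
      obtain ⟨k, hk⟩ := h1
      exact Set.mem_iUnion.2 ⟨k, h0, hk, h2⟩
    refine (Set.finite_iUnion fun k => ?_).subset hsub
    obtain ⟨B, hB⟩ := exists_norm_le_of_form_le (C := cartan Γ) (L := {v | v k = 0})
      (isClosed_eq (continuous_apply k) continuous_const) (fun v hv c => by simp_all)
      (fun v hv hne => by
        refine lt_of_le_of_ne (by simpa using hΓ.2.1.dotProduct_mulVec_nonneg v) fun h0 => hne ?_
        refine eq_zero_of_mulVec_eq_zero hΓ.1 hΓ.2.1 ?_ hv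
        rw [← hΓ.2.1.dotProduct_mulVec_zero_iff, star_trivial, ← h0]) 2
    refine finite_of_intCast_norm_le (B := B + ‖fun k => (δ k : ℝ)‖) fun β hβ => ?_
    obtain ⟨h0, hk, h2⟩ := hβ
    set d : V → ℝ := fun k => (δ k : ℝ) with hd
    set b : V → ℝ := fun k => (β k : ℝ) with hb
    -- `b - t d` has the same norm as `b`, and its `k`-th coordinate vanishes
    set t : ℝ := b k / d k with ht
    have hdk : 0 < d k := by simpa [hd] using hpos k
    have hCd : (cartan Γ).mulVec d = 0 := mulVec_intCast_eq_zero hker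
    have ht0 : 0 ≤ t := div_nonneg (by simpa [hb] using h0 k) hdk.le
    have ht1 : t ≤ 1 := by
      rw [ht, div_le_one hdk]; simp only [hb, hd]; exact_mod_cast hk.le
    have hform : (b - t • d) ⬝ᵥ (cartan Γ).mulVec (b - t • d) = 2 := by
      rw [Matrix.mulVec_sub, Matrix.mulVec_smul, hCd, smul_zero, sub_zero, sub_dotProduct,
        smul_dotProduct, hb, dotProduct_cartan_intCast, h2]
      have : d ⬝ᵥ (cartan Γ).mulVec (fun k => (β k : ℝ)) = 0 := by
        simp only [dotProduct, cartan_mulVec_intCast, hd]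
        have h3 : ∑ k, δ k * coroot Γ k β = 0 := by rw [sum_mul_coroot_comm]; simp [hker]
        exact_mod_cast h3
      rw [this]; norm_num
    have h4 := hB (b - t • d) (by simp [ht, hdk.ne']) hform.le
    calc ‖b‖ = ‖(b - t • d) + t • d‖ := by rw [sub_add_cancel]
      _ ≤ ‖b - t • d‖ + ‖t • d‖ := norm_add_le _ _
      _ ≤ B + ‖d‖ := by
        refine add_le_add h4 ?_
        rw [norm_smul, Real.norm_of_nonneg ht0]
        exact mul_le_of_le_one_left (norm_nonneg _) ht1
  · have key : ∀ (m : ℕ) (γ : V → ℤ), 0 ≤ γ → rootForm Γ γ = 2 → (height γ).toNat = m →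
        ∃ β ∈ {β | 0 ≤ β ∧ ¬ δ ≤ β ∧ rootForm Γ β = 2}, ∃ n : ℕ, γ = β + n • δ := by
      intro m
      induction m using Nat.strong_induction_on with
      | _ m ih =>
        intro γ h0 h2 hm
        by_cases hle : δ ≤ γ
        · obtain ⟨i⟩ := hΓ.1.nonempty
          have hh : height (γ - δ) = height γ - height δ := by simp [height]
          have hδh : 0 < height δ := Finset.sum_pos (fun k _ => hpos k) ⟨i, by simp⟩
          have hγh : 0 ≤ height (γ - δ) := Finset.sum_nonneg fun k _ => sub_nonneg.2 (hle k)
          obtain ⟨β, hβ, n, hn⟩ := ih _ (by omega) (γ - δ) (sub_nonneg.2 hle)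
            (by rw [rootForm_sub_of_coroot_eq_zero hker, h2]) rfl
          exact ⟨β, hβ, n + 1, by rw [succ_nsmul, ← add_assoc, ← hn, sub_add_cancel]⟩
        · exact ⟨γ, ⟨h0, hle, h2⟩, 0, by simp⟩
    exact fun γ hγ => key _ γ hγ.2 hγ.1.rootForm_eq rfl

omit [DecidableEq V] in
theorem sv_add_smul {q : ℕ} (hq : 0 < q) (x : V → ℂ) {β δ : V → ℤ} (hβ : 0 ≤ β) (hδ : 0 ≤ δ)
    (n : ℕ) : sv q x (β + n • δ) = sv q x β * sv q x δ ^ n := by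
  induction n with
  | zero => simp
  | succ n ih =>
    rw [succ_nsmul, ← add_assoc, sv_add hq x (add_nonneg hβ (nsmul_nonneg hδ n)) hδ, ih, pow_succ]
    ring

theorem isGoodDomain_of_isAffineType (hΓ : IsAffineType Γ) {q : ℕ} (hq : 0 < q) {δ : V → ℤ}
    (hδ : δ ∈ invariantVectors Γ) : IsGoodDomain Γ q {x | ‖sv q x δ‖ < 1} where
  isOpen := isOpen_lt (differentiable_sv q hδ.1.le).continuous.norm continuous_const
  reinhardt := fun x hx y hy => (norm_sv_mono q hy hδ.1.le).trans_lt hx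
  sigma_mem := fun x hx h0 i => by
    rw [Set.mem_ofPred_eq, sv_sigma Γ hq h0, hδ.2 i]; exact hx
  single_mem := fun i z => by
    have hpos := pos_of_mem_invariantVectors hΓ.1 hδ
    have h1 := coroot_eq_zero_of_mem hδ i
    have h2 := hpos i
    obtain ⟨j, hj⟩ : (Γ.neighborFinset i).Nonempty := by
      rw [Finset.nonempty_iff_ne_empty]
      intro he
      rw [coroot, he, Finset.sum_empty] at h1
      omega
    rw [SimpleGraph.mem_neighborFinset] at hj
    have h3 : sv q (Pi.single i z) δ = 0 := by
      rw [sv, monomial, Finset.prod_eq_zero (Finset.mem_univ j), mul_zero]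
      rw [Pi.single_eq_of_ne hj.ne', zero_zpow _ (hpos j).ne']
    rw [Set.mem_ofPred_eq, h3]; simp
  summable := by
    intro p hp
    obtain ⟨S, hS, hS0, hdec⟩ := exists_finite_strings hΓ hδ
    have : Finite S := hS
    choose β hβ n hn using fun γ : posRoots Γ => hdec γ γ.2
    -- each string contributes a geometric series of ratio `θ < 1`
    obtain ⟨θ, hθ, hθ1⟩ := exists_between (show ‖sv q p δ‖ < 1 from hp)
    have hθ0 : 0 ≤ θ := (norm_nonneg _).trans hθ.le
    choose C hC0 hC using fun b : S => exists_bound_sv q p (hS0 b b.2)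
    have hNopen : {x : V → ℂ | ‖sv q x δ‖ < θ} ∈ 𝓝 p :=
      (isOpen_lt (differentiable_sv q hδ.1.le).continuous.norm continuous_const).mem_nhds hθ
    refine ⟨Metric.closedBall p 1 ∩ {x | ‖sv q x δ‖ < θ},
      inter_mem (Metric.closedBall_mem_nhds p one_pos) hNopen,
      fun γ => C ⟨β γ, hβ γ⟩ * θ ^ n γ, ?_, ?_⟩
    · have h1 : Summable fun bn : S × ℕ => C bn.1 * θ ^ bn.2 :=
        (Summable.of_finite (f := C)).mul_of_nonneg
          (summable_geometric_of_lt_one hθ0 hθ1) hC0 (fun n => pow_nonneg hθ0 n)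
      refine h1.comp_injective (i := fun γ : posRoots Γ => ((⟨β γ, hβ γ⟩, n γ) : S × ℕ)) ?_
      intro γ γ' h
      simp only [Prod.mk.injEq, Subtype.mk.injEq] at h
      ext1
      rw [hn γ, hn γ', h.1, h.2]
    · rintro γ x ⟨hx1, hx2⟩
      have hx2' : ‖sv q x δ‖ ≤ θ := le_of_lt hx2
      rw [hn γ, sv_add_smul hq x (hS0 _ (hβ γ)) hδ.1.le, norm_mul, norm_pow]
      exact mul_le_mul (hC ⟨β γ, hβ γ⟩ x hx1) (pow_le_pow_left₀ (norm_nonneg _) hx2' _)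
        (by positivity) (hC0 _)

omit [DecidableEq V] in
theorem norm_sv_lt_one_iff {q : ℕ} (hq : 0 < q) (x : V → ℂ) (δ : V → ℤ) :
    ‖sv q x δ‖ < 1 ↔ ‖monomial x δ‖ < (q : ℝ) ^ (-(height δ : ℝ) / 2) := by
  have hq' : (0 : ℝ) < q := by exact_mod_cast hq
  have h1 : ‖sqrtq q ^ height δ‖ = (q : ℝ) ^ ((height δ : ℝ) / 2) := by
    rw [norm_zpow, sqrtq, Complex.norm_real, Real.norm_of_nonneg (Real.sqrt_nonneg _),
      Real.sqrt_eq_rpow, ← Real.rpow_intCast, ← Real.rpow_mul hq'.le]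
    congr 1; ring
  rw [sv, norm_mul, h1, neg_div, Real.rpow_neg hq'.le, ← one_div,
    lt_div_iff₀ (Real.rpow_pos_of_pos hq' _), mul_comm]

end

/-! ### Relations between the slash operators -/

section

open Function Filter

variable {V : Type*} [Fintype V] [DecidableEq V] (Γ : SimpleGraph V) [DecidableRel Γ.Adj]

/-- The coefficient of `f (σ_i x)` in `(f | σ_i)(x)`, where `t = x_i`. -/
def slashCoeff (q : ℕ) (t : ℂ) : ℂ :=
  ((1 - t⁻¹) * (1 - q * t)⁻¹ + (sqrtq q)⁻¹ * t⁻¹) / 2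

/-- The coefficient of `f (ε_i σ_i x)` in `(f | σ_i)(x)`, where `t = x_i`. -/
def slashCoeffNeg (q : ℕ) (t : ℂ) : ℂ :=
  ((1 - t⁻¹) * (1 - q * t)⁻¹ - (sqrtq q)⁻¹ * t⁻¹) / 2

omit [Fintype V] in
theorem slash_apply (q : ℕ) (f : (V → ℂ) → ℂ) (i : V) (x : V → ℂ) :
    slash Γ q f i x = slashCoeff q (x i) * f (sigma Γ q i x)
      + slashCoeffNeg q (x i) * f (epsilon Γ i (sigma Γ q i x)) := by
  simp only [slash, evenPart, oddPart, slashCoeff, slashCoeffNeg]; ring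

omit [Fintype V] [DecidableEq V] in
@[simp]
theorem epsilon_epsilon (i : V) (x : V → ℂ) : epsilon Γ i (epsilon Γ i x) = x := by
  ext k; simp only [epsilon]; split_ifs <;> simp

omit [Fintype V] [DecidableEq V] in
theorem epsilon_comm (i j : V) (x : V → ℂ) :
    epsilon Γ j (epsilon Γ i x) = epsilon Γ i (epsilon Γ j x) := by
  ext k; simp only [epsilon]; split_ifs <;> simp

omit [Fintype V] in
theorem sigma_epsilon_self (q : ℕ) (i : V) (x : V → ℂ) :
    sigma Γ q i (epsilon Γ i x) = epsilon Γ i (sigma Γ q i x) := by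
  ext k
  by_cases hk : k = i
  · subst hk; simp [sigma, epsilon]
  · by_cases h : Γ.Adj i k <;> simp [sigma, epsilon, hk, h]

omit [Fintype V] in
theorem sigma_epsilon_of_adj (q : ℕ) {i j : V} (hij : Γ.Adj i j) (x : V → ℂ) :
    sigma Γ q j (epsilon Γ i x) = epsilon Γ i (epsilon Γ j (sigma Γ q j x)) := by
  ext k
  by_cases hk : k = j
  · subst hk; simp [sigma, epsilon, hij]
  · by_cases h : Γ.Adj i k <;> by_cases h' : Γ.Adj j k <;> simp [sigma, epsilon, hk, h, h', hij]

omit [Fintype V] in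
theorem sigma_epsilon_of_not_adj (q : ℕ) {i j : V} (hij : ¬Γ.Adj i j) (x : V → ℂ) :
    sigma Γ q j (epsilon Γ i x) = epsilon Γ i (sigma Γ q j x) := by
  ext k
  by_cases hk : k = j
  · subst hk; simp [sigma, epsilon, hij]
  · by_cases h : Γ.Adj i k <;> by_cases h' : Γ.Adj j k <;> simp [sigma, epsilon, hk, h, h', hij]

omit [Fintype V] in
theorem sigma_self (q : ℕ) (i : V) (x : V → ℂ) : sigma Γ q i x i = (q : ℂ)⁻¹ * (x i)⁻¹ := by
  simp [sigma]

omit [Fintype V] in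
theorem sigma_of_adj (q : ℕ) {i j : V} (h : Γ.Adj i j) (x : V → ℂ) :
    sigma Γ q i x j = sqrtq q * x i * x j := by
  simp [sigma, h.ne', h]

omit [Fintype V] in
theorem sigma_of_not_adj (q : ℕ) {i j : V} (hij : j ≠ i) (h : ¬Γ.Adj i j) (x : V → ℂ) :
    sigma Γ q i x j = x j := by
  simp [sigma, hij, h]

omit [Fintype V] [DecidableEq V] in
theorem epsilon_self (i : V) (x : V → ℂ) : epsilon Γ i x i = x i := by simp [epsilon]

omit [Fintype V] [DecidableEq V] in
theorem epsilon_of_adj {i j : V} (h : Γ.Adj i j) (x : V → ℂ) : epsilon Γ i x j = -x j := by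
  simp [epsilon, h]

omit [Fintype V] [DecidableEq V] in
theorem epsilon_of_not_adj {i j : V} (h : ¬Γ.Adj i j) (x : V → ℂ) : epsilon Γ i x j = x j := by
  simp [epsilon, h]

omit [Fintype V] in
theorem sigma_ne_zero {q : ℕ} (hq : 0 < q) {x : V → ℂ} (hx : ∀ k, x k ≠ 0) (i k : V) :
    sigma Γ q i x k ≠ 0 := by
  have hq' : (q : ℂ) ≠ 0 := by exact_mod_cast hq.ne'
  simp only [sigma]
  split_ifs
  · exact mul_ne_zero (inv_ne_zero hq') (inv_ne_zero (hx i))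
  · exact mul_ne_zero (mul_ne_zero (sqrtq_ne_zero hq) (hx i)) (hx k)
  · exact hx k

omit [Fintype V] [DecidableEq V] in
theorem epsilon_ne_zero {x : V → ℂ} (hx : ∀ k, x k ≠ 0) (i k : V) : epsilon Γ i x k ≠ 0 := by
  simp only [epsilon]
  split_ifs
  · exact neg_ne_zero.2 (hx k)
  · exact hx k

/-- The normalized monomials separate points, so that relations between the `σ_i` follow from those
between the reflections. -/
theorem eq_of_sv_eq {q : ℕ} (hq : 0 < q) {x y : V → ℂ} (h : ∀ α, sv q x α = sv q y α) :
    x = y := by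
  ext i
  have := h (Pi.single i 1)
  rw [sv_single hq, sv_single hq] at this
  exact mul_left_cancel₀ (sqrtq_ne_zero hq) this

theorem sigma_braid {q : ℕ} (hq : 0 < q) {i j : V} (h : Γ.Adj i j) {x : V → ℂ}
    (hx : ∀ k, x k ≠ 0) : sigma Γ q i (sigma Γ q j (sigma Γ q i x)) =
      sigma Γ q j (sigma Γ q i (sigma Γ q j x)) := by
  refine eq_of_sv_eq hq fun α => ?_
  have h1 := sigma_ne_zero Γ hq hx
  have h2 := fun k l => sigma_ne_zero Γ hq (h1 k) l
  rw [sv_sigma Γ hq (h2 i j), sv_sigma Γ hq (h1 i), sv_sigma Γ hq hx, sv_sigma Γ hq (h2 j i),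
    sv_sigma Γ hq (h1 j), sv_sigma Γ hq hx, reflection_braid Γ h]

theorem sigma_comm {q : ℕ} (hq : 0 < q) {i j : V} (hij : i ≠ j) (h : ¬Γ.Adj i j) {x : V → ℂ}
    (hx : ∀ k, x k ≠ 0) : sigma Γ q i (sigma Γ q j x) = sigma Γ q j (sigma Γ q i x) := by
  refine eq_of_sv_eq hq fun α => ?_
  have h1 := sigma_ne_zero Γ hq hx
  rw [sv_sigma Γ hq (h1 j), sv_sigma Γ hq hx, sv_sigma Γ hq (h1 i), sv_sigma Γ hq hx,
    reflection_comm Γ hij h]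

theorem sigma_sigma {q : ℕ} (hq : 0 < q) (i : V) {x : V → ℂ} (hx : ∀ k, x k ≠ 0) :
    sigma Γ q i (sigma Γ q i x) = x := by
  refine eq_of_sv_eq hq fun α => ?_
  rw [sv_sigma Γ hq (sigma_ne_zero Γ hq hx i), sv_sigma Γ hq hx, reflection_reflection]

theorem slashCoeff_eq {q : ℕ} (hq : 0 < q) {t s : ℂ} (ht : sqrtq q * t = s) (hs : s ≠ 0)
    (h : 1 - sqrtq q * s ≠ 0) :
    slashCoeff q t = (1 - sqrtq q) * (1 + s) / (2 * s * (1 - sqrtq q * s)) := by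
  have hr := sqrtq_ne_zero hq
  have ht' : t = (sqrtq q)⁻¹ * s := by rw [← ht, inv_mul_cancel_left₀ hr]
  rw [slashCoeff, ← sqrtq_sq q, ht', pow_two, mul_assoc, mul_inv_cancel_left₀ hr]
  field_simp
  ring

theorem slashCoeffNeg_eq {q : ℕ} (hq : 0 < q) {t s : ℂ} (ht : sqrtq q * t = s) (hs : s ≠ 0)
    (h : 1 - sqrtq q * s ≠ 0) :
    slashCoeffNeg q t = (1 + sqrtq q) * (s - 1) / (2 * s * (1 - sqrtq q * s)) := by
  have hr := sqrtq_ne_zero hq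
  have ht' : t = (sqrtq q)⁻¹ * s := by rw [← ht, inv_mul_cancel_left₀ hr]
  rw [slashCoeffNeg, ← sqrtq_sq q, ht', pow_two, mul_assoc, mul_inv_cancel_left₀ hr]
  field_simp
  ring

/-- The slash operator of `i` is an involution. The excluded values of `x i` are those where the
denominator vanishes at `σ_i x`, respectively at `x`. -/
theorem slash_slash {q : ℕ} (hq : 0 < q) (f : (V → ℂ) → ℂ) (i : V) {x : V → ℂ}
    (hx : ∀ k, x k ≠ 0) (h1 : x i ≠ 1) (h2 : q * x i ≠ 1) :
    slash Γ q (slash Γ q f i) i x = f x := by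
  have hr := sqrtq_ne_zero hq
  have hrq := sqrtq_sq q
  simp only [slash_apply, sigma_epsilon_self, epsilon_epsilon, sigma_sigma Γ hq i hx, epsilon_self,
    sigma_self, slashCoeff, slashCoeffNeg]
  have hq' : (q : ℂ) ≠ 0 := by exact_mod_cast hq.ne'
  have ha := hx i
  generalize x i = a at *
  have hA : ((1 - a⁻¹) * (1 - q * a)⁻¹) * ((1 - (((q : ℂ))⁻¹ * a⁻¹)⁻¹) *
      (1 - q * ((q : ℂ)⁻¹ * a⁻¹))⁻¹) = 1 := by
    rw [mul_inv_cancel_left₀ hq', mul_inv, inv_inv, inv_inv]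
    have h3 : (1 : ℂ) - q * a ≠ 0 := fun h => h2 (sub_eq_zero.1 h).symm
    have h4 : 1 - a⁻¹ ≠ 0 := fun h => h1 (inv_eq_one.1 (sub_eq_zero.1 h).symm)
    rw [mul_mul_mul_comm, mul_comm (1 - q * a)⁻¹, mul_mul_mul_comm, mul_inv_cancel₀ h4,
      mul_inv_cancel₀ h3, one_mul]
  have hB : ((sqrtq q)⁻¹ * a⁻¹) * ((sqrtq q)⁻¹ * ((q : ℂ)⁻¹ * a⁻¹)⁻¹) = 1 := by
    rw [← hrq]; field_simp
  linear_combination (f x + f (epsilon Γ i x)) / 2 * hA + (f x - f (epsilon Γ i x)) / 2 * hB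

theorem slash_comm {q : ℕ} (hq : 0 < q) (f : (V → ℂ) → ℂ) {i j : V} (hij : i ≠ j)
    (h : ¬Γ.Adj i j) {x : V → ℂ} (hx : ∀ k, x k ≠ 0) :
    slash Γ q (slash Γ q f i) j x = slash Γ q (slash Γ q f j) i x := by
  have h' : ¬Γ.Adj j i := fun h' => h h'.symm
  simp only [slash_apply, sigma_epsilon_of_not_adj Γ q h, sigma_epsilon_of_not_adj Γ q h',
    sigma_of_not_adj Γ q hij h', sigma_of_not_adj Γ q hij.symm h, epsilon_of_not_adj Γ h,
    epsilon_of_not_adj Γ h', sigma_comm Γ hq hij h hx, epsilon_comm Γ i j]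
  ring

/-- The braid relation for the slash operators, at the value of `f` twisted by both sign changes.
Here `r = √q`, and `s`, `t`, `s t` are the normalized monomials of the three positive roots. -/
theorem braid_identity_both {r s t : ℂ} (hs : s ≠ 0) (ht : t ≠ 0) (h1 : 1 - r * s ≠ 0)
    (h2 : 1 + r * s ≠ 0) (h3 : 1 - r * t ≠ 0) (h4 : 1 + r * t ≠ 0) (h5 : 1 - r * s * t ≠ 0)
    (h6 : 1 + r * s * t ≠ 0) :
      ((1 + r) * (s - 1) / (2 * s * (1 - r * s))) *
        ((1 - r) * (1 + -(s * t)) / (-(2 * (s * t)) * (1 + r * (s * t)))) *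
        ((1 + r) * (-t - 1) / (-(2 * t) * (1 + r * t))) +
      ((1 - r) * (1 + s) / (2 * s * (1 - r * s))) *
        ((1 + r) * ((s * t) - 1) / (2 * (s * t) * (1 - r * (s * t)))) *
        ((1 - r) * (1 + -t) / (-(2 * t) * (1 + r * t))) =
      ((1 + r) * (t - 1) / (2 * t * (1 - r * t))) *
        ((1 - r) * (1 + -(s * t)) / (-(2 * (s * t)) * (1 + r * (s * t)))) *
        ((1 + r) * (-s - 1) / (-(2 * s) * (1 + r * s))) +
      ((1 - r) * (1 + t) / (2 * t * (1 - r * t))) *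
        ((1 + r) * ((s * t) - 1) / (2 * (s * t) * (1 - r * (s * t)))) *
        ((1 - r) * (1 + -s) / (-(2 * s) * (1 + r * s))) := by
  field_simp
  ring

/-- The braid relation for the slash operators, at the value of `f` twisted by the sign change
`ε_i`, in the notation of `braid_identity_both`. -/
theorem braid_identity_single {r s t : ℂ} (hs : s ≠ 0) (ht : t ≠ 0) (h1 : 1 - r * s ≠ 0)
    (h2 : 1 + r * s ≠ 0) (h3 : 1 - r * t ≠ 0) (h5 : 1 - r * s * t ≠ 0)
    (h6 : 1 + r * s * t ≠ 0) :
      ((1 - r) * (1 + s) / (2 * s * (1 - r * s))) *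
        ((1 - r) * (1 + (s * t)) / (2 * (s * t) * (1 - r * (s * t)))) *
        ((1 + r) * (t - 1) / (2 * t * (1 - r * t))) +
      ((1 + r) * (s - 1) / (2 * s * (1 - r * s))) *
        ((1 + r) * (-(s * t) - 1) / (-(2 * (s * t)) * (1 + r * (s * t)))) *
        ((1 - r) * (1 + t) / (2 * t * (1 - r * t))) =
      ((1 + r) * (t - 1) / (2 * t * (1 - r * t))) *
        ((1 - r) * (1 + -(s * t)) / (-(2 * (s * t)) * (1 + r * (s * t)))) *
        ((1 - r) * (1 + -s) / (-(2 * s) * (1 + r * s))) +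
      ((1 - r) * (1 + t) / (2 * t * (1 - r * t))) *
        ((1 + r) * ((s * t) - 1) / (2 * (s * t) * (1 - r * (s * t)))) *
        ((1 + r) * (-s - 1) / (-(2 * s) * (1 + r * s))) := by
  field_simp
  ring

/-- The braid relation. Both sides are combinations of four values of `f`, at the images of one
point under the group generated by `ε_i` and `ε_j`; the untwisted value has the same coefficient on
both sides, and the other three are the identities above. -/
theorem slash_braid {q : ℕ} (hq : 0 < q) (f : (V → ℂ) → ℂ) {i j : V} (h : Γ.Adj i j) {x : V → ℂ}
    (hx : ∀ k, x k ≠ 0) (h1 : q * sv q x (Pi.single i 1) ^ 2 ≠ 1)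
    (h2 : q * sv q x (Pi.single j 1) ^ 2 ≠ 1)
    (h3 : q * sv q x (Pi.single i 1 + Pi.single j 1) ^ 2 ≠ 1) :
    slash Γ q (slash Γ q (slash Γ q f i) j) i x = slash Γ q (slash Γ q (slash Γ q f j) i) j x := by
  have hr := sqrtq_ne_zero hq
  have hrq := sqrtq_sq q
  rw [sv_single hq, ← hrq] at h1 h2
  rw [sv_add hq x (Pi.single_nonneg.2 zero_le_one) (Pi.single_nonneg.2 zero_le_one),
    sv_single hq, sv_single hq, ← hrq] at h3
  simp only [slash_apply, sigma_epsilon_self, sigma_epsilon_of_adj Γ q h,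
    sigma_epsilon_of_adj Γ q h.symm, epsilon_epsilon, epsilon_comm Γ i j,
    sigma_of_adj Γ q h, sigma_of_adj Γ q h.symm, sigma_self, epsilon_self, epsilon_of_adj Γ h,
    epsilon_of_adj Γ h.symm, sigma_braid Γ hq h hx]
  generalize f (sigma Γ q j (sigma Γ q i (sigma Γ q j x))) = f₀
  generalize f (epsilon Γ i (sigma Γ q j (sigma Γ q i (sigma Γ q j x)))) = f₁
  generalize f (epsilon Γ j (sigma Γ q j (sigma Γ q i (sigma Γ q j x)))) = f₂
  generalize f (epsilon Γ i (epsilon Γ j (sigma Γ q j (sigma Γ q i (sigma Γ q j x))))) = f₃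
  have hi := hx i
  have hj := hx j
  have e1 : sqrtq q * (sqrtq q * x i * x j) * ((q : ℂ)⁻¹ * (x i)⁻¹) = x j := by
    rw [← hrq]; field_simp
  have e2 : sqrtq q * (sqrtq q * x j * x i) * ((q : ℂ)⁻¹ * (x j)⁻¹) = x i := by
    rw [← hrq]; field_simp
  rw [e1, e2, mul_right_comm _ (x j) (x i)]
  have hs : sqrtq q * x i ≠ 0 := mul_ne_zero hr hi
  have ht : sqrtq q * x j ≠ 0 := mul_ne_zero hr hj
  obtain ⟨s, hs'⟩ : ∃ s, sqrtq q * x i = s := ⟨_, rfl⟩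
  obtain ⟨t, ht'⟩ : ∃ t, sqrtq q * x j = t := ⟨_, rfl⟩
  have hst' : sqrtq q * (sqrtq q * x i * x j) = s * t := by rw [← hs', ← ht']; ring
  rw [hs'] at h1 h3 hs
  rw [ht'] at h2 h3 ht
  have hsq : ∀ z : ℂ, sqrtq q ^ 2 * z ^ 2 ≠ 1 → 1 - sqrtq q * z ≠ 0 ∧ 1 + sqrtq q * z ≠ 0 := by
    intro z hz
    constructor <;> intro h0 <;> apply hz
    · linear_combination (-1 - sqrtq q * z) * h0
    · linear_combination (sqrtq q * z - 1) * h0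
  obtain ⟨d1, d2⟩ := hsq s h1
  obtain ⟨d3, d4⟩ := hsq t h2
  obtain ⟨d5, d6⟩ := hsq _ h3
  have hn : ∀ {z u : ℂ}, sqrtq q * z = u → sqrtq q * -z = -u := fun h => by rw [mul_neg, h]
  have hd : ∀ {z : ℂ}, 1 + sqrtq q * z ≠ 0 → 1 - sqrtq q * -z ≠ 0 := fun h => by
    rwa [mul_neg, sub_neg_eq_add]
  have hst : s * t ≠ 0 := mul_ne_zero hs ht
  rw [slashCoeff_eq hq hs' hs d1, slashCoeff_eq hq ht' ht d3, slashCoeff_eq hq hst' hst d5,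
    slashCoeff_eq hq (hn hs') (neg_ne_zero.2 hs) (hd d2),
    slashCoeff_eq hq (hn ht') (neg_ne_zero.2 ht) (hd d4),
    slashCoeff_eq hq (hn hst') (neg_ne_zero.2 hst) (hd d6),
    slashCoeffNeg_eq hq hs' hs d1, slashCoeffNeg_eq hq ht' ht d3, slashCoeffNeg_eq hq hst' hst d5,
    slashCoeffNeg_eq hq (hn hs') (neg_ne_zero.2 hs) (hd d2),
    slashCoeffNeg_eq hq (hn ht') (neg_ne_zero.2 ht) (hd d4),
    slashCoeffNeg_eq hq (hn hst') (neg_ne_zero.2 hst) (hd d6)]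
  generalize sqrtq q = r at *
  rw [← mul_assoc] at d5 d6
  simp only [mul_neg, sub_neg_eq_add]
  have k1 := braid_identity_both hs ht d1 d2 d3 d4 d5 d6
  have k2 := braid_identity_single hs ht d1 d2 d3 d5 d6
  have k3 := braid_identity_single ht hs d3 d4 d1 (by rwa [mul_right_comm] at d5)
    (by rwa [mul_right_comm] at d6)
  rw [mul_comm t s] at k3
  linear_combination f₃ * k1 + f₁ * k2 - f₂ * k3

end

/-! ### The Chinta-Gunnells action -/

section

open Function Filter MulOpposite

variable {V : Type*} [Fintype V] [DecidableEq V] (Γ : SimpleGraph V) [DecidableRel Γ.Adj]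

/-- The points of the torus at which none of the factors `1 - u_α` and `1 - q u_α`, for `α` a
positive or negative root, vanishes, where `u_α = q ^ (ht α) x ^ (2 α)`. -/
def regularSet (q : ℕ) : Set (V → ℂ) :=
  {x | (∀ i, x i ≠ 0) ∧ ∀ α, IsRoot Γ α → sv q x α ^ 2 ≠ 1 ∧ q * sv q x α ^ 2 ≠ 1}

theorem sigma_mem_regularSet {q : ℕ} (hq : 0 < q) {x : V → ℂ} (hx : x ∈ regularSet Γ q) (i : V) :
    sigma Γ q i x ∈ regularSet Γ q :=
  ⟨sigma_ne_zero Γ hq hx.1 i, fun α hα => by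
    rw [sv_sigma Γ hq hx.1]; exact hx.2 _ (.reflect i α hα)⟩

theorem epsilon_mem_regularSet {q : ℕ} {x : V → ℂ} (hx : x ∈ regularSet Γ q) (i : V) :
    epsilon Γ i x ∈ regularSet Γ q :=
  ⟨epsilon_ne_zero Γ hx.1 i, fun α hα => by rw [sv_epsilon_sq]; exact hx.2 α hα⟩

omit [DecidableEq V] in
theorem sv_neg {q : ℕ} (hq : 0 < q) (x : V → ℂ) (α : V → ℤ) : sv q x (-α) = (sv q x α)⁻¹ := by
  simp [sv_eq_prod hq]

theorem slash_congr {q : ℕ} (hq : 0 < q) {f g : (V → ℂ) → ℂ}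
    (h : ∀ y ∈ regularSet Γ q, f y = g y) {x : V → ℂ} (hx : x ∈ regularSet Γ q) (i : V) :
    slash Γ q f i x = slash Γ q g i x := by
  have h1 := sigma_mem_regularSet Γ hq hx i
  rw [slash_apply, slash_apply, h _ h1, h _ (epsilon_mem_regularSet Γ h1 i)]

theorem slash_slash_regular {q : ℕ} (hq : 0 < q) (f : (V → ℂ) → ℂ) (i : V) {x : V → ℂ}
    (hx : x ∈ regularSet Γ q) : slash Γ q (slash Γ q f i) i x = f x := by
  have hq' : (q : ℂ) ≠ 0 := by exact_mod_cast hq.ne'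
  have h1 := (hx.2 _ (.simple i)).2
  have h2 := (hx.2 _ (IsRoot.reflect i _ (.simple i))).2
  rw [reflection_single_self, sv_neg hq] at h2
  rw [sv_single hq, inv_pow, mul_pow, sqrtq_sq] at h2
  rw [sv_single hq, mul_pow, sqrtq_sq] at h1
  refine slash_slash Γ hq f i hx.1 (fun h => h2 ?_) (fun h => h1 ?_)
  · rw [h]; field_simp
  · linear_combination (q * x i + 1) * h

/-- Extension by zero of a function on the regular set. -/
def extendZero {q : ℕ} (f : regularSet Γ q → ℂ) (x : V → ℂ) : ℂ := by
  classical exact if h : x ∈ regularSet Γ q then f ⟨x, h⟩ else 0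

theorem extendZero_apply {q : ℕ} (f : regularSet Γ q → ℂ) {x : V → ℂ} (h : x ∈ regularSet Γ q) :
    extendZero Γ f x = f ⟨x, h⟩ := by simp [extendZero, h]

/-- The operator `f ↦ f | σ_i` on functions on the regular set. -/
def slashOn (q : ℕ) (i : V) : Function.End (regularSet Γ q → ℂ) :=
  fun f x => slash Γ q (extendZero Γ f) i x

theorem extendZero_slashOn {q : ℕ} (i : V) (f : regularSet Γ q → ℂ) {x : V → ℂ}
    (hx : x ∈ regularSet Γ q) :
    extendZero Γ (slashOn Γ q i f) x = slash Γ q (extendZero Γ f) i x := by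
  rw [extendZero_apply Γ _ hx]; rfl

/-- The Chinta-Gunnells action of the Weyl group on functions on the regular set. It is a right
action, hence the opposite monoid. -/
def slashHom {q : ℕ} (hq : 0 < q) :
    (coxeterMatrix Γ).Group →* (Function.End (regularSet Γ q → ℂ))ᵐᵒᵖ :=
  (weylSystem Γ).lift ⟨fun i => op (slashOn Γ q i), isLiftable_coxeterMatrix Γ
    (fun i => by
      rw [← op_mul, ← op_one]
      congr 1
      funext f x
      exact (slash_congr Γ hq (fun y hy => extendZero_slashOn Γ i f hy) x.2 i).trans
        ((slash_slash_regular Γ hq _ i x.2).trans (extendZero_apply Γ f x.2)))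
    (fun i j h => by
      have key : ∀ i j, (slashOn Γ q i * (slashOn Γ q j * slashOn Γ q i) :
          Function.End (regularSet Γ q → ℂ)) = fun (f : regularSet Γ q → ℂ) (x : regularSet Γ q) =>
            slash Γ q (slash Γ q (slash Γ q (extendZero Γ f) i) j) i x := by
        intro i j
        funext f x
        refine slash_congr Γ hq (fun y hy => ?_) x.2 i
        refine (extendZero_slashOn Γ j _ hy).trans ?_
        exact slash_congr Γ hq (fun z hz => extendZero_slashOn Γ i _ hz) hy j
      rw [← op_mul, ← op_mul, ← op_mul, ← op_mul]
      congr 1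
      rw [key, key]
      funext f x
      have h3 := (x.2.2 _ (IsRoot.reflect i _ (.simple j))).2
      rw [reflection_single_of_adj Γ h] at h3
      exact slash_braid Γ hq _ h x.2.1 (x.2.2 _ (.simple i)).2 (x.2.2 _ (.simple j)).2 h3)
    (fun i j hij h => by
      have key : ∀ i j, (slashOn Γ q i * slashOn Γ q j : Function.End (regularSet Γ q → ℂ)) =
          fun (f : regularSet Γ q → ℂ) (x : regularSet Γ q) =>
              slash Γ q (slash Γ q (extendZero Γ f) j) i x := by
        intro i j
        funext f x
        exact slash_congr Γ hq (fun y hy => extendZero_slashOn Γ j _ hy) x.2 i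
      rw [← op_mul, ← op_mul]
      congr 1
      rw [key, key]
      funext f x
      exact slash_comm Γ hq _ hij h x.2.1)⟩

omit [Fintype V] in
theorem oneSlash_concat (q : ℕ) (ω : List V) (i : V) :
    oneSlash Γ q (ω ++ [i]) = slash Γ q (oneSlash Γ q ω) i := by
  simp [oneSlash]

theorem oneSlash_eq_slashHom {q : ℕ} (hq : 0 < q) (ω : List V) {x : V → ℂ}
    (hx : x ∈ regularSet Γ q) : oneSlash Γ q ω x =
      extendZero Γ ((slashHom Γ hq ((weylSystem Γ).wordProd ω)).unop fun _ => 1) x := by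
  induction ω using List.reverseRecOn generalizing x with
  | nil =>
    rw [CoxeterSystem.wordProd_nil, map_one, extendZero_apply Γ _ hx]
    rfl
  | append_singleton ω i ih =>
    rw [CoxeterSystem.wordProd_append, CoxeterSystem.wordProd_singleton, map_mul, unop_mul,
      oneSlash_concat, slash_congr Γ hq (fun y hy => ih hy) hx]
    conv_rhs => rw [slashHom, CoxeterSystem.lift_apply_simple]
    exact (extendZero_slashOn Γ i _ hx).symm

/-- On the regular set `1 | w` does not depend on the word for `w`. -/
theorem oneSlash_congr {q : ℕ} (hq : 0 < q) {ω ω' : List V}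
    (h : (weylSystem Γ).wordProd ω = (weylSystem Γ).wordProd ω') {x : V → ℂ}
    (hx : x ∈ regularSet Γ q) : oneSlash Γ q ω x = oneSlash Γ q ω' x := by
  rw [oneSlash_eq_slashHom Γ hq ω hx, oneSlash_eq_slashHom Γ hq ω' hx, h]

omit [Fintype V] in
theorem act_concat (q : ℕ) (ω : List V) (i : V) (x : V → ℂ) :
    act Γ q (ω ++ [i]) x = act Γ q ω (sigma Γ q i x) := by
  simp [act]

omit [Fintype V] in
theorem act_ne_zero {q : ℕ} (hq : 0 < q) (ω : List V) {x : V → ℂ} (hx : ∀ k, x k ≠ 0) :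
    ∀ k, act Γ q ω x k ≠ 0 := by
  induction ω with
  | nil => exact hx
  | cons i ω ih => exact sigma_ne_zero Γ hq ih i

theorem sv_act {q : ℕ} (hq : 0 < q) (ω : List V) {x : V → ℂ} (hx : ∀ k, x k ≠ 0) (α : V → ℤ) :
    sv q (act Γ q ω x) α =
      sv q x (rootAction Γ ((weylSystem Γ).wordProd ω)⁻¹ α) := by
  induction ω generalizing α with
  | nil => simp [act]
  | cons i ω ih =>
    change sv q (sigma Γ q i (act Γ q ω x)) α = _
    rw [sv_sigma Γ hq (act_ne_zero Γ hq ω hx), ih, CoxeterSystem.wordProd_cons, mul_inv_rev,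
      CoxeterSystem.inv_simple, rootAction_mul_simple]

theorem act_congr {q : ℕ} (hq : 0 < q) {ω ω' : List V}
    (h : (weylSystem Γ).wordProd ω = (weylSystem Γ).wordProd ω') {x : V → ℂ}
    (hx : ∀ k, x k ≠ 0) : act Γ q ω x = act Γ q ω' x :=
  eq_of_sv_eq hq fun α => by rw [sv_act Γ hq ω hx, sv_act Γ hq ω' hx, h]

/-! ### Numerators of the slash operators -/

/-- `s (s - √q) (1 + √q s)`: the product of `u (1 - q u)`, `u = s²`, with the coefficient of the
even part in the slash operator. -/
def numEven (q : ℕ) (s : ℂ) : ℂ := s * (s - sqrtq q) * (1 + sqrtq q * s)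

/-- `s (1 - q s²)`: the product of `u (1 - q u)`, `u = s²`, with the coefficient of the
odd part in the slash operator. -/
def numOdd (q : ℕ) (s : ℂ) : ℂ := s * (1 - q * s ^ 2)

/-- The sign by which `ε_i` multiplies the monomial `x ^ γ`. -/
def epsSign (i : V) (γ : V → ℤ) : ℂ := (-1) ^ (∑ j ∈ Γ.neighborFinset i, γ j)

/-- The numerator of `1 | w` for a word of `w`, as a polynomial in the normalized monomials
`s γ` attached to the inversions `γ` of `w`; the denominator is `∏ u_γ (1 - q u_γ)`. -/
def slashNum (q : ℕ) (ω : List V) : ((V → ℤ) → ℂ) → ℂ :=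
  ω.foldl (fun g i s =>
    (numEven q (s (Pi.single i 1)) + numOdd q (s (Pi.single i 1))) / 2 *
        g (fun γ => s (reflection Γ i γ)) +
      (numEven q (s (Pi.single i 1)) - numOdd q (s (Pi.single i 1))) / 2 *
        g (fun γ => epsSign Γ i γ * s (reflection Γ i γ)))
    (fun _ => 1)

theorem slashNum_concat (q : ℕ) (ω : List V) (i : V) (s : (V → ℤ) → ℂ) :
    slashNum Γ q (ω ++ [i]) s =
      (numEven q (s (Pi.single i 1)) + numOdd q (s (Pi.single i 1))) / 2 *
        slashNum Γ q ω (fun γ => s (reflection Γ i γ)) +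
      (numEven q (s (Pi.single i 1)) - numOdd q (s (Pi.single i 1))) / 2 *
        slashNum Γ q ω (fun γ => epsSign Γ i γ * s (reflection Γ i γ)) := by
  simp [slashNum]

theorem slashCoeff_mul {q : ℕ} (hq : 0 < q) {t s : ℂ} (hs : sqrtq q * t = s) (hs0 : s ≠ 0)
    (h : q * s ^ 2 ≠ 1) :
    s ^ 2 * (1 - q * s ^ 2) * slashCoeff q t = (numEven q s + numOdd q s) / 2 := by
  have h1 : 1 - sqrtq q * s ≠ 0 := fun h0 => h (by
    rw [← sqrtq_sq]; linear_combination (-1 - sqrtq q * s) * h0)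
  rw [slashCoeff_eq hq hs hs0 h1, numEven, numOdd, ← sqrtq_sq]
  rw [← mul_div_assoc, div_eq_div_iff (mul_ne_zero (mul_ne_zero two_ne_zero hs0) h1) two_ne_zero]
  ring

theorem slashCoeffNeg_mul {q : ℕ} (hq : 0 < q) {t s : ℂ} (hs : sqrtq q * t = s) (hs0 : s ≠ 0)
    (h : q * s ^ 2 ≠ 1) :
    s ^ 2 * (1 - q * s ^ 2) * slashCoeffNeg q t = (numEven q s - numOdd q s) / 2 := by
  have h1 : 1 - sqrtq q * s ≠ 0 := fun h0 => h (by
    rw [← sqrtq_sq]; linear_combination (-1 - sqrtq q * s) * h0)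
  rw [slashCoeffNeg_eq hq hs hs0 h1, numEven, numOdd, ← sqrtq_sq]
  rw [← mul_div_assoc, div_eq_div_iff (mul_ne_zero (mul_ne_zero two_ne_zero hs0) h1) two_ne_zero]
  ring

theorem slashNum_sv {q : ℕ} (hq : 0 < q) (ω : List V) {x : V → ℂ} (hx : ∀ k, x k ≠ 0)
    (h : ∀ γ ∈ invRoots Γ ω, q * sv q x γ ^ 2 ≠ 1) :
    slashNum Γ q ω (sv q x) =
      ((invRoots Γ ω).map fun γ => sv q x γ ^ 2 * (1 - q * sv q x γ ^ 2)).prod *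
        oneSlash Γ q ω x := by
  induction ω using List.reverseRecOn generalizing x with
  | nil => simp [slashNum, invRoots, oneSlash]
  | append_singleton ω i ih =>
    rw [invRoots_concat] at h ⊢
    have h1 : ∀ γ, sv q x (reflection Γ i γ) = sv q (sigma Γ q i x) γ :=
      fun γ => (sv_sigma Γ hq hx i γ).symm
    have h2 : ∀ γ, epsSign Γ i γ * sv q (sigma Γ q i x) γ =
        sv q (epsilon Γ i (sigma Γ q i x)) γ := fun γ => (sv_epsilon Γ q _ i γ).symm
    have hσ := sigma_ne_zero Γ hq hx i
    have h3 : ∀ γ ∈ invRoots Γ ω, q * sv q (sigma Γ q i x) γ ^ 2 ≠ 1 := fun γ hγ => by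
      rw [← h1]
      exact h _ (List.mem_cons_of_mem _ (List.mem_map_of_mem hγ))
    rw [slashNum_concat, oneSlash_concat, slash_apply]
    simp only [h1, h2]
    rw [ih hσ h3, ih (epsilon_ne_zero Γ hσ i) (fun γ hγ => by rw [sv_epsilon_sq]; exact h3 γ hγ)]
    have hs := sv_single hq x i
    have hs0 : sv q x (Pi.single i 1) ≠ 0 := by
      rw [hs]; exact mul_ne_zero (sqrtq_ne_zero hq) (hx i)
    have h4 := h _ List.mem_cons_self
    rw [← slashCoeff_mul hq hs.symm hs0 h4, ← slashCoeffNeg_mul hq hs.symm hs0 h4, List.map_cons,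
      List.prod_cons, List.map_map]
    simp only [comp_def, h1, sv_epsilon_sq]
    ring

theorem differentiableOn_slashNum (q : ℕ) (ω : List V) {N : Set (V → ℂ)}
    {s : (V → ℂ) → (V → ℤ) → ℂ}
    (h : ∀ γ ∈ invRoots Γ ω, DifferentiableOn ℂ (fun x => s x γ) N) :
    DifferentiableOn ℂ (fun x => slashNum Γ q ω (s x)) N := by
  induction ω using List.reverseRecOn generalizing s with
  | nil => simp only [slashNum, List.foldl_nil]; exact differentiableOn_const _
  | append_singleton ω i ih =>
    rw [invRoots_concat] at h
    simp only [slashNum_concat, numEven, numOdd]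
    have h0 := h _ List.mem_cons_self
    have h1 : ∀ γ ∈ invRoots Γ ω, DifferentiableOn ℂ (fun x => s x (reflection Γ i γ)) N :=
      fun γ hγ => h _ (List.mem_cons_of_mem _ (List.mem_map_of_mem hγ))
    have h2 := ih h1
    have h3 := ih (s := fun x γ => epsSign Γ i γ * s x (reflection Γ i γ))
      fun γ hγ => (h1 γ hγ).const_mul _
    fun_prop

/-- A bound for the two coefficients in the recursion for `slashNum`. -/
def numBound (q : ℕ) (t : ℝ) : ℝ := t * ((t + √q) * (1 + √q * t) + (1 + q * t ^ 2))

theorem numBound_nonneg (q : ℕ) {t : ℝ} (ht : 0 ≤ t) : 0 ≤ numBound q t := by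
  unfold numBound; positivity

theorem numBound_mono (q : ℕ) {t t' : ℝ} (ht : 0 ≤ t) (h : t ≤ t') :
    numBound q t ≤ numBound q t' := by
  have := ht.trans h
  unfold numBound
  gcongr

theorem norm_sqrtq (q : ℕ) : ‖sqrtq q‖ = √q := by
  rw [sqrtq, Complex.norm_real, Real.norm_of_nonneg (Real.sqrt_nonneg _)]

theorem norm_num_add_norm_num_le (q : ℕ) (s : ℂ) :
    ‖(numEven q s + numOdd q s) / 2‖ + ‖(numEven q s - numOdd q s) / 2‖ ≤ numBound q ‖s‖ := by
  have h1 : ‖numEven q s‖ ≤ ‖s‖ * ((‖s‖ + √q) * (1 + √q * ‖s‖)) := by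
    rw [numEven, norm_mul, norm_mul, mul_assoc]
    gcongr
    · exact (norm_sub_le _ _).trans (by rw [norm_sqrtq])
    · exact (norm_add_le _ _).trans (by rw [norm_mul, norm_sqrtq, norm_one])
  have h2 : ‖numOdd q s‖ ≤ ‖s‖ * (1 + q * ‖s‖ ^ 2) := by
    rw [numOdd, norm_mul]
    gcongr
    refine (norm_sub_le _ _).trans ?_
    simp
  rw [norm_div, norm_div, Complex.norm_two, numBound, mul_add]
  have h3 := norm_add_le (numEven q s) (numOdd q s)
  have h4 := norm_sub_le (numEven q s) (numOdd q s)
  linarith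

theorem norm_slashNum_le (q : ℕ) (ω : List V) (s : (V → ℤ) → ℂ) :
    ‖slashNum Γ q ω s‖ ≤ ((invRoots Γ ω).map fun γ => numBound q ‖s γ‖).prod := by
  induction ω using List.reverseRecOn generalizing s with
  | nil => simp [slashNum, invRoots]
  | append_singleton ω i ih =>
    rw [invRoots_concat, slashNum_concat, List.map_cons, List.prod_cons, List.map_map]
    have h1 := ih fun γ => s (reflection Γ i γ)
    have h2 := ih fun γ => epsSign Γ i γ * s (reflection Γ i γ)
    have h3 : ∀ γ, ‖epsSign Γ i γ * s (reflection Γ i γ)‖ = ‖s (reflection Γ i γ)‖ := fun γ => by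
      rw [norm_mul, epsSign, norm_zpow]; simp
    simp only [h3] at h2
    refine (norm_add_le _ _).trans ?_
    rw [norm_mul, norm_mul]
    have hP : 0 ≤ ((invRoots Γ ω).map fun γ => numBound q ‖s (reflection Γ i γ)‖).prod :=
      (norm_nonneg _).trans h1
    refine (add_le_add (mul_le_mul_of_nonneg_left h1 (norm_nonneg _))
      (mul_le_mul_of_nonneg_left h2 (norm_nonneg _))).trans ?_
    rw [← add_mul]
    exact mul_le_mul_of_nonneg_right (norm_num_add_norm_num_le q _) hP

end

/-! ### Products over the positive roots -/

section

open Function Filter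

variable {V : Type*} [Fintype V] [DecidableEq V] (Γ : SimpleGraph V) [DecidableRel Γ.Adj]

/-- The product of the factors `1 - c u_γ`, where `u_γ = q ^ (ht γ) x ^ (2 γ)`, over the positive
roots `γ` outside of the finite set `L`. With `L = ∅` it is `D` for `c = q` and `Δ` for `c = 1`. -/
def rootProd (q : ℕ) (c : ℂ) (L : Finset (V → ℤ)) (x : V → ℂ) : ℂ :=
  ∏' γ : posRoots Γ, (1 + if (γ : V → ℤ) ∈ L then 0 else -(c * sv q x γ ^ 2))

theorem weylD_eq {q : ℕ} (hq : 0 < q) (x : V → ℂ) : weylD Γ q x = rootProd Γ q q ∅ x := by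
  simp [weylD, rootProd, factorD_eq hq, sub_eq_add_neg]

theorem weylDelta_eq (q : ℕ) (x : V → ℂ) : weylDelta Γ q x = rootProd Γ q 1 ∅ x := by
  simp [weylDelta, rootProd, factorDelta_eq, sub_eq_add_neg]

variable {Γ} {q : ℕ} {U : Set (V → ℂ)}

theorem IsGoodDomain.summable_norm_sv (hU : IsGoodDomain Γ q U) {x : V → ℂ} (hx : x ∈ U) :
    Summable fun γ : posRoots Γ => ‖sv q x γ‖ := by
  obtain ⟨N, hN, κ, hκ, h⟩ := hU.summable x hx
  exact hκ.of_nonneg_of_le (fun _ => norm_nonneg _) fun γ => h γ x (mem_of_mem_nhds hN)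

omit [DecidableEq V] in
theorem norm_rootFactor_le (c : ℂ) (L : Finset (V → ℤ)) {γ : V → ℤ} {x : V → ℂ} {t : ℝ}
    (h : ‖sv q x γ‖ ≤ t) :
    ‖if γ ∈ L then (0 : ℂ) else -(c * sv q x γ ^ 2)‖ ≤ ‖c‖ * t ^ 2 := by
  split_ifs
  · rw [norm_zero]; positivity
  · rw [norm_neg, norm_mul, norm_pow]; gcongr

theorem summable_sq_of_summable {ι : Type*} {κ : ι → ℝ} (h0 : ∀ i, 0 ≤ κ i) (h : Summable κ) :
    Summable fun i => κ i ^ 2 := by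
  refine (h.mul_left (∑' i, κ i)).of_nonneg_of_le (fun i => sq_nonneg _) fun i => ?_
  rw [sq]
  exact mul_le_mul_of_nonneg_right (h.le_tsum i fun j _ => h0 j) (h0 i)

theorem IsGoodDomain.summable_rootFactor (hU : IsGoodDomain Γ q U) (c : ℂ) (L : Finset (V → ℤ))
    {x : V → ℂ} (hx : x ∈ U) :
    Summable fun γ : posRoots Γ =>
      ‖if (γ : V → ℤ) ∈ L then (0 : ℂ) else -(c * sv q x γ ^ 2)‖ :=
  ((summable_sq_of_summable (fun _ => norm_nonneg _) (hU.summable_norm_sv hx)).mul_left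
    ‖c‖).of_nonneg_of_le (fun _ => norm_nonneg _) fun _ => norm_rootFactor_le c L le_rfl

theorem IsGoodDomain.multipliable_rootFactor (hU : IsGoodDomain Γ q U) (c : ℂ)
    (L : Finset (V → ℤ)) {x : V → ℂ} (hx : x ∈ U) : Multipliable fun γ : posRoots Γ =>
      (1 + if (γ : V → ℤ) ∈ L then (0 : ℂ) else -(c * sv q x γ ^ 2)) :=
  multipliable_one_add_of_summable (hU.summable_rootFactor c L hx)

theorem IsGoodDomain.differentiableOn_rootProd (hU : IsGoodDomain Γ q U) (c : ℂ)
    (L : Finset (V → ℤ)) : DifferentiableOn ℂ (rootProd Γ q c L) U := by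
  refine differentiableOn_tprod_one_add hU.isOpen (fun γ => ?_) fun p hp => ?_
  · split_ifs
    · exact differentiableOn_const _
    · exact (((differentiable_sv q γ.2.2).differentiableOn.pow 2).const_mul c).neg
  · obtain ⟨N, hN, κ, hκ, h⟩ := hU.summable p hp
    have hκ0 : ∀ γ, 0 ≤ κ γ := fun γ => (norm_nonneg _).trans (h γ p (mem_of_mem_nhds hN))
    exact ⟨N, hN, fun γ => ‖c‖ * κ γ ^ 2, (summable_sq_of_summable hκ0 hκ).mul_left _,
      fun γ x hx => norm_rootFactor_le c L (h γ x hx)⟩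

theorem norm_tprod_one_add_le_exp {ι : Type*} {f : ι → ℂ} {u : ι → ℝ} (hu : Summable u)
    (h : ∀ i, ‖f i‖ ≤ u i) : ‖∏' i, (1 + f i)‖ ≤ Real.exp (∑' i, u i) := by
  have hf : Summable fun i => ‖f i‖ := hu.of_nonneg_of_le (fun _ => norm_nonneg _) h
  refine le_of_tendsto ((multipliable_one_add_of_summable hf).hasProd.norm)
    (Eventually.of_forall fun s => ?_)
  calc ∏ i ∈ s, ‖1 + f i‖ ≤ ∏ i ∈ s, (1 + u i) :=
        Finset.prod_le_prod (fun _ _ => norm_nonneg _) fun i _ =>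
          (norm_add_le _ _).trans (by rw [norm_one]; gcongr; exact h i)
    _ ≤ Real.exp (∑ i ∈ s, u i) :=
        Real.prod_one_add_le_exp_sum _ fun i => (norm_nonneg _).trans (h i)
    _ ≤ _ := Real.exp_le_exp.2 (hu.sum_le_tsum s fun i _ => (norm_nonneg _).trans (h i))

theorem IsGoodDomain.rootProd_ne_zero (hU : IsGoodDomain Γ q U) (c : ℂ) (L : Finset (V → ℤ))
    {x : V → ℂ} (hx : x ∈ U) (h : ∀ γ ∈ posRoots Γ, γ ∉ L → c * sv q x γ ^ 2 ≠ 1) :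
    rootProd Γ q c L x ≠ 0 := by
  refine tprod_one_add_ne_zero_of_summable (fun γ => ?_) (hU.summable_rootFactor c L hx)
  split_ifs with hγ
  · simp
  · intro h0
    exact h γ γ.2 hγ (by linear_combination -h0)

theorem IsGoodDomain.rootProd_mul_prod (hU : IsGoodDomain Γ q U) (c : ℂ) {L : Finset (V → ℤ)}
    (hL : ∀ γ ∈ L, γ ∈ posRoots Γ) {x : V → ℂ} (hx : x ∈ U) :
    rootProd Γ q c L x * ∏ γ ∈ L, (1 - c * sv q x γ ^ 2) = rootProd Γ q c ∅ x := by
  classical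
  set g : posRoots Γ → ℂ := fun γ => if (γ : V → ℤ) ∈ L then 1 - c * sv q x γ ^ 2 else 1 with hg
  have h1 : ∀ γ ∉ L.subtype (· ∈ posRoots Γ), g γ = 1 := fun γ hγ => by
    rw [Finset.mem_subtype] at hγ
    simp [hg, hγ]
  have h2 : ∏' γ, g γ = ∏ γ ∈ L, (1 - c * sv q x γ ^ 2) := by
    rw [tprod_eq_prod h1, ← Finset.prod_subtype_of_mem _ hL]
    refine Finset.prod_congr rfl fun γ hγ => ?_
    rw [Finset.mem_subtype] at hγ
    simp [hg, hγ]
  rw [← h2, rootProd, ← (hU.multipliable_rootFactor c L hx).tprod_mul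
    (multipliable_of_ne_finset_one h1), rootProd]
  refine tprod_congr fun γ => ?_
  by_cases hγ : (γ : V → ℤ) ∈ L
  · simp [hg, hγ, sub_eq_add_neg]
  · simp [hg, hγ]

theorem IsGoodDomain.rootProd_eq_zero (hU : IsGoodDomain Γ q U) (c : ℂ) {γ : V → ℤ}
    (hγ : γ ∈ posRoots Γ) {x : V → ℂ} (hx : x ∈ U) (h : c * sv q x γ ^ 2 = 1) :
    rootProd Γ q c ∅ x = 0 := by
  rw [← hU.rootProd_mul_prod c (L := {γ}) (by simpa using hγ) hx, Finset.prod_singleton, h]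
  simp

theorem rootProd_epsilon (c : ℂ) (L : Finset (V → ℤ)) (i : V) (x : V → ℂ) :
    rootProd Γ q c L (epsilon Γ i x) = rootProd Γ q c L x := by
  simp only [rootProd, sv_epsilon_sq]

/-- The reflection `σ_i` permutes the positive roots different from `e_i`. -/
theorem rootProd_single_sigma (hq : 0 < q) (c : ℂ) (i : V) {x : V → ℂ} (hx : ∀ k, x k ≠ 0) :
    rootProd Γ q c {Pi.single i 1} (sigma Γ q i x) = rootProd Γ q c {Pi.single i 1} x := by
  set r : posRoots Γ → posRoots Γ := fun γ =>
    if h : (γ : V → ℤ) = Pi.single i 1 then γ else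
      ⟨reflection Γ i γ, reflection_mem_posRoots Γ γ.2 h⟩ with hr
  have hinv : Function.Involutive r := by
    intro γ
    by_cases h : (γ : V → ℤ) = Pi.single i 1
    · simp [hr, h]
    · have h' := reflection_ne_single Γ γ.2 (i := i)
      simp [hr, h, h']
  rw [rootProd, rootProd, ← (hinv.toPerm r).tprod_eq]
  refine tprod_congr fun γ => ?_
  by_cases h : (γ : V → ℤ) = Pi.single i 1
  · simp [hr, h]
  · have h' := reflection_ne_single Γ γ.2 (i := i)
    simp [hr, h, h', sv_sigma Γ hq hx]

theorem IsGoodDomain.rootProd_sigma (hU : IsGoodDomain Γ q U) (hq : 0 < q) (c : ℂ) (i : V)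
    {x : V → ℂ} (hxU : x ∈ U) (hx : ∀ k, x k ≠ 0) :
    rootProd Γ q c ∅ (sigma Γ q i x) * (1 - c * sv q x (Pi.single i 1) ^ 2) =
      rootProd Γ q c ∅ x * (1 - c * (sv q x (Pi.single i 1) ^ 2)⁻¹) := by
  have hL : ∀ γ ∈ ({Pi.single i 1} : Finset (V → ℤ)), γ ∈ posRoots Γ := by
    simpa using single_mem_posRoots Γ i
  rw [← hU.rootProd_mul_prod c hL hxU, ← hU.rootProd_mul_prod c hL (hU.sigma_mem x hxU hx i),
    rootProd_single_sigma hq c i hx, Finset.prod_singleton, Finset.prod_singleton,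
    sv_sigma Γ hq hx, reflection_single_self, sv_neg hq, inv_pow]
  ring

omit [DecidableEq V] in
theorem sv_ne_zero (hq : 0 < q) {x : V → ℂ} (hx : ∀ k, x k ≠ 0) (α : V → ℤ) : sv q x α ≠ 0 := by
  rw [sv_eq_prod hq, Finset.prod_ne_zero_iff]
  exact fun i _ => zpow_ne_zero _ (mul_ne_zero (sqrtq_ne_zero hq) (hx i))

/-- The Weyl denominator is antisymmetric, up to a monomial. -/
theorem IsGoodDomain.delta_sigma (hU : IsGoodDomain Γ q U) (hq : 0 < q) (i : V)
    {x : V → ℂ} (hxU : x ∈ U) (hx : ∀ k, x k ≠ 0) :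
    rootProd Γ q 1 ∅ (sigma Γ q i x) * -sv q x (Pi.single i 1) ^ 2 = rootProd Γ q 1 ∅ x := by
  have hL : ∀ γ ∈ ({Pi.single i 1} : Finset (V → ℤ)), γ ∈ posRoots Γ := by
    simpa using single_mem_posRoots Γ i
  rw [← hU.rootProd_mul_prod 1 hL hxU, ← hU.rootProd_mul_prod 1 hL (hU.sigma_mem x hxU hx i),
    rootProd_single_sigma hq 1 i hx, Finset.prod_singleton, Finset.prod_singleton,
    sv_sigma Γ hq hx, reflection_single_self, sv_neg hq, inv_pow]
  have := sv_ne_zero hq hx (Pi.single i 1)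
  field_simp
  ring

theorem IsGoodDomain.delta_act (hU : IsGoodDomain Γ q U) (hq : 0 < q) (ω : List V)
    {x : V → ℂ} (hxU : x ∈ U) (hx : ∀ k, x k ≠ 0) :
    rootProd Γ q 1 ∅ (act Γ q ω x) * ((invRoots Γ ω).map fun γ => -sv q x γ ^ 2).prod =
      rootProd Γ q 1 ∅ x := by
  induction ω using List.reverseRecOn generalizing x with
  | nil => simp [act, invRoots]
  | append_singleton ω i ih =>
    have h := ih (hU.sigma_mem x hxU hx i) (sigma_ne_zero Γ hq hx i)
    simp only [sv_sigma Γ hq hx] at h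
    rw [act_concat, invRoots_concat, List.map_cons, List.prod_cons, List.map_map,
      ← hU.delta_sigma hq i hxU hx, ← h]
    simp only [comp_def]
    ring

theorem IsGoodDomain.delta_act_epsilon (hU : IsGoodDomain Γ q U) (hq : 0 < q) (ω : List V) (i : V)
    {x : V → ℂ} (hxU : x ∈ U) (hx : ∀ k, x k ≠ 0) :
    rootProd Γ q 1 ∅ (act Γ q ω (epsilon Γ i x)) = rootProd Γ q 1 ∅ (act Γ q ω x) := by
  have hεU : epsilon Γ i x ∈ U := hU.reinhardt x hxU _ fun k => by
    simp only [epsilon]; split_ifs <;> simp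
  have h1 := hU.delta_act hq ω hεU (epsilon_ne_zero Γ hx i)
  have h2 := hU.delta_act hq ω hxU hx
  simp only [sv_epsilon_sq, rootProd_epsilon] at h1
  rw [← h2] at h1
  refine mul_right_cancel₀ ?_ h1
  rw [Ne, List.prod_eq_zero_iff, List.mem_map]
  rintro ⟨γ, _, h⟩
  exact pow_ne_zero 2 (sv_ne_zero hq hx γ) (neg_eq_zero.1 h)

end

/-! ### Density of the regular set -/

section

open Function Filter

variable {V : Type*} [Fintype V] [DecidableEq V] {Γ : SimpleGraph V} [DecidableRel Γ.Adj]
  {q : ℕ} {U : Set (V → ℂ)}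

/-- The one-parameter subgroup with weights `m`, acting on `x`. It multiplies a monomial `x ^ α` by
a power of `t`, which makes it convenient for moving a point off a hypersurface `u_α = c`, or along
it. -/
def scale (x : V → ℂ) (m : V → ℤ) (t : ℝ) : V → ℂ := fun k => x k * (t : ℂ) ^ m k

omit [Fintype V] [DecidableEq V] in
theorem tendsto_scale (x : V → ℂ) (m : V → ℤ) : Tendsto (scale x m) (𝓝[>] 1) (𝓝 x) := by
  have h : Tendsto (scale x m) (𝓝 1) (𝓝 (scale x m 1)) := by
    refine tendsto_pi_nhds.2 fun k => ?_
    have h1 : ContinuousAt (fun t : ℝ => (t : ℂ) ^ m k) 1 :=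
      Complex.continuous_ofReal.continuousAt.zpow₀ (m k) (.inl (by simp))
    exact h1.const_mul (x k)
  have h2 : scale x m 1 = x := by ext k; simp [scale]
  rw [h2] at h
  exact h.mono_left nhdsWithin_le_nhds

omit [DecidableEq V] in
theorem sv_scale (hq : 0 < q) (x : V → ℂ) (m : V → ℤ) {t : ℝ} (ht : 1 < t) (α : V → ℤ) :
    sv q (scale x m t) α = (t : ℂ) ^ (∑ k, m k * α k) * sv q x α := by
  have ht0 : (t : ℂ) ≠ 0 := by exact_mod_cast (zero_lt_one.trans ht).ne'
  have hz : ∀ (s : Finset V) (e : V → ℤ), ∏ k ∈ s, (t : ℂ) ^ e k = (t : ℂ) ^ ∑ k ∈ s, e k := by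
    classical
    intro s e
    induction s using Finset.induction_on with
    | empty => simp
    | insert i s hi ih => rw [Finset.prod_insert hi, Finset.sum_insert hi, zpow_add₀ ht0, ih]
  rw [sv_eq_prod hq, sv_eq_prod hq, ← hz, ← Finset.prod_mul_distrib]
  refine Finset.prod_congr rfl fun k _ => ?_
  rw [scale, zpow_mul, ← mul_zpow]
  congr 1; ring

omit [DecidableEq V] in
theorem sv_scale_of_eq_zero (hq : 0 < q) (x : V → ℂ) {m : V → ℤ} {t : ℝ} (ht : 1 < t) {α : V → ℤ}
    (h : ∑ k, m k * α k = 0) : sv q (scale x m t) α = sv q x α := by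
  rw [sv_scale hq x m ht, h, zpow_zero, one_mul]

omit [DecidableEq V] in
theorem sv_scale_sq_ne (hq : 0 < q) {x : V → ℂ} {m : V → ℤ} {t : ℝ} (ht : 1 < t) {α : V → ℤ}
    (h : ∑ k, m k * α k ≠ 0) {c : ℂ} (hc : c ≠ 0) (hx : sv q x α ^ 2 = c) :
    sv q (scale x m t) α ^ 2 ≠ c := by
  intro h1
  rw [sv_scale hq x m ht, mul_pow, hx, mul_eq_right₀ hc, ← zpow_natCast, ← zpow_mul] at h1
  have h2 : t ^ ((∑ k, m k * α k) * ((2 : ℕ) : ℤ)) = t ^ (0 : ℤ) := by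
    rw [zpow_zero]; exact_mod_cast h1
  have h3 := zpow_right_injective₀ (zero_lt_one.trans ht) ht.ne' h2
  simp [h] at h3

omit [Fintype V] [DecidableEq V] in
theorem eq_zero_of_scale {f : (V → ℂ) → ℂ} {x : V → ℂ} (hf : ContinuousAt f x) (m : V → ℤ)
    (h : ∀ᶠ t in 𝓝[>] (1 : ℝ), f (scale x m t) = 0) : f x = 0 :=
  tendsto_nhds_unique (hf.tendsto.comp (tendsto_scale x m))
    (tendsto_const_nhds.congr' (h.mono fun _ ht => ht.symm))

theorem dense_setOf_sv_sq_ne (hq : 0 < q) {α : V → ℤ} (hα : α ≠ 0) {c : ℂ} (hc : c ≠ 0) :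
    Dense {x : V → ℂ | sv q x α ^ 2 ≠ c} := by
  intro x
  by_cases hx : sv q x α ^ 2 = c
  · obtain ⟨i, hi⟩ := Function.ne_iff.1 hα
    refine mem_closure_of_tendsto (tendsto_scale x (Pi.single i 1)) ?_
    filter_upwards [self_mem_nhdsWithin] with t ht
    refine sv_scale_sq_ne hq ht ?_ hc hx
    rw [Finset.sum_eq_single i] <;> simp +contextual
    exact hi
  · exact subset_closure hx

/-- By the Baire category theorem, since there are countably many roots. -/
theorem dense_regularSet (hq : 0 < q) : Dense (regularSet Γ q) := by
  have hq' : (q : ℂ) ≠ 0 := by exact_mod_cast hq.ne'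
  have hopen : ∀ (α : posRoots Γ) (c : ℂ), IsOpen {x : V → ℂ | sv q x α ^ 2 ≠ c} := fun α c =>
    isOpen_ne_fun ((differentiable_sv q α.2.2).continuous.pow 2) continuous_const
  have hd : ∀ c : ℂ, c ≠ 0 → Dense (⋂ α : posRoots Γ, {x : V → ℂ | sv q x α ^ 2 ≠ c}) :=
    fun c hc => dense_iInter_of_isOpen (fun α => hopen α c)
      fun α => dense_setOf_sv_sq_ne hq α.2.1.ne_zero hc
  have hG : ∀ c : ℂ, IsGδ (⋂ α : posRoots Γ, {x : V → ℂ | sv q x α ^ 2 ≠ c}) := fun c =>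
    IsGδ.iInter_of_isOpen fun α => hopen α c
  have hG0 : IsGδ (⋂ i : V, {x : V → ℂ | x i ≠ 0}) := IsGδ.iInter_of_isOpen fun i =>
    isOpen_ne_fun (continuous_apply i) continuous_const
  have hd0 : Dense (⋂ i : V, {x : V → ℂ | x i ≠ 0}) := by
    refine dense_iInter_of_isOpen
      (fun i => isOpen_ne_fun (continuous_apply i) continuous_const) fun i => ?_
    exact (dense_compl_singleton (0 : ℂ)).preimage (isOpenMap_eval i)
  refine ((hd0.inter_of_Gδ hG0 (hG 1) (hd 1 one_ne_zero)).inter_of_Gδ (hG0.inter (hG 1))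
    ((hG (q : ℂ)⁻¹).inter (hG q)) ((hd _ (inv_ne_zero hq')).inter_of_Gδ (hG _) (hG _)
      (hd _ hq'))).mono ?_
  rintro x ⟨⟨h0, h1⟩, h2, h3⟩
  simp only [Set.mem_iInter, Set.mem_ofPred_eq] at h0 h1 h2 h3
  have hpos : ∀ α ∈ posRoots Γ, sv q x α ^ 2 ≠ 1 ∧ sv q x α ^ 2 ≠ (q : ℂ)⁻¹ ∧
      sv q x α ^ 2 ≠ q := fun α hα => ⟨h1 ⟨α, hα⟩, h2 ⟨α, hα⟩, h3 ⟨α, hα⟩⟩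
  refine ⟨h0, fun α hα => ?_⟩
  rcases hα.nonneg_or_nonpos with h | h
  · obtain ⟨a, b, -⟩ := hpos α ⟨hα, h⟩
    exact ⟨a, fun hc => b (eq_inv_of_mul_eq_one_right hc)⟩
  · have hneg : IsRoot Γ (-α) := by
      obtain ⟨w, i, rfl⟩ := (isRoot_iff Γ α).1 hα
      rw [← map_neg, ← reflection_single_self Γ]
      exact isRoot_rootAction Γ (.reflect i _ (.simple i)) w
    obtain ⟨a, -, b⟩ := hpos (-α) ⟨hneg, neg_nonneg.2 h⟩
    rw [sv_neg hq, inv_pow] at a b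
    refine ⟨fun hc => a (by rw [hc, inv_one]), fun hc => b ?_⟩
    rw [inv_eq_of_mul_eq_one_left hc]

theorem eqOn_of_eqOn_regularSet (hU : IsOpen U) (hq : 0 < q) {f g : (V → ℂ) → ℂ}
    (hf : ContinuousOn f U) (hg : ContinuousOn g U) (h : Set.EqOn f g (U ∩ regularSet Γ q)) :
    Set.EqOn f g U :=
  h.of_subset_closure hf hg Set.inter_subset_left
    ((dense_regularSet (Γ := Γ) hq).open_subset_closure_inter hU)

/-! ### The numerator of the average -/

variable (Γ) in
/-- `D(x) ∏_γ u_γ (1 | w)(x)`, where `γ` runs over the inversions of `w`, as a holomorphic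
function, computed from a reduced word of `w`. -/
def termNum (q : ℕ) (ω : List V) (x : V → ℂ) : ℂ :=
  rootProd Γ q q (invRoots Γ ω).toFinset x * slashNum Γ q ω (sv q x)

theorem mem_posRoots_of_mem_invRoots {ω : List V} (hω : (weylSystem Γ).IsReduced ω) {γ : V → ℤ}
    (h : γ ∈ invRoots Γ ω) : γ ∈ posRoots Γ := (((invRoots_spec Γ hω).2 γ).1 h).1

theorem differentiableOn_termNum (hU : IsGoodDomain Γ q U) {ω : List V}
    (hω : (weylSystem Γ).IsReduced ω) : DifferentiableOn ℂ (termNum Γ q ω) U :=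
  (hU.differentiableOn_rootProd q _).mul (differentiableOn_slashNum Γ q ω fun _ hγ =>
    (differentiable_sv q (mem_posRoots_of_mem_invRoots hω hγ).2).differentiableOn)

theorem termNum_eq (hU : IsGoodDomain Γ q U) (hq : 0 < q) {ω : List V}
    (hω : (weylSystem Γ).IsReduced ω) {x : V → ℂ} (hxU : x ∈ U) (hx : ∀ k, x k ≠ 0)
    (h : ∀ γ ∈ posRoots Γ, q * sv q x γ ^ 2 ≠ 1) :
    termNum Γ q ω x = rootProd Γ q q ∅ x * ((invRoots Γ ω).map fun γ => sv q x γ ^ 2).prod *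
      oneSlash Γ q ω x := by
  have hnd := (invRoots_spec Γ hω).1
  rw [termNum, slashNum_sv Γ hq ω hx fun γ hγ => h γ (mem_posRoots_of_mem_invRoots hω hγ),
    ← hU.rootProd_mul_prod q (L := (invRoots Γ ω).toFinset)
      (fun γ hγ => mem_posRoots_of_mem_invRoots hω (List.mem_toFinset.1 hγ)) hxU,
    List.prod_toFinset _ hnd, List.prod_map_mul]
  ring

theorem length_invRoots (ω : List V) : (invRoots Γ ω).length = ω.length := by
  induction ω using List.reverseRecOn with
  | nil => simp [invRoots]
  | append_singleton ω i ih => simp [invRoots_concat, ih]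

/-- The term of the average belonging to `w`, as a multiple of a function holomorphic on `U`. -/
theorem inv_delta_mul_oneSlash (hU : IsGoodDomain Γ q U) (hq : 0 < q) {ω : List V}
    (hω : (weylSystem Γ).IsReduced ω) {x : V → ℂ} (hxU : x ∈ U) (hx : ∀ k, x k ≠ 0)
    (hD : rootProd Γ q q ∅ x ≠ 0) (hΔ : rootProd Γ q 1 ∅ x ≠ 0) :
    (rootProd Γ q 1 ∅ (act Γ q ω x))⁻¹ * oneSlash Γ q ω x =
      (-1) ^ ω.length * termNum Γ q ω x / (rootProd Γ q q ∅ x * rootProd Γ q 1 ∅ x) := by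
  have h := hU.delta_act hq ω hxU hx
  have hl : ∀ L : List (V → ℤ), (L.map fun γ => -sv q x γ ^ 2).prod =
      (-1) ^ L.length * (L.map fun γ => sv q x γ ^ 2).prod := by
    intro L
    induction L with
    | nil => simp
    | cons γ L ih => simp only [List.map_cons, List.prod_cons, ih, List.length_cons]; ring
  rw [hl, length_invRoots] at h
  rw [termNum_eq hU hq hω hxU hx fun γ hγ h0 => hD (hU.rootProd_eq_zero q hγ hxU h0)]
  rw [← h] at hΔ ⊢
  set P := ((invRoots Γ ω).map fun γ => sv q x γ ^ 2).prod
  have h1 := left_ne_zero_of_mul hΔ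
  have h2 := right_ne_zero_of_mul (right_ne_zero_of_mul hΔ)
  have h3 := left_ne_zero_of_mul (right_ne_zero_of_mul hΔ)
  field_simp

theorem termNum_congr (hU : IsGoodDomain Γ q U) (hq : 0 < q) {ω ω' : List V}
    (hω : (weylSystem Γ).IsReduced ω) (hω' : (weylSystem Γ).IsReduced ω')
    (h : (weylSystem Γ).wordProd ω = (weylSystem Γ).wordProd ω') :
    Set.EqOn (termNum Γ q ω) (termNum Γ q ω') U := by
  refine eqOn_of_eqOn_regularSet (Γ := Γ) hU.isOpen hq (differentiableOn_termNum hU hω).continuousOn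
    (differentiableOn_termNum hU hω').continuousOn fun x hx => ?_
  have h1 : ∀ γ ∈ posRoots Γ, q * sv q x γ ^ 2 ≠ 1 := fun γ hγ => (hx.2.2 γ hγ.1).2
  have hL : (invRoots Γ ω).toFinset = (invRoots Γ ω').toFinset := by
    ext γ
    rw [List.mem_toFinset, List.mem_toFinset, (invRoots_spec Γ hω).2, (invRoots_spec Γ hω').2, h]
  rw [termNum_eq hU hq hω hx.1 hx.2.1 h1, termNum_eq hU hq hω' hx.1 hx.2.1 h1,
    oneSlash_congr Γ hq h hx.2, ← List.prod_toFinset _ (invRoots_spec Γ hω).1,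
    ← List.prod_toFinset _ (invRoots_spec Γ hω').1, hL]

/-- The family `word` assigns to each element of the Weyl group a reduced word. -/
def IsReducedWords (word : (coxeterMatrix Γ).Group → List V) : Prop :=
  ∀ w, (weylSystem Γ).IsReduced (word w) ∧ (weylSystem Γ).wordProd (word w) = w

variable (Γ) in
omit [Fintype V] in
theorem exists_isReducedWords : ∃ word : (coxeterMatrix Γ).Group → List V, IsReducedWords word := by
  choose word h using fun w => (weylSystem Γ).exists_isReduced w
  exact ⟨word, fun w => ⟨(h w).1, (h w).2.symm⟩⟩

theorem summable_numBound (q : ℕ) {ι : Type*} {κ : ι → ℝ} (hκ0 : ∀ γ, 0 ≤ κ γ)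
    (hκ : Summable κ) : Summable fun γ => numBound q (κ γ) := by
  set M := ∑' γ, κ γ
  refine (hκ.mul_right ((M + √q) * (1 + √q * M) + (1 + q * M ^ 2))).of_nonneg_of_le
    (fun γ => numBound_nonneg q (hκ0 γ)) fun γ => ?_
  have h1 : κ γ ≤ M := hκ.le_tsum γ fun j _ => hκ0 j
  have h2 := hκ0 γ
  have h3 := h2.trans h1
  unfold numBound
  gcongr

/-- Since an element of the Weyl group is determined by its inversions, a sum over the group of
products over inversions is bounded by a sum over all finite sets of positive roots. -/
theorem summable_prod_invRoots {word : (coxeterMatrix Γ).Group → List V}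
    (hw : IsReducedWords word) {K : posRoots Γ → ℝ} (hK0 : ∀ γ, 0 ≤ K γ) (hK : Summable K)
    {g : (V → ℤ) → ℝ} (hg : ∀ γ : posRoots Γ, g γ = K γ) :
    Summable fun w => ((invRoots Γ (word w)).map g).prod := by
  classical
  set T : (coxeterMatrix Γ).Group → Finset (posRoots Γ) := fun w =>
    (invRoots Γ (word w)).toFinset.subtype (· ∈ posRoots Γ) with hT
  have hTinj : Function.Injective T := by
    intro w w' hww
    refine inversions_injective Γ ?_
    ext γ
    have key : ∀ v, γ ∈ inversions Γ v ↔ ∃ hγ : γ ∈ posRoots Γ, (⟨γ, hγ⟩ : posRoots Γ) ∈ T v := by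
      intro v
      simp only [hT, Finset.mem_subtype, List.mem_toFinset]
      rw [(invRoots_spec Γ (hw v).1).2, (hw v).2]
      exact ⟨fun h => ⟨h.1, h⟩, fun h => h.2⟩
    rw [key, key, hww]
  refine ((summable_finsetProd_of_summable_nonneg hK0 hK).comp_injective hTinj).congr fun w => ?_
  rw [comp_apply, ← List.prod_toFinset _ (invRoots_spec Γ (hw w).1).1,
    ← Finset.prod_subtype_of_mem (p := (· ∈ posRoots Γ)) g fun γ hγ =>
      mem_posRoots_of_mem_invRoots (hw w).1 (List.mem_toFinset.1 hγ)]
  exact Finset.prod_congr rfl fun γ _ => (hg γ).symm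

theorem norm_slashNum_sv_le {ω : List V} (hω : (weylSystem Γ).IsReduced ω) {x : V → ℂ}
    {g : (V → ℤ) → ℝ} (h : ∀ γ ∈ posRoots Γ, numBound q ‖sv q x γ‖ ≤ g γ) :
    ‖slashNum Γ q ω (sv q x)‖ ≤ ((invRoots Γ ω).map g).prod := by
  refine (norm_slashNum_le Γ q _ _).trans ?_
  rw [← List.prod_toFinset _ (invRoots_spec Γ hω).1, ← List.prod_toFinset _ (invRoots_spec Γ hω).1]
  exact Finset.prod_le_prod (fun γ _ => numBound_nonneg q (norm_nonneg _)) fun γ hγ =>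
    h γ (mem_posRoots_of_mem_invRoots hω (List.mem_toFinset.1 hγ))

/-- The terms of the numerator are locally uniformly summable. -/
theorem exists_bound_termNum (hU : IsGoodDomain Γ q U)
    {word : (coxeterMatrix Γ).Group → List V} (hw : IsReducedWords word) {p : V → ℂ} (hp : p ∈ U) :
    ∃ N ∈ 𝓝 p, ∃ u : (coxeterMatrix Γ).Group → ℝ, Summable u ∧
      ∀ w, ∀ x ∈ N, ‖(-1) ^ (word w).length * termNum Γ q (word w) x‖ ≤ u w := by
  classical
  obtain ⟨N, hN, κ, hκ, h⟩ := hU.summable p hp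
  have hκ0 : ∀ γ, 0 ≤ κ γ := fun γ => (norm_nonneg _).trans (h γ p (mem_of_mem_nhds hN))
  set g : (V → ℤ) → ℝ := fun γ => if hγ : γ ∈ posRoots Γ then numBound q (κ ⟨γ, hγ⟩) else 0 with hg
  have hgK : ∀ γ : posRoots Γ, g γ = numBound q (κ γ) := fun γ => dif_pos γ.2
  have hs := summable_prod_invRoots hw (fun γ => numBound_nonneg q (hκ0 γ))
    (summable_numBound q hκ0 hκ) hgK
  refine ⟨N, hN, _, hs.mul_left (Real.exp (∑' γ, ‖(q : ℂ)‖ * κ γ ^ 2)), fun w x hx => ?_⟩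
  rw [norm_mul, norm_pow, norm_neg, norm_one, one_pow, one_mul, termNum, norm_mul]
  refine mul_le_mul ?_ ?_ (norm_nonneg _) (Real.exp_pos _).le
  · exact norm_tprod_one_add_le_exp ((summable_sq_of_summable hκ0 hκ).mul_left _)
      fun γ => norm_rootFactor_le _ _ (h γ x hx)
  · refine norm_slashNum_sv_le (hw w).1 fun γ hγ => ?_
    rw [hgK ⟨γ, hγ⟩]
    exact numBound_mono q (norm_nonneg _) (h ⟨γ, hγ⟩ x hx)

/-- The numerator `D Δ Z` of the average `Z`. On a good domain it does not depend on the choice of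
the reduced words, by `numerator_congr`. -/
def numerator (q : ℕ) (word : (coxeterMatrix Γ).Group → List V) (x : V → ℂ) : ℂ :=
  ∑' w, (-1) ^ (word w).length * termNum Γ q (word w) x

theorem differentiableOn_numerator (hU : IsGoodDomain Γ q U)
    {word : (coxeterMatrix Γ).Group → List V} (hw : IsReducedWords word) :
    DifferentiableOn ℂ (numerator q word) U :=
  differentiableOn_tsum hU.isOpen (fun w => (differentiableOn_termNum hU (hw w).1).const_mul _)
    fun _ hp => exists_bound_termNum hU hw hp

theorem hasSum_numerator (hU : IsGoodDomain Γ q U)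
    {word : (coxeterMatrix Γ).Group → List V} (hw : IsReducedWords word) {x : V → ℂ}
    (hx : x ∈ U) :
    HasSum (fun w => (-1) ^ (word w).length * termNum Γ q (word w) x) (numerator q word x) := by
  obtain ⟨N, hN, u, hu, h⟩ := exists_bound_termNum hU hw hx
  exact (hu.of_norm_bounded fun w => h w x (mem_of_mem_nhds hN)).hasSum

theorem numerator_congr (hU : IsGoodDomain Γ q U) (hq : 0 < q)
    {word word' : (coxeterMatrix Γ).Group → List V} (hw : IsReducedWords word)
    (hw' : IsReducedWords word') : Set.EqOn (numerator q word) (numerator q word') U := by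
  intro x hx
  refine tsum_congr fun w => ?_
  rw [termNum_congr hU hq (hw w).1 (hw' w).1 (by rw [(hw w).2, (hw' w).2]) hx]
  have h1 := (hw w).1.eq
  have h2 := (hw' w).1.eq
  rw [(hw w).2] at h1
  rw [(hw' w).2] at h2
  rw [← h1, ← h2]

theorem hasSum_average (hU : IsGoodDomain Γ q U) (hq : 0 < q)
    {word : (coxeterMatrix Γ).Group → List V} (hw : IsReducedWords word) {x : V → ℂ} (hxU : x ∈ U)
    (hx : ∀ k, x k ≠ 0) (hD : rootProd Γ q q ∅ x ≠ 0) (hΔ : rootProd Γ q 1 ∅ x ≠ 0) :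
    HasSum (fun w => (rootProd Γ q 1 ∅ (act Γ q (word w) x))⁻¹ * oneSlash Γ q (word w) x)
      (numerator q word x / (rootProd Γ q q ∅ x * rootProd Γ q 1 ∅ x)) := by
  simp only [fun w => inv_delta_mul_oneSlash hU hq (hw w).1 hxU hx hD hΔ]
  exact (hasSum_numerator hU hw hxU).div_const _

end

/-! ### Divisibility of the numerator by the Weyl denominator -/

section

open Function Filter

variable {V : Type*} [Fintype V] [DecidableEq V] {Γ : SimpleGraph V} [DecidableRel Γ.Adj]
  {q : ℕ} {U : Set (V → ℂ)}

theorem IsGoodDomain.epsilon_mem (hU : IsGoodDomain Γ q U) {x : V → ℂ} (hx : x ∈ U) (i : V) :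
    epsilon Γ i x ∈ U := hU.reinhardt x hx _ fun k => by
  simp only [epsilon]; split_ifs <;> simp

theorem IsGoodDomain.rootProd_ne_zero_of_regular (hU : IsGoodDomain Γ q U) {x : V → ℂ}
    (hx : x ∈ U) (hr : x ∈ regularSet Γ q) :
    rootProd Γ q q ∅ x ≠ 0 ∧ rootProd Γ q 1 ∅ x ≠ 0 :=
  ⟨hU.rootProd_ne_zero _ _ hx fun γ hγ _ => (hr.2 γ hγ.1).2,
    hU.rootProd_ne_zero _ _ hx fun γ hγ _ => by rw [one_mul]; exact (hr.2 γ hγ.1).1⟩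

/-- The average is invariant under the slash operators: slashing by `σ_i` permutes the terms by
right multiplication. -/
theorem average_slash (hU : IsGoodDomain Γ q U) (hq : 0 < q)
    {word : (coxeterMatrix Γ).Group → List V} (hw : IsReducedWords word) (i : V) {x : V → ℂ}
    (hxU : x ∈ U) (hx : x ∈ regularSet Γ q) :
    slash Γ q (fun y => numerator q word y / (rootProd Γ q q ∅ y * rootProd Γ q 1 ∅ y)) i x =
      numerator q word x / (rootProd Γ q q ∅ x * rootProd Γ q 1 ∅ x) := by
  have hσ := sigma_mem_regularSet Γ hq hx i
  have hσU := hU.sigma_mem x hxU hx.1 i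
  have hε := epsilon_mem_regularSet Γ hσ i
  have hεU := hU.epsilon_mem hσU i
  have sum : ∀ {y}, y ∈ U → y ∈ regularSet Γ q → _ := fun {y} hyU hy =>
    hasSum_average hU hq hw hyU hy.1 (hU.rootProd_ne_zero_of_regular hyU hy).1
      (hU.rootProd_ne_zero_of_regular hyU hy).2
  have h1 := sum hσU hσ
  have h2 := sum hεU hε
  have h3 := (Equiv.hasSum_iff (Equiv.mulRight ((weylSystem Γ).simple i))).2 (sum hxU hx)
  rw [slash_apply]
  refine ((h1.mul_left (slashCoeff q (x i))).add (h2.mul_left (slashCoeffNeg q (x i)))).unique ?_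
  refine h3.congr_fun fun w => ?_
  have hprod : (weylSystem Γ).wordProd (word (w * (weylSystem Γ).simple i)) =
      (weylSystem Γ).wordProd (word w ++ [i]) := by
    rw [(hw _).2, CoxeterSystem.wordProd_append, CoxeterSystem.wordProd_singleton, (hw _).2]
  rw [comp_apply, Equiv.coe_mulRight, act_congr Γ hq hprod hx.1, oneSlash_congr Γ hq hprod hx,
    act_concat, oneSlash_concat, slash_apply, hU.delta_act_epsilon hq _ _ hσU hσ.1]
  ring

theorem differentiableOn_sigma (q : ℕ) (i : V) :
    DifferentiableOn ℂ (sigma Γ q i) {x | ∀ k, x k ≠ 0} := by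
  rw [differentiableOn_pi]
  intro k
  simp only [sigma]
  split_ifs
  · have h : DifferentiableOn ℂ (fun x : V → ℂ => (x i)⁻¹) {x | ∀ k, x k ≠ 0} :=
      DifferentiableOn.fun_inv (differentiable_apply i).differentiableOn fun x hx => hx i
    exact h.const_mul _
  · fun_prop
  · fun_prop

omit [DecidableEq V] in
theorem differentiable_epsilon (i : V) : Differentiable ℂ (epsilon Γ i) := by
  rw [differentiable_pi]
  intro k
  simp only [epsilon]
  split_ifs <;> fun_prop

omit [DecidableEq V] in
theorem isOpen_torus : IsOpen {x : V → ℂ | ∀ k, x k ≠ 0} := by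
  simp only [Set.ofPred_forall]
  exact isOpen_iInter_of_finite fun k => isOpen_ne_fun (continuous_apply k) continuous_const

/-- The invariance of the average under the slash operators, cleared of denominators. By density of
the regular set it holds on the whole torus part of `U`. -/
theorem numerator_sigma (hU : IsGoodDomain Γ q U) (hq : 0 < q)
    {word : (coxeterMatrix Γ).Group → List V} (hw : IsReducedWords word) (i : V) {x : V → ℂ}
    (hxU : x ∈ U) (hx : ∀ k, x k ≠ 0) {s : ℂ} (hs : sv q x (Pi.single i 1) = s) :
    (s ^ 2 - q) * numerator q word x = -s ^ 2 *
      ((numEven q s + numOdd q s) / 2 * numerator q word (sigma Γ q i x) +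
        (numEven q s - numOdd q s) / 2 * numerator q word (epsilon Γ i (sigma Γ q i x))) := by
  subst hs
  set T : Set (V → ℂ) := {x | ∀ k, x k ≠ 0} with hT
  have hTo : IsOpen T := isOpen_torus
  have hs : Continuous fun x : V → ℂ => sv q x (Pi.single i 1) :=
    (differentiable_sv q (single_mem_posRoots Γ i).2).continuous
  have hN := (differentiableOn_numerator hU hw).continuousOn
  have hσ : ContinuousOn (sigma Γ q i) (U ∩ T) :=
    (differentiableOn_sigma q i).continuousOn.mono Set.inter_subset_right
  have hσU : Set.MapsTo (sigma Γ q i) (U ∩ T) U := fun y hy => hU.sigma_mem y hy.1 hy.2 i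
  have hN1 : ContinuousOn (fun y => numerator q word (sigma Γ q i y)) (U ∩ T) := hN.comp hσ hσU
  have hN2 : ContinuousOn (fun y => numerator q word (epsilon Γ i (sigma Γ q i y))) (U ∩ T) :=
    hN.comp ((differentiable_epsilon i).continuous.comp_continuousOn hσ)
      fun y hy => hU.epsilon_mem (hσU hy) i
  have hN0 := hN.mono (Set.inter_subset_left : U ∩ T ⊆ U)
  refine eqOn_of_eqOn_regularSet (Γ := Γ) (hU.isOpen.inter hTo) hq
    (f := fun x => (sv q x (Pi.single i 1) ^ 2 - q) * numerator q word x)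
    (g := fun x => -sv q x (Pi.single i 1) ^ 2 *
      ((numEven q (sv q x (Pi.single i 1)) + numOdd q (sv q x (Pi.single i 1))) / 2 *
        numerator q word (sigma Γ q i x) +
        (numEven q (sv q x (Pi.single i 1)) - numOdd q (sv q x (Pi.single i 1))) / 2 *
          numerator q word (epsilon Γ i (sigma Γ q i x)))) ?_ ?_ ?_ ⟨hxU, hx⟩
  · exact (Continuous.continuousOn (by fun_prop)).mul hN0
  · simp only [numEven, numOdd]
    refine (Continuous.continuousOn (by fun_prop)).mul (ContinuousOn.add ?_ ?_)
    · exact (Continuous.continuousOn (by fun_prop)).mul hN1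
    · exact (Continuous.continuousOn (by fun_prop)).mul hN2
  · rintro y ⟨⟨hyU, hyT⟩, hy⟩
    have h := average_slash hU hq hw i hyU hy
    have hσ := sigma_mem_regularSet Γ hq hy i
    obtain ⟨d1, d2⟩ := hU.rootProd_ne_zero_of_regular hyU hy
    obtain ⟨d3, d4⟩ := hU.rootProd_ne_zero_of_regular (hU.sigma_mem y hyU hyT i) hσ
    have h1 := hU.rootProd_sigma hq q i hyU hyT
    have h2 := hU.delta_sigma hq i hyU hyT
    have hs0 := sv_ne_zero hq hyT (Pi.single i 1)
    have hqs := (hy.2 _ (.simple i)).2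
    have h3 := slashCoeff_mul hq (sv_single hq y i).symm hs0 hqs
    have h4 := slashCoeffNeg_mul hq (sv_single hq y i).symm hs0 hqs
    rw [slash_apply, rootProd_epsilon, rootProd_epsilon] at h
    simp only
    rw [← h3, ← h4]
    generalize sv q y (Pi.single i 1) = s at *
    generalize numerator q word y = n at *
    generalize numerator q word (sigma Γ q i y) = n1 at *
    generalize numerator q word (epsilon Γ i (sigma Γ q i y)) = n2 at *
    generalize rootProd Γ q q ∅ y = D at *
    generalize rootProd Γ q 1 ∅ y = Δ at *
    generalize rootProd Γ q q ∅ (sigma Γ q i y) = D' at *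
    generalize rootProd Γ q 1 ∅ (sigma Γ q i y) = Δ' at *
    generalize slashCoeff q (y i) = c1 at *
    generalize slashCoeffNeg q (y i) = c2 at *
    have h5 : (c1 * n1 + c2 * n2) * (D * Δ) = n * (D' * Δ') := by
      field_simp at h
      linear_combination h
    have h6 : D' * (1 - q * s ^ 2) * s ^ 2 = D * (s ^ 2 - q) := by
      rw [h1]; field_simp
    refine mul_right_cancel₀ (mul_ne_zero d3 d4) ?_
    linear_combination (-(s ^ 2 - q)) * h5 +
      (c1 * n1 + c2 * n2) * (-D' * (1 - q * s ^ 2) * s ^ 2 * h2 - Δ * h6)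

/-- At a point with `u_i = 1` the map `σ_i` is the identity or `ε_i`, and the functional equation
reduces to `(1 - q) N = -(1 - q) N`. -/
theorem numerator_eq_zero_of_simple (hU : IsGoodDomain Γ q U) (hq : 1 < q)
    {word : (coxeterMatrix Γ).Group → List V} (hw : IsReducedWords word) (i : V) {x : V → ℂ}
    (hxU : x ∈ U) (hx : ∀ k, x k ≠ 0) (h : sv q x (Pi.single i 1) ^ 2 = 1) :
    numerator q word x = 0 := by
  have hq0 : 0 < q := by omega
  have hr := sqrtq_ne_zero hq0
  have hrq := sqrtq_sq q
  have hq1 : (1 : ℂ) - q ≠ 0 := sub_ne_zero.2 (by exact_mod_cast hq.ne)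
  have hi := hx i
  have key : ∀ s : ℂ, sv q x (Pi.single i 1) = s → s ^ 2 = 1 → sigma Γ q i x = fun k =>
      if Γ.Adj i k then s * x k else x k := by
    intro s hs hs2
    rw [sv_single hq0] at hs
    ext k
    by_cases hk : k = i
    · subst hk
      simp only [sigma, if_true, SimpleGraph.irrefl, if_false]
      rw [← hrq]
      field_simp
      rw [← mul_pow, hs, hs2]
    · by_cases hadj : Γ.Adj i k <;> simp [sigma, hk, hadj, hs]
  set t := sv q x (Pi.single i 1) with ht
  have h0 : (t - 1) * (t + 1) = 0 := by linear_combination h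
  refine (mul_eq_zero.1 (?_ : (1 - (q : ℂ)) * numerator q word x = 0)).resolve_left hq1
  rcases mul_eq_zero.1 h0 with hs | hs
  · have hs : t = 1 := by linear_combination hs
    have h1 := numerator_sigma hU hq0 hw i hxU hx hs
    have h3 : sigma Γ q i x = x := by rw [key 1 hs (by norm_num)]; ext k; simp
    rw [h3] at h1
    simp only [numEven, numOdd] at h1
    linear_combination h1 / 2 +
      (numerator q word x + numerator q word (epsilon Γ i x)) / 4 * hrq
  · have hs : t = -1 := by linear_combination hs
    have h1 := numerator_sigma hU hq0 hw i hxU hx hs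
    have h3 : sigma Γ q i x = epsilon Γ i x := by
      rw [key (-1) hs (by norm_num)]; ext k; simp [epsilon]
    rw [h3, epsilon_epsilon] at h1
    simp only [numEven, numOdd] at h1
    linear_combination h1 / 2 +
      (numerator q word x + numerator q word (epsilon Γ i x)) / 4 * hrq

theorem sum_single_sub_single_mul {j k : V} (a b : ℤ) (α : V → ℤ) :
    ∑ l, (Pi.single j a - Pi.single k b : V → ℤ) l * α l = a * α j - b * α k := by
  have h : ∀ (j : V) (a : ℤ), ∑ l, (Pi.single j a : V → ℤ) l * α l = a * α j := by
    intro j a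
    rw [Finset.sum_eq_single j] <;> simp +contextual
  simp only [Pi.sub_apply, sub_mul, Finset.sum_sub_distrib, h]

omit [Fintype V] [DecidableEq V] in
theorem scale_ne_zero {x : V → ℂ} (hx : ∀ k, x k ≠ 0) (m : V → ℤ) {t : ℝ} (ht : 1 < t) (k : V) :
    scale x m t k ≠ 0 :=
  mul_ne_zero (hx k) (zpow_ne_zero _ (by exact_mod_cast (zero_lt_one.trans ht).ne'))

/-- The numerator vanishes on the torus part of the hypersurface `u_β = 1`, because the functional
equation carries this hypersurface to the one of a simple root. -/
theorem numerator_eq_zero_of_torus (hU : IsGoodDomain Γ q U) (hq : 1 < q)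
    {word : (coxeterMatrix Γ).Group → List V} (hw : IsReducedWords word) {β : V → ℤ}
    (hβ : IsRoot Γ β) : ∀ {x : V → ℂ}, x ∈ U → (∀ k, x k ≠ 0) → sv q x β ^ 2 = 1 →
      numerator q word x = 0 := by
  have hq0 : 0 < q := by omega
  have hqC : (q : ℂ) ≠ 0 := by exact_mod_cast hq0.ne'
  induction hβ with
  | simple i => exact fun {x} hxU hx h => numerator_eq_zero_of_simple hU hq hw i hxU hx h
  | reflect i β hβ ih =>
    -- the factor `u_i - q` in the functional equation has to be avoided
    have gen : ∀ {x : V → ℂ}, x ∈ U → (∀ k, x k ≠ 0) → sv q x (reflection Γ i β) ^ 2 = 1 →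
        sv q x (Pi.single i 1) ^ 2 ≠ q → numerator q word x = 0 := by
      intro x hxU hx h hne
      rw [← sv_sigma Γ hq0 hx] at h
      have hσU := hU.sigma_mem x hxU hx i
      have hσ := sigma_ne_zero Γ hq0 hx i
      have h1 := numerator_sigma hU hq0 hw i hxU hx rfl
      rw [ih hσU hσ h, ih (hU.epsilon_mem hσU i) (epsilon_ne_zero Γ hσ i)
        (by rw [sv_epsilon_sq, h])] at h1
      rw [mul_zero, mul_zero, add_zero, mul_zero] at h1
      exact (mul_eq_zero.1 h1).resolve_left (sub_ne_zero.2 hne)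
    intro x hxU hx h
    by_cases hne : sv q x (Pi.single i 1) ^ 2 = q
    · set β' := reflection Γ i β with hβ'
      have hr : IsRoot Γ β' := .reflect i β hβ
      obtain ⟨k, hki, hk⟩ : ∃ k, k ≠ i ∧ β' k ≠ 0 := by
        by_contra! hcon
        have hq1 : (q : ℂ) ≠ 1 := by exact_mod_cast hq.ne'
        rcases hr.eq_single_or_neg hcon with h0 | h0
        · rw [h0, hne] at h; exact hq1 h
        · rw [h0, sv_neg hq0, inv_pow, hne, inv_eq_one] at h; exact hq1 h
      -- approach `x` in a direction tangent to the hypersurface and transversal to `u_i = q`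
      refine eq_zero_of_scale ((differentiableOn_numerator hU hw).continuousOn.continuousAt
        (hU.isOpen.mem_nhds hxU)) (Pi.single i (β' k) - Pi.single k (β' i)) ?_
      filter_upwards [self_mem_nhdsWithin,
        (tendsto_scale x _).eventually (hU.isOpen.mem_nhds hxU)] with t ht htU
      refine gen htU (scale_ne_zero hx _ ht) ?_ (sv_scale_sq_ne hq0 ht ?_ hqC hne)
      · rw [sv_scale_of_eq_zero hq0 x ht (by rw [sum_single_sub_single_mul]; ring), h]
      · rw [sum_single_sub_single_mul]; simpa [hki] using hk
    · exact gen hxU hx h hne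

omit [DecidableEq V] in
theorem ne_zero_of_sv_sq_eq_one {p : V → ℂ} {α : V → ℤ} (h : sv q p α ^ 2 = 1) {i : V}
    (hi : α i ≠ 0) : p i ≠ 0 := by
  intro h0
  rw [sv, monomial, Finset.prod_eq_zero (Finset.mem_univ i) (by rw [h0, zero_zpow _ hi])] at h
  simp at h

theorem numerator_eq_zero (hU : IsGoodDomain Γ q U) (hq : 1 < q)
    {word : (coxeterMatrix Γ).Group → List V} (hw : IsReducedWords word) {β : V → ℤ}
    (hβ : IsRoot Γ β) {p : V → ℂ} (hp : p ∈ U) (h : sv q p β ^ 2 = 1) :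
    numerator q word p = 0 := by
  -- move the zero coordinates, none of which occurs in `u_β`
  set y : ℝ → V → ℂ := fun t k => if p k = 0 then (t : ℂ) - 1 else p k with hy
  have hlim : Tendsto y (𝓝[>] 1) (𝓝 p) := by
    have h1 : Continuous y := by
      refine continuous_pi fun k => ?_
      simp only [hy]
      split_ifs <;> fun_prop
    have h2 : y 1 = p := by
      ext k; by_cases hk : p k = 0 <;> simp [hy, hk]
    have := h1.tendsto 1
    rw [h2] at this
    exact this.mono_left nhdsWithin_le_nhds
  have hc := (differentiableOn_numerator hU hw).continuousOn.continuousAt (hU.isOpen.mem_nhds hp)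
  refine tendsto_nhds_unique (hc.tendsto.comp hlim) (tendsto_const_nhds.congr' ?_)
  filter_upwards [self_mem_nhdsWithin, hlim.eventually (hU.isOpen.mem_nhds hp)] with t ht htU
  refine (numerator_eq_zero_of_torus hU hq hw hβ htU (fun k => ?_) ?_).symm
  · by_cases hk : p k = 0
    · simp only [hy, hk, if_true]
      exact sub_ne_zero.2 (by exact_mod_cast (ne_of_gt ht))
    · simp [hy, hk]
  · rw [← h]
    congr 1
    rw [sv, sv, monomial, monomial]
    congr 1
    refine Finset.prod_congr rfl fun k _ => ?_
    by_cases hk : β k = 0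
    · simp [hk]
    · simp [hy, ne_zero_of_sv_sq_eq_one h hk]

/-- Near a point, the numerator may be divided by any finite set of the factors `1 - u_β` which
vanish there: each division keeps the vanishing along the other hypersurfaces. -/
theorem exists_numerator_eq_prod_mul (hU : IsGoodDomain Γ q U) (hq : 1 < q)
    {word : (coxeterMatrix Γ).Group → List V} (hw : IsReducedWords word) {p : V → ℂ} (hp : p ∈ U)
    (B : Finset (V → ℤ)) (hB : ∀ β ∈ B, β ∈ posRoots Γ ∧ sv q p β ^ 2 = 1) :
    ∃ N : Set (V → ℂ), IsOpen N ∧ p ∈ N ∧ N ⊆ U ∧ ∃ H : (V → ℂ) → ℂ, DifferentiableOn ℂ H N ∧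
      (∀ x ∈ N, numerator q word x = (∏ β ∈ B, (1 - sv q x β ^ 2)) * H x) ∧
      ∀ γ ∈ posRoots Γ, γ ∉ B → ∀ x ∈ N, sv q x γ ^ 2 = 1 → H x = 0 := by
  have hq0 : 0 < q := by omega
  induction B using Finset.induction_on with
  | empty =>
    exact ⟨U, hU.isOpen, hp, subset_rfl, _, differentiableOn_numerator hU hw, by simp,
      fun γ hγ _ x hx h => numerator_eq_zero hU hq hw hγ.1 hx h⟩
  | insert β B hβB ih =>
    obtain ⟨N, hNo, hpN, hNU, H, hH, hNH, hv⟩ := ih fun γ hγ => hB γ (Finset.mem_insert_of_mem hγ)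
    obtain ⟨hβ, hpβ⟩ := hB β (Finset.mem_insert_self β B)
    obtain ⟨i, hi⟩ := Function.ne_iff.1 hβ.1.ne_zero
    have hi0 : (β i).toNat ≠ 0 := by
      have := hβ.2 i
      simp only [Pi.zero_apply] at this hi
      omega
    obtain ⟨N', hN', hN'N, hN'o, H', hH', hHH'⟩ := exists_eq_one_sub_mul_of_vanish (i := i)
      (n := (β i).toNat * 2) (mul_ne_zero hi0 two_ne_zero) (hNo.mem_nhds hpN) hH
      (u := fun x => sv q x β ^ 2) ((differentiable_sv q hβ.2).pow 2).differentiableOn hpβ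
      (ne_zero_of_sv_sq_eq_one hpβ hi) (fun x z => by
        rw [pow_mul, ← mul_pow, sv_eq_natPow q _ hβ.2, sv_eq_natPow q _ hβ.2,
          ← Finset.mul_prod_erase _ _ (Finset.mem_univ i),
          ← Finset.mul_prod_erase _ (fun k => x k ^ (β k).toNat) (Finset.mem_univ i)]
        rw [Finset.prod_congr rfl fun k hk => by
          rw [update_of_ne (Finset.ne_of_mem_erase hk)], update_self]
        ring) (hv β hβ hβB)
    refine ⟨N', hN'o, mem_of_mem_nhds hN', hN'N.trans hNU, H', hH', fun x hx => ?_, ?_⟩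
    · rw [hNH x (hN'N hx), hHH' x hx, Finset.prod_insert hβB]; ring
    · intro γ hγ hγB x hx hxγ
      rw [Finset.mem_insert, not_or] at hγB
      -- on the intersection of the two hypersurfaces a limit within `u_γ = 1` is taken
      have gen : ∀ y ∈ N', sv q y γ ^ 2 = 1 → sv q y β ^ 2 ≠ 1 → H' y = 0 := by
        intro y hy h1 h2
        have h3 := hHH' y hy
        rw [hv γ hγ hγB.2 y (hN'N hy) h1] at h3
        exact (mul_eq_zero.1 h3.symm).resolve_left (sub_ne_zero.2 (Ne.symm h2))
      by_cases hxβ : sv q x β ^ 2 = 1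
      · obtain ⟨j, k, hjk⟩ := exists_minor_ne_zero Γ hγ hβ hγB.1
        refine eq_zero_of_scale (hH'.continuousOn.continuousAt (hN'o.mem_nhds hx))
          (Pi.single j (γ k) - Pi.single k (γ j)) ?_
        filter_upwards [self_mem_nhdsWithin,
          (tendsto_scale x _).eventually (hN'o.mem_nhds hx)] with t ht htN
        refine gen _ htN ?_ (sv_scale_sq_ne hq0 ht ?_ one_ne_zero hxβ)
        · rw [sv_scale_of_eq_zero hq0 x ht (by rw [sum_single_sub_single_mul]; ring), hxγ]
        · rw [sum_single_sub_single_mul]; exact fun h => hjk (by linarith)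
      · exact gen x hx hxγ hxβ

/-- Near `p`, all but finitely many of the factors of `Δ` have a nonvanishing product. -/
theorem exists_local_quotient (hU : IsGoodDomain Γ q U) (hq : 1 < q)
    {word : (coxeterMatrix Γ).Group → List V} (hw : IsReducedWords word) {p : V → ℂ}
    (hp : p ∈ U) : ∃ N : Set (V → ℂ), IsOpen N ∧ p ∈ N ∧ N ⊆ U ∧ ∃ G : (V → ℂ) → ℂ,
      DifferentiableOn ℂ G N ∧ ∀ x ∈ N, numerator q word x = rootProd Γ q 1 ∅ x * G x := by
  have hfin : {γ : posRoots Γ | sv q p γ ^ 2 = 1}.Finite := by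
    have h1 := (hU.summable_norm_sv hp).tendsto_cofinite_zero.eventually (gt_mem_nhds one_pos)
    rw [eventually_cofinite] at h1
    refine h1.subset fun γ hγ hlt => ?_
    have h2 : ‖sv q p γ‖ ^ 2 = 1 := by
      rw [← norm_pow, show sv q p γ ^ 2 = 1 from hγ, norm_one]
    nlinarith [norm_nonneg (sv q p γ)]
  set B : Finset (V → ℤ) := hfin.toFinset.image Subtype.val with hB
  have hmem : ∀ β, β ∈ B ↔ β ∈ posRoots Γ ∧ sv q p β ^ 2 = 1 := by
    intro β
    simp only [hB, Finset.mem_image, Set.Finite.mem_toFinset, Set.mem_ofPred_eq]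
    constructor
    · rintro ⟨γ, h1, rfl⟩; exact ⟨γ.2, h1⟩
    · rintro ⟨h1, h2⟩; exact ⟨⟨β, h1⟩, h2, rfl⟩
  obtain ⟨N, hNo, hpN, hNU, H, hH, hNH, -⟩ :=
    exists_numerator_eq_prod_mul hU hq hw hp B fun β hβ => (hmem β).1 hβ
  have hR := hU.differentiableOn_rootProd 1 B
  have hR0 : rootProd Γ q 1 B p ≠ 0 := hU.rootProd_ne_zero 1 B hp fun γ hγ hγB h =>
    hγB ((hmem γ).2 ⟨hγ, by rwa [one_mul] at h⟩)
  refine ⟨N ∩ rootProd Γ q 1 B ⁻¹' {0}ᶜ,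
    (hR.continuousOn.mono hNU).isOpen_inter_preimage hNo isOpen_compl_singleton, ⟨hpN, hR0⟩,
    Set.inter_subset_left.trans hNU, fun x => H x / rootProd Γ q 1 B x, ?_, ?_⟩
  · simp only [div_eq_mul_inv]
    exact (hH.mono Set.inter_subset_left).mul
      (DifferentiableOn.fun_inv (hR.mono (Set.inter_subset_left.trans hNU)) fun x hx => hx.2)
  · rintro x ⟨hx, hx0⟩
    have hx0' : rootProd Γ q 1 B x ≠ 0 := hx0
    rw [hNH x hx, ← hU.rootProd_mul_prod 1 (L := B) (fun β hβ => ((hmem β).1 hβ).1) (hNU hx)]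
    simp only [one_mul]
    field_simp

/-- The numerator is divisible by `Δ`. The local quotients agree where `Δ` does not vanish, hence
everywhere. -/
theorem exists_numerator_eq_delta_mul (hU : IsGoodDomain Γ q U) (hq : 1 < q)
    {word : (coxeterMatrix Γ).Group → List V} (hw : IsReducedWords word) :
    ∃ G : (V → ℂ) → ℂ, DifferentiableOn ℂ G U ∧
      ∀ x ∈ U, numerator q word x = rootProd Γ q 1 ∅ x * G x := by
  classical
  choose! N hNo hpN hNU G hG hNG using
    fun (p : V → ℂ) (hp : p ∈ U) => exists_local_quotient hU hq hw hp
  have key : ∀ p ∈ U, ∀ x ∈ N p, G x x = G p x := by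
    intro p hp x hx
    have hxU := hNU p hp hx
    refine eqOn_of_eqOn_regularSet (Γ := Γ) (q := q) ((hNo x hxU).inter (hNo p hp)) (by omega)
      ((hG x hxU).continuousOn.mono Set.inter_subset_left)
      ((hG p hp).continuousOn.mono Set.inter_subset_right) ?_ ⟨hpN x hxU, hx⟩
    rintro y ⟨⟨hy1, hy2⟩, hy⟩
    have h0 := (hU.rootProd_ne_zero_of_regular (hNU x hxU hy1) hy).2
    exact mul_left_cancel₀ h0 ((hNG x hxU y hy1).symm.trans (hNG p hp y hy2))
  refine ⟨fun x => G x x, fun p hp => ?_, fun x hx => hNG x hx x (hpN x hx)⟩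
  have h1 := (hG p hp).differentiableAt ((hNo p hp).mem_nhds (hpN p hp))
  refine (h1.congr_of_eventuallyEq ?_).differentiableWithinAt
  filter_upwards [(hNo p hp).mem_nhds (hpN p hp)] with x hx
  exact key p hp x hx

end

/-! ### Recurrences in one variable -/

section

open Function Filter

/-- The solutions of the recurrence are `r ^ (-n)` times a function of the parity of `n`; the only
one with `v n * r ^ n → 0` is zero. -/
theorem eq_zero_of_recurrence_of_tendsto {r : ℂ} (hr : r ≠ 0) {v f : ℤ → ℂ} {n₀ : ℤ}
    (hrec : ∀ n, v (n - 2) = r ^ 2 * v n) (hv : ∀ n, n₀ ≤ n → v n = f n)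
    (hf : Tendsto (fun n : ℕ => f n * r ^ n) atTop (𝓝 0)) (n : ℤ) : v n = 0 := by
  have h1 : ∀ (k : ℕ) (n : ℤ), v n = r ^ (2 * k) * v (n + 2 * k) := by
    intro k
    induction k with
    | zero => intro n; simp
    | succ k ih =>
      intro n
      have := hrec (n + 2 * (k + 1 : ℕ))
      rw [ih n, show n + 2 * (k : ℤ) = n + 2 * (k + 1 : ℕ) - 2 by push_cast; ring, this]
      ring
  set M : ℕ := n₀.toNat with hM
  set m : ℕ := n.toNat with hm
  -- it is enough to treat large indices of the same parity
  obtain ⟨N, K, hN, hN0, hNM⟩ : ∃ N K : ℕ, n + 2 * (K : ℤ) = N ∧ n₀ ≤ N ∧ 0 ≤ N :=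
    ⟨(n + 2 * ((n₀ - n).toNat + (-n).toNat : ℕ)).toNat, (n₀ - n).toNat + (-n).toNat,
      by omega, by omega, by omega⟩
  have h2 : ∀ k : ℕ, v N * r ^ N = f ((N + 2 * k : ℕ) : ℤ) * r ^ (N + 2 * k) := by
    intro k
    rw [h1 k N, ← hv _ (by push_cast; omega)]
    push_cast
    ring
  have h3 : Tendsto (fun k : ℕ => f ((N + 2 * k : ℕ) : ℤ) * r ^ (N + 2 * k)) atTop (𝓝 0) :=
    hf.comp (tendsto_atTop_mono (fun k => show k ≤ N + 2 * k by omega) tendsto_id)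
  have h4 := tendsto_nhds_unique (h3.congr fun k => (h2 k).symm) tendsto_const_nhds
  rw [h1 K n, hN, (mul_eq_zero.1 h4.symm).resolve_right (pow_ne_zero _ hr), mul_zero]

/-- The odd functional equation for the coefficients `c` of `Z`, from the equation satisfied by the
coefficients `f` of `(1 - q s ^ 2) Z`, where `r = √q`: the difference of the two sides is
annihilated by `(E ^ 2 - q) (1 - q E ^ 2)`, where `E` is the shift `n ↦ n - 1`. The decay of `f`
removes the first factor, the antisymmetry of the difference under `n ↦ S - 1 - n` the second. -/
theorem eq_of_odd_recurrence {r : ℂ} (hr : r ≠ 0) (hr4 : r ^ 4 ≠ 1) {c f : ℤ → ℂ} {S : ℤ}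
    (hc : ∀ n < 0, c n = 0) (hf : ∀ n, f n = c n - r ^ 2 * c (n - 2))
    (hlim : Tendsto (fun n : ℕ => f n * r ^ n) atTop (𝓝 0))
    (h : ∀ n, f (n - 2) - r ^ 2 * f n = f (S - n + 1) - r ^ 2 * f (S - n + 3)) (n : ℤ) :
    c n = c (S - 1 - n) := by
  set e : ℤ → ℂ := fun n => c n - c (S - 1 - n) with he
  have hv := eq_zero_of_recurrence_of_tendsto hr (v := fun n => e n - r ^ 2 * e (n - 2)) (f := f)
    (n₀ := S + 2) (fun n => by
      have h1 := h n
      simp only [hf] at h1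
      simp only [he]
      rw [show n - 2 - 2 = n - 4 by ring] at h1 ⊢
      rw [show S - n + 1 - 2 = S - 1 - n by ring, show S - n + 3 - 2 = S - n + 1 by ring] at h1
      rw [show S - 1 - (n - 2) = S - n + 1 by ring, show S - 1 - (n - 4) = S - n + 3 by ring]
      linear_combination h1) (fun n hn => by
      simp only [he, hf]
      rw [hc (S - 1 - n) (by omega), hc (S - 1 - (n - 2)) (by omega)]
      ring) hlim
  have h1 := hv (n + 2)
  have h2 := hv (S - 1 - n)
  simp only [he] at h1 h2
  rw [show n + 2 - 2 = n by ring, show S - 1 - (n + 2) = S - 1 - n - 2 by ring] at h1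
  rw [show S - 1 - (S - 1 - n) = n by ring, show S - 1 - (S - 1 - n - 2) = n + 2 by ring] at h2
  have h3 : (r ^ 4 - 1) * (c n - c (S - 1 - n)) = 0 := by linear_combination h2 - r ^ 2 * h1
  exact sub_eq_zero.1 ((mul_eq_zero.1 h3).resolve_left (sub_ne_zero.2 hr4))

/-- The even functional equation; the argument is that of `eq_of_odd_recurrence` for the
coefficients of `(1 - √q s) Z`, with the operator `(E ^ 2 - q) (1 + √q E)`. -/
theorem eq_of_even_recurrence {r : ℂ} (hr : r ≠ 0) (hr2 : r ^ 2 ≠ 1) {c f : ℤ → ℂ} {S : ℤ}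
    (hc : ∀ n < 0, c n = 0) (hf : ∀ n, f n = c n - r ^ 2 * c (n - 2))
    (hlim : Tendsto (fun n : ℕ => f n * r ^ n) atTop (𝓝 0))
    (h : ∀ n, f (n - 2) - r ^ 2 * f n =
      r * f (S - n + 3) + (1 - r ^ 2) * f (S - n + 2) - r * f (S - n + 1)) (n : ℤ) :
    c n - r * c (n - 1) = c (S - n) - r * c (S - n - 1) := by
  set b : ℤ → ℂ := fun n => c n - r * c (n - 1) with hb
  have hfb : ∀ n, f n = b n + r * b (n - 1) := fun n => by
    simp only [hf, hb]
    rw [show n - 1 - 1 = n - 2 by ring]; ring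
  have hb0 : ∀ n < 0, b n = 0 := fun n hn => by
    simp only [hb]; rw [hc n hn, hc (n - 1) (by omega)]; ring
  set e : ℤ → ℂ := fun n => b n - b (S - n) with he
  have hv := eq_zero_of_recurrence_of_tendsto hr (v := fun n => e n + r * e (n - 1)) (f := f)
    (n₀ := S + 2) (fun n => by
      have h1 := h n
      simp only [hfb] at h1
      simp only [he]
      rw [show n - 2 - 1 = n - 3 by ring] at h1 ⊢
      rw [show S - n + 3 - 1 = S - n + 2 by ring, show S - n + 2 - 1 = S - n + 1 by ring,
        show S - n + 1 - 1 = S - n by ring] at h1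
      rw [show S - (n - 2) = S - n + 2 by ring, show S - (n - 3) = S - n + 3 by ring,
        show S - (n - 1) = S - n + 1 by ring]
      linear_combination h1) (fun n hn => by
      simp only [he, hfb]
      rw [hb0 (S - n) (by omega), hb0 (S - (n - 1)) (by omega)]
      ring) hlim
  have h1 := hv (n + 1)
  have h2 := hv (S - n)
  simp only [he] at h1 h2
  rw [show n + 1 - 1 = n by ring, show S - (n + 1) = S - n - 1 by ring] at h1
  rw [show S - (S - n) = n by ring, show S - (S - n - 1) = n + 1 by ring] at h2
  have h3 : (r ^ 2 - 1) * (b n - b (S - n)) = 0 := by linear_combination r * h1 + h2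
  have h4 := sub_eq_zero.1 ((mul_eq_zero.1 h3).resolve_left (sub_ne_zero.2 hr2))
  simpa only [hb] using h4

/-! ### Laurent series in the normalized monomials -/

variable {V : Type*} [Fintype V] [DecidableEq V] {Γ : SimpleGraph V} [DecidableRel Γ.Adj]
  {q : ℕ} {U : Set (V → ℂ)}

omit [DecidableEq V] in
theorem sv_add_of_ne_zero (hq : 0 < q) {x : V → ℂ} (hx : ∀ k, x k ≠ 0) (α β : V → ℤ) :
    sv q x (α + β) = sv q x α * sv q x β := by
  rw [sv_eq_prod hq, sv_eq_prod hq, sv_eq_prod hq, ← Finset.prod_mul_distrib]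
  exact Finset.prod_congr rfl fun k _ => zpow_add₀ (mul_ne_zero (sqrtq_ne_zero hq) (hx k)) _ _

theorem sv_single_natCast (hq : 0 < q) (x : V → ℂ) (i : V) (m : ℕ) :
    sv q x (Pi.single i (m : ℤ)) = (sqrtq q * x i) ^ m := by
  rw [sv_eq_prod hq, Finset.prod_eq_single i]
  · simp
  · intro j _ hj; simp [hj]
  · simp

theorem hasSum_shift (hq : 0 < q) {x : V → ℂ} (hx : ∀ k, x k ≠ 0) {f : (V → ℤ) → ℂ} {y : ℂ}
    (h : HasSum (fun a => f a * sv q x a) y) (i : V) (m : ℕ) :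
    HasSum (fun a => f (a - Pi.single i (m : ℤ)) * sv q x a) ((sqrtq q * x i) ^ m * y) := by
  rw [← (Equiv.addRight (Pi.single i (m : ℤ) : V → ℤ)).hasSum_iff]
  refine (h.mul_left _).congr_fun fun a => ?_
  simp only [comp_apply, Equiv.coe_addRight, add_sub_cancel_right]
  rw [sv_add_of_ne_zero hq hx, sv_single_natCast hq]
  ring

theorem hasSum_sigma (hq : 0 < q) {x : V → ℂ} (hx : ∀ k, x k ≠ 0) {f : (V → ℤ) → ℂ} {y : ℂ}
    (i : V) (h : HasSum (fun a => f a * sv q (sigma Γ q i x) a) y) :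
    HasSum (fun a => f (reflection Γ i a) * sv q x a) y := by
  have hinv : Function.Involutive (reflection Γ i) := reflection_reflection Γ i
  rw [← (hinv.toPerm _).hasSum_iff]
  refine h.congr_fun fun a => ?_
  simp only [comp_apply, Function.Involutive.coe_toPerm, reflection_reflection, sv_sigma Γ hq hx]

omit [DecidableEq V] in
theorem eq_zero_of_hasSum_sv (hq : 0 < q) {ρ : V → ℝ} (hρ : ∀ k, 0 < ρ k) {e : (V → ℤ) → ℂ}
    (h : ∀ x : V → ℂ, (∀ k, ‖x k‖ = ρ k) → HasSum (fun a => e a * sv q x a) 0) (a : V → ℤ) :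
    e a = 0 := by
  have h1 := laurent_coeff_eq_zero hρ (e := fun a => e a * sqrtq q ^ height a) (fun x hx => by
    refine (h x hx).congr_fun fun a => ?_
    rw [sv, monomial]; ring) a
  exact (mul_eq_zero.1 h1).resolve_right (zpow_ne_zero _ (sqrtq_ne_zero hq))

/-- The coefficients of a power series with respect to the normalized monomials, extended by zero
to all integral exponents. -/
def normCoeff (q : ℕ) (c : (V → ℕ) → ℂ) (a : V → ℤ) : ℂ :=
  if ∀ k, 0 ≤ a k then c (fun k => (a k).toNat) / sqrtq q ^ height a else 0

omit [DecidableEq V] in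
theorem hasSum_normCoeff (hq : 0 < q) {c : (V → ℕ) → ℂ} {x : V → ℂ} {y : ℂ}
    (h : HasSum (fun a => c a * ∏ k, x k ^ a k) y) :
    HasSum (fun a => normCoeff q c a * sv q x a) y := by
  have hinj : Function.Injective fun (a : V → ℕ) (k : V) => (a k : ℤ) := fun a b hab => by
    ext k; exact Int.natCast_inj.1 (congr_fun hab k)
  refine (hinj.hasSum_iff fun a ha => ?_).1 ?_
  · have : ¬ ∀ k, 0 ≤ a k := fun h0 => ha ⟨fun k => (a k).toNat, by
      ext k; exact Int.toNat_of_nonneg (h0 k)⟩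
    rw [normCoeff, if_neg this, zero_mul]
  · refine h.congr_fun fun a => ?_
    have h0 : ∀ k, (0 : ℤ) ≤ (a k : ℤ) := fun k => Int.natCast_nonneg _
    have h1 := zpow_ne_zero (height fun k => (a k : ℤ)) (sqrtq_ne_zero hq)
    simp only [comp_apply, normCoeff, h0, implies_true, if_true, sv, monomial,
      Int.toNat_natCast, zpow_natCast]
    field_simp

end

/-! ### Comparison of Laurent coefficients -/

section

open Function Filter

variable {V : Type*} [Fintype V] [DecidableEq V] {Γ : SimpleGraph V} [DecidableRel Γ.Adj]
  {q : ℕ} {U : Set (V → ℂ)}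

/-- On a thin polydisc around a disc in the `i`-th coordinate axis, the only factor of `D` which may
vanish is that of the simple root `e_i`: on the axis itself the other monomials are zero. -/
theorem IsGoodDomain.exists_polydisc (hU : IsGoodDomain Γ q U) (hq : 0 < q) (i : V) {ρ : ℝ}
    (hρ : 0 < ρ) : ∃ δ > 0, ∀ x : V → ℂ, ‖x i‖ ≤ ρ → (∀ j, j ≠ i → ‖x j‖ ≤ δ) →
      x ∈ U ∧ ∀ γ ∈ posRoots Γ, γ ≠ Pi.single i 1 → q * sv q x γ ^ 2 ≠ 1 := by
  have hq' : (0 : ℝ) < q := by exact_mod_cast hq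
  set P : V → ℂ := Pi.single i (ρ : ℂ) with hP
  have hPU : P ∈ U := hU.single_mem i _
  obtain ⟨N, hN, κ, hκ, h⟩ := hU.summable P hPU
  have hfin := hκ.tendsto_cofinite_zero.eventually (gt_mem_nhds (inv_pos.2 hq'))
  rw [eventually_cofinite] at hfin
  have h1 : ∀ᶠ x in 𝓝 P, ∀ γ ∈ {γ : posRoots Γ | ¬ κ γ < (q : ℝ)⁻¹},
      (γ : V → ℤ) ≠ Pi.single i 1 → ‖sv q x γ‖ < (q : ℝ)⁻¹ := by
    refine (eventually_all_finite hfin).2 fun γ _ => ?_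
    by_cases hγ : (γ : V → ℤ) = Pi.single i 1
    · simp [hγ]
    · have h0 : sv q P γ = 0 := by
        obtain ⟨k, hki, hk⟩ : ∃ k, k ≠ i ∧ (γ : V → ℤ) k ≠ 0 := by
          by_contra! hcon
          rcases γ.2.1.eq_single_or_neg hcon with h0 | h0
          · exact hγ h0
          · have := γ.2.2 i
            rw [h0] at this
            simp at this
        rw [sv, monomial, Finset.prod_eq_zero (Finset.mem_univ k), mul_zero]
        rw [hP, Pi.single_eq_of_ne hki, zero_zpow _ hk]
      have hc := (differentiable_sv q γ.2.2).continuous.norm.tendsto P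
      rw [h0, norm_zero] at hc
      filter_upwards [hc.eventually (gt_mem_nhds (inv_pos.2 hq'))] with x hx _ using hx
  obtain ⟨ε, hε, hball⟩ := Metric.eventually_nhds_iff.1
    ((h1.and (eventually_mem_set.2 hN)).and (eventually_mem_set.2 (hU.isOpen.mem_nhds hPU)))
  set y : V → ℂ := fun k => if k = i then (ρ : ℂ) else ((ε / 2 : ℝ) : ℂ) with hy
  have hyP : dist y P < ε := by
    rw [dist_pi_lt_iff hε]
    intro k
    by_cases hk : k = i
    · subst hk; simpa [hy, hP] using hε
    · simp only [hy, hk, if_false, hP, Pi.single_eq_of_ne hk, dist_zero_right]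
      rw [Complex.norm_real, Real.norm_of_nonneg (by positivity)]
      linarith
  obtain ⟨⟨h2, hyN⟩, hyU⟩ := hball hyP
  refine ⟨ε / 2, by positivity, fun x hxi hxj => ?_⟩
  have hxy : ∀ k, ‖x k‖ ≤ ‖y k‖ := by
    intro k
    by_cases hk : k = i
    · subst hk
      simpa [hy, abs_of_pos hρ] using hxi
    · have := hxj k hk
      simpa [hy, hk, abs_of_pos hε] using this
  refine ⟨hU.reinhardt y hyU x hxy, fun γ hγ hγi h0 => ?_⟩
  have h3 : ‖sv q x γ‖ < (q : ℝ)⁻¹ := by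
    refine (norm_sv_mono q hxy hγ.2).trans_lt ?_
    by_cases hb : κ ⟨γ, hγ⟩ < (q : ℝ)⁻¹
    · exact (h ⟨γ, hγ⟩ y hyN).trans_lt hb
    · exact h2 ⟨γ, hγ⟩ hb hγi
  have h4 : (q : ℝ) * ‖sv q x γ‖ ^ 2 = 1 := by
    have := congr_arg norm h0
    rwa [norm_mul, norm_pow, Complex.norm_natCast, norm_one] at this
  have h5 : (1 : ℝ) ≤ q := by exact_mod_cast hq
  have h6 : (q : ℝ) * ‖sv q x γ‖ < 1 := by
    exact (mul_lt_mul_of_pos_left h3 hq').trans_eq (mul_inv_cancel₀ hq'.ne')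
  have h7 : ‖sv q x γ‖ < 1 := h3.trans_le (inv_le_one_of_one_le₀ h5)
  nlinarith [norm_nonneg (sv q x γ)]

/-- The functional equation of the quotient `G = N / Δ`. -/
theorem quotient_sigma (hU : IsGoodDomain Γ q U) (hq : 0 < q)
    {word : (coxeterMatrix Γ).Group → List V} (hw : IsReducedWords word) {G : (V → ℂ) → ℂ}
    (hG : DifferentiableOn ℂ G U)
    (hNG : ∀ x ∈ U, numerator q word x = rootProd Γ q 1 ∅ x * G x) (i : V) {x : V → ℂ}
    (hxU : x ∈ U) (hx : ∀ k, x k ≠ 0) :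
    (sv q x (Pi.single i 1) ^ 2 - q) * G x =
      (numEven q (sv q x (Pi.single i 1)) + numOdd q (sv q x (Pi.single i 1))) / 2 *
        G (sigma Γ q i x) +
      (numEven q (sv q x (Pi.single i 1)) - numOdd q (sv q x (Pi.single i 1))) / 2 *
        G (epsilon Γ i (sigma Γ q i x)) := by
  set T : Set (V → ℂ) := {x | ∀ k, x k ≠ 0} with hT
  have hTo : IsOpen T := isOpen_torus
  have hs : Continuous fun x : V → ℂ => sv q x (Pi.single i 1) :=
    (differentiable_sv q (single_mem_posRoots Γ i).2).continuous
  have hG' := hG.continuousOn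
  have hσ : ContinuousOn (sigma Γ q i) (U ∩ T) :=
    (differentiableOn_sigma q i).continuousOn.mono Set.inter_subset_right
  have hσU : Set.MapsTo (sigma Γ q i) (U ∩ T) U := fun y hy => hU.sigma_mem y hy.1 hy.2 i
  have hN1 : ContinuousOn (fun y => G (sigma Γ q i y)) (U ∩ T) := hG'.comp hσ hσU
  have hN2 : ContinuousOn (fun y => G (epsilon Γ i (sigma Γ q i y))) (U ∩ T) :=
    hG'.comp ((differentiable_epsilon i).continuous.comp_continuousOn hσ)
      fun y hy => hU.epsilon_mem (hσU hy) i
  have hN0 := hG'.mono (Set.inter_subset_left : U ∩ T ⊆ U)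
  refine eqOn_of_eqOn_regularSet (Γ := Γ) (hU.isOpen.inter hTo) hq
    (f := fun x => (sv q x (Pi.single i 1) ^ 2 - q) * G x)
    (g := fun x =>
      (numEven q (sv q x (Pi.single i 1)) + numOdd q (sv q x (Pi.single i 1))) / 2 *
        G (sigma Γ q i x) +
      (numEven q (sv q x (Pi.single i 1)) - numOdd q (sv q x (Pi.single i 1))) / 2 *
        G (epsilon Γ i (sigma Γ q i x))) ?_ ?_ ?_ ⟨hxU, hx⟩
  · exact (Continuous.continuousOn (by fun_prop)).mul hN0
  · simp only [numEven, numOdd]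
    refine ContinuousOn.add ?_ ?_
    · exact (Continuous.continuousOn (by fun_prop)).mul hN1
    · exact (Continuous.continuousOn (by fun_prop)).mul hN2
  · rintro y ⟨⟨hyU, hyT⟩, hy⟩
    have hyσ := hU.sigma_mem y hyU hyT i
    have h := numerator_sigma hU hq hw i hyU hyT rfl
    have h2 := hU.delta_sigma hq i hyU hyT
    rw [hNG y hyU, hNG _ hyσ, hNG _ (hU.epsilon_mem hyσ i), rootProd_epsilon, ← h2] at h
    have h3 : rootProd Γ q 1 ∅ (sigma Γ q i y) * -sv q y (Pi.single i 1) ^ 2 ≠ 0 := by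
      rw [h2]; exact (hU.rootProd_ne_zero_of_regular hyU hy).2
    refine mul_left_cancel₀ h3 ?_
    simp only
    linear_combination h

theorem epsSign_reflection (i : V) (a : V → ℤ) :
    epsSign Γ i (reflection Γ i a) = epsSign Γ i a := by
  rw [epsSign, epsSign]
  congr 1
  exact Finset.sum_congr rfl fun j hj => reflection_of_ne Γ ((Γ.mem_neighborFinset i j).1 hj).ne' a

theorem epsSign_sub_single (i : V) (a : V → ℤ) (m : ℤ) :
    epsSign Γ i (a - Pi.single i m) = epsSign Γ i a := by
  rw [epsSign, epsSign]
  congr 1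
  refine Finset.sum_congr rfl fun j hj => ?_
  rw [Pi.sub_apply, Pi.single_eq_of_ne ((Γ.mem_neighborFinset i j).1 hj).ne', sub_zero]

/-- Comparison of the Laurent coefficients in the functional equation of
`H = (1 - q s ^ 2) Z`, where `s = √q x_i`. The sign `epsSign` selects the even or the odd part. -/
theorem recurrence_of_hasSum (hq : 0 < q) (i : V) {ρ : V → ℝ} (hρ : ∀ k, 0 < ρ k)
    {f : (V → ℤ) → ℂ} {H : (V → ℂ) → ℂ}
    (h0 : ∀ x : V → ℂ, (∀ k, ‖x k‖ = ρ k) → HasSum (fun a => f a * sv q x a) (H x))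
    (h1 : ∀ x : V → ℂ, (∀ k, ‖x k‖ = ρ k) →
      HasSum (fun a => f a * sv q (sigma Γ q i x) a) (H (sigma Γ q i x)))
    (h2 : ∀ x : V → ℂ, (∀ k, ‖x k‖ = ρ k) →
      HasSum (fun a => f a * sv q (epsilon Γ i (sigma Γ q i x)) a)
        (H (epsilon Γ i (sigma Γ q i x))))
    (heq : ∀ x : V → ℂ, (∀ k, ‖x k‖ = ρ k) → ∀ s, s = sqrtq q * x i → (s ^ 2 - q) * H x =
      (numEven q s + numOdd q s) / 2 * H (sigma Γ q i x) +
        (numEven q s - numOdd q s) / 2 * H (epsilon Γ i (sigma Γ q i x))) (a : V → ℤ) :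
    f (a - Pi.single i 2) - q * f a =
      (sqrtq q * f (reflection Γ i (a - Pi.single i 3)) +
        (1 - q) * f (reflection Γ i (a - Pi.single i 2)) -
        sqrtq q * f (reflection Γ i (a - Pi.single i 1))) * ((1 + epsSign Γ i a) / 2) +
      (f (reflection Γ i (a - Pi.single i 1)) - q * f (reflection Γ i (a - Pi.single i 3))) *
        ((1 - epsSign Γ i a) / 2) := by
  obtain ⟨e, he⟩ : ∃ e : (V → ℤ) → ℂ, ∀ a, e a =
      (f (a - Pi.single i 2) - q * f a) -
      ((sqrtq q * f (reflection Γ i (a - Pi.single i 3)) +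
        (1 - q) * f (reflection Γ i (a - Pi.single i 2)) -
        sqrtq q * f (reflection Γ i (a - Pi.single i 1))) * ((1 + epsSign Γ i a) / 2) +
      (f (reflection Γ i (a - Pi.single i 1)) - q * f (reflection Γ i (a - Pi.single i 3))) *
        ((1 - epsSign Γ i a) / 2)) := ⟨_, fun _ => rfl⟩
  suffices key : ∀ x : V → ℂ, (∀ k, ‖x k‖ = ρ k) → HasSum (fun a => e a * sv q x a) 0 by
    have h3 := eq_zero_of_hasSum_sv hq hρ key a
    rw [he] at h3
    exact sub_eq_zero.1 h3
  intro x hx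
  have hx0 : ∀ k, x k ≠ 0 := fun k => norm_ne_zero_iff.1 (by rw [hx k]; exact (hρ k).ne')
  have k0 := h0 x hx
  have k1 := hasSum_sigma hq hx0 i (h1 x hx)
  have k2 : HasSum (fun a => (epsSign Γ i a * f (reflection Γ i a)) * sv q x a)
      (H (epsilon Γ i (sigma Γ q i x))) := by
    refine (hasSum_sigma (Γ := Γ) (f := fun a => epsSign Γ i a * f a) hq hx0 i
      ((h2 x hx).congr_fun fun a => ?_)).congr_fun fun a => ?_
    · rw [sv_epsilon, epsSign]; ring
    · simp only [epsSign_reflection]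
  have hH := heq x hx _ rfl
  have hrq := sqrtq_sq q
  set s := sqrtq q * x i with hs
  have A2 := hasSum_shift hq hx0 k0 i 2
  have B := fun m => hasSum_shift hq hx0 k1 i m
  have C := fun m => hasSum_shift hq hx0 k2 i m
  have tot := (A2.sub (k0.mul_left (q : ℂ))).sub
    ((((((B 3).add (C 3)).mul_left (sqrtq q / 2)).add
      (((B 2).add (C 2)).mul_left ((1 - (q : ℂ)) / 2))).sub
      (((B 1).add (C 1)).mul_left (sqrtq q / 2))).add
      ((((B 1).sub (C 1)).mul_left (1 / 2 : ℂ)).sub (((B 3).sub (C 3)).mul_left ((q : ℂ) / 2))))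
  simp only [Nat.cast_ofNat, Nat.cast_one, epsSign_sub_single] at tot
  have key : ∀ y : ℂ, HasSum (fun a => e a * sv q x a) y → y = 0 →
      HasSum (fun a => e a * sv q x a) 0 := fun y h h0 => h0 ▸ h
  refine key _ (tot.congr_fun fun a => ?_) ?_
  · rw [he]; ring
  · rw [← hs]
    simp only [numEven, numOdd] at hH
    linear_combination hH - s ^ 2 / 2 *
      (H (sigma Γ q i x) + H (epsilon Γ i (sigma Γ q i x))) * hrq

end

/-! ### From the Laurent coefficients to the recurrences -/

section

open Function Filter

variable {V : Type*} [Fintype V] [DecidableEq V] {Γ : SimpleGraph V} [DecidableRel Γ.Adj]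
  {q : ℕ} {U : Set (V → ℂ)}

theorem reflection_update (i : V) (a : V → ℤ) (n : ℤ) :
    reflection Γ i (update a i n) = update a i (∑ j ∈ Γ.neighborFinset i, a j - n) := by
  rw [reflection, update_self, update_idem]
  congr 2
  refine Finset.sum_congr rfl fun j hj => ?_
  rw [update_of_ne ((Γ.mem_neighborFinset i j).1 hj).ne']

omit [Fintype V] in
theorem update_sub_single (i : V) (a : V → ℤ) (n m : ℤ) :
    update a i n - Pi.single i m = update a i (n - m) := by
  ext k
  by_cases hk : k = i
  · subst hk; simp
  · simp [hk]

theorem epsSign_update (i : V) (a : V → ℤ) (n : ℤ) :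
    epsSign Γ i (update a i n) = (-1) ^ ∑ j ∈ Γ.neighborFinset i, a j := by
  rw [epsSign]
  congr 1
  refine Finset.sum_congr rfl fun j hj => ?_
  rw [update_of_ne ((Γ.mem_neighborFinset i j).1 hj).ne']

/-- If the series with coefficients `f` converges at a point of the torus whose `i`-th coordinate
has absolute value `1`, then the coefficients along the direction of `e_i` tend to zero. -/
theorem tendsto_coeff_update (hq : 0 < q) {f : (V → ℤ) → ℂ} {x : V → ℂ} {i : V}
    (hx : ∀ k, x k ≠ 0) (hxi : x i = 1) (hs : Summable fun a => f a * sv q x a) (a : V → ℤ) :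
    Tendsto (fun n : ℕ => f (update a i n) * sqrtq q ^ n) atTop (𝓝 0) := by
  have hinj : Function.Injective fun n : ℕ => update a i (n : ℤ) := fun n m h => by
    have := congr_fun h i
    simpa using this
  have h1 := hs.tendsto_cofinite_zero.comp hinj.tendsto_cofinite
  rw [Nat.cofinite_eq_atTop] at h1
  have h2 : ∀ n : ℕ, sv q x (update a i (n : ℤ)) = sv q x (update a i 0) * sqrtq q ^ n := by
    intro n
    have h3 : update a i (n : ℤ) = update a i 0 + Pi.single i (n : ℤ) := by
      ext k
      by_cases hk : k = i
      · subst hk; simp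
      · simp [hk]
    rw [h3, sv_add_of_ne_zero hq hx, sv_single_natCast hq, hxi, mul_one]
  have h4 := sv_ne_zero hq hx (update a i 0)
  have h5 := h1.mul_const (sv q x (update a i 0))⁻¹
  rw [zero_mul] at h5
  refine h5.congr fun n => ?_
  simp only [comp_apply, h2]
  field_simp

/-- The functional equation at the vertex `i` in terms of normalized coefficients. Here `F` is the
continuation of the series `Z` with coefficients `c`, and `H = (1 - q s ^ 2) F` near the origin,
where `s = √q x_i`; but `H` is holomorphic on a polydisc around the closed disc `‖x i‖ ≤ 1`, where
it satisfies the functional equation of `quotient_sigma`. -/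
theorem recurrence_normCoeff (hq : 1 < q) (i : V) {δ r₀ : ℝ} (hδ : 0 < δ) (hr₀ : 0 < r₀)
    {H F : (V → ℂ) → ℂ} {c : (V → ℕ) → ℂ}
    (hH : DifferentiableOn ℂ H {x | ∀ k, ‖x k‖ < if k = i then 2 else δ})
    (hF : ∀ x : V → ℂ, (∀ k, ‖x k‖ < r₀) → HasSum (fun a => c a * ∏ k, x k ^ a k) (F x))
    (hHF : ∀ x : V → ℂ, (∀ k, ‖x k‖ < if k = i then (q : ℝ)⁻¹ else δ) →
      H x = (1 - q * (sqrtq q * x i) ^ 2) * F x)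
    (heq : ∀ x : V → ℂ, (∀ k, x k ≠ 0) → ‖x i‖ ≤ 1 → (∀ k, k ≠ i → ‖x k‖ < δ) →
      ∀ s, s = sqrtq q * x i → (s ^ 2 - q) * H x =
      (numEven q s + numOdd q s) / 2 * H (sigma Γ q i x) +
        (numEven q s - numOdd q s) / 2 * H (epsilon Γ i (sigma Γ q i x))) (a : V → ℤ) :
    (Odd (∑ j ∈ Γ.neighborFinset i, a j) → ∀ n, normCoeff q c (update a i n) =
      normCoeff q c (update a i (∑ j ∈ Γ.neighborFinset i, a j - 1 - n))) ∧
    (Even (∑ j ∈ Γ.neighborFinset i, a j) → ∀ n,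
      normCoeff q c (update a i n) - sqrtq q * normCoeff q c (update a i (n - 1)) =
      normCoeff q c (update a i (∑ j ∈ Γ.neighborFinset i, a j - n)) -
        sqrtq q * normCoeff q c (update a i (∑ j ∈ Γ.neighborFinset i, a j - n - 1))) := by
  have hq0 : 0 < q := by omega
  have hqR : (0 : ℝ) < q := by exact_mod_cast hq0
  have hqR1 : (1 : ℝ) < q := by exact_mod_cast hq
  have hr := sqrtq_ne_zero hq0
  have hrq := sqrtq_sq q
  -- the Taylor series of `H`
  obtain ⟨h, hh⟩ := exists_hasSum_of_differentiableOn
    (R := fun k => if k = i then 3 / 2 else δ / 2) (R' := fun k => if k = i then 2 else δ)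
    (fun k => by split_ifs <;> positivity)
    (fun k => by split_ifs <;> linarith) hH
  set f := normCoeff q h with hf
  set g := normCoeff q c with hg
  have hfs : ∀ x : V → ℂ, ‖x i‖ < 3 / 2 → (∀ k, k ≠ i → ‖x k‖ < δ / 2) →
      HasSum (fun a => f a * sv q x a) (H x) := by
    intro x hxi hx
    refine hasSum_normCoeff hq0 (hh x fun k => ?_)
    by_cases hk : k = i
    · subst hk; simpa using hxi
    · simpa [hk] using hx k hk
  -- comparison with the Taylor series of `F`
  have hfg : ∀ a, f a = g a - q * g (a - Pi.single i 2) := by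
    intro a
    set ρ : ℝ := min (min r₀ δ) (q : ℝ)⁻¹ / 2 / 2 with hρ
    have hm : 0 < min (min r₀ δ) (q : ℝ)⁻¹ := lt_min (lt_min hr₀ hδ) (inv_pos.2 hqR)
    have hρ0 : 0 < ρ := by positivity
    have hm1 := min_le_left (min r₀ δ) (q : ℝ)⁻¹
    have hm2 := min_le_right (min r₀ δ) (q : ℝ)⁻¹
    have hm3 := min_le_left r₀ δ
    have hm4 := min_le_right r₀ δ
    have hqi : (q : ℝ)⁻¹ < 1 := inv_lt_one_of_one_lt₀ hqR1
    have key := eq_zero_of_hasSum_sv hq0 (ρ := fun _ : V => ρ) (fun _ => hρ0)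
      (e := fun a => f a - (g a - q * g (a - Pi.single i 2))) (fun x hx => ?_) a
    · exact sub_eq_zero.1 key
    · have hx0 : ∀ k, x k ≠ 0 := fun k => norm_ne_zero_iff.1 (by rw [hx k]; exact hρ0.ne')
      have k1 := hfs x (by rw [hx]; linarith) (fun k _ => by rw [hx]; linarith)
      have k2 := hasSum_normCoeff hq0 (hF x fun k => by rw [hx]; linarith)
      have k3 := hasSum_shift hq0 hx0 k2 i 2
      have k4 := hHF x fun k => by rw [hx]; split_ifs <;> linarith
      have tot := k1.sub (k2.sub (k3.mul_left (q : ℂ)))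
      rw [k4] at tot
      have fin : ∀ y : ℂ, HasSum
          (fun a => (f a - (g a - q * g (a - Pi.single i 2))) * sv q x a) y → y = 0 →
          HasSum (fun a => (f a - (g a - q * g (a - Pi.single i 2))) * sv q x a) 0 :=
        fun y h h0 => h0 ▸ h
      refine fin _ (tot.congr_fun fun a => ?_) (by ring)
      simp only [Nat.cast_ofNat]
      ring
  -- on this torus `‖x i‖ = q ^ (-1 / 2)`, so that `σ_i` preserves all absolute values
  have hsq : (√(q : ℝ)) ^ 2 = q := Real.sq_sqrt hqR.le
  have hsq1 : 1 < √(q : ℝ) := Real.lt_sqrt_of_sq_lt (by simpa using hqR1)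
  have hsqi : (√(q : ℝ))⁻¹ < 1 := inv_lt_one_of_one_lt₀ hsq1
  have hqs : (q : ℝ)⁻¹ * √(q : ℝ) < 3 / 2 := by
    have h1 : (q : ℝ)⁻¹ * √(q : ℝ) = (√(q : ℝ))⁻¹ := by
      field_simp
      exact hsq
    linarith
  have hrec := recurrence_of_hasSum (Γ := Γ) (f := f) (H := H) hq0 i
    (ρ := fun k => if k = i then (√(q : ℝ))⁻¹ else δ / 4)
    (fun k => by split_ifs <;> positivity)
    (fun x hx => hfs x (by rw [hx]; simp; linarith) fun k hk => by rw [hx]; simp [hk]; linarith)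
    (fun x hx => by
      have hxi := hx i
      simp only [if_true] at hxi
      refine hfs _ ?_ fun k hk => ?_
      · rw [sigma_self, norm_mul, norm_inv, norm_inv, hxi, Complex.norm_natCast, inv_inv]
        exact hqs
      · have hxk := hx k
        simp only [hk, if_false] at hxk
        by_cases hadj : Γ.Adj i k
        · rw [sigma_of_adj Γ q hadj, norm_mul, norm_mul, norm_sqrtq, hxi, hxk,
            mul_inv_cancel₀ (by positivity)]
          linarith
        · rw [sigma_of_not_adj Γ q hk hadj, hxk]; linarith)
    (fun x hx => by
      have hxi := hx i
      simp only [if_true] at hxi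
      have hε : ∀ (y : V → ℂ) k, ‖epsilon Γ i y k‖ = ‖y k‖ := fun y k => by
        simp only [epsilon]; split_ifs <;> simp
      refine hfs _ ?_ fun k hk => ?_
      · rw [hε, sigma_self, norm_mul, norm_inv, norm_inv, hxi, Complex.norm_natCast, inv_inv]
        exact hqs
      · have hxk := hx k
        simp only [hk, if_false] at hxk
        rw [hε]
        by_cases hadj : Γ.Adj i k
        · rw [sigma_of_adj Γ q hadj, norm_mul, norm_mul, norm_sqrtq, hxi, hxk,
            mul_inv_cancel₀ (by positivity)]
          linarith
        · rw [sigma_of_not_adj Γ q hk hadj, hxk]; linarith)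
    (fun x hx s hs => heq x (fun k => norm_ne_zero_iff.1 (by
        rw [hx]; split_ifs <;> positivity)) (by rw [hx]; simp; linarith)
      (fun k hk => by rw [hx]; simp [hk]; linarith) s hs)
  set S := ∑ j ∈ Γ.neighborFinset i, a j with hS
  have hneg : ∀ n < 0, g (update a i n) = 0 := fun n hn => by
    have : ¬ ∀ k, 0 ≤ update a i n k := fun h0 => by
      have := h0 i
      rw [update_self] at this
      omega
    rw [hg, normCoeff, if_neg this]
  have hfg' : ∀ n, f (update a i n) =
      g (update a i n) - sqrtq q ^ 2 * g (update a i (n - 2)) := fun n => by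
    rw [hfg, update_sub_single, hrq]
  have hlim : Tendsto (fun n : ℕ => f (update a i n) * sqrtq q ^ n) atTop (𝓝 0) := by
    refine tendsto_coeff_update hq0 (x := fun k => if k = i then 1 else ((δ / 4 : ℝ) : ℂ))
      (fun k => ?_) (by simp) (hfs _ (by simp; norm_num) fun k hk => ?_).summable a
    · split_ifs
      · exact one_ne_zero
      · exact_mod_cast (by positivity : δ / 4 ≠ 0)
    · rw [if_neg hk, Complex.norm_real, Real.norm_of_nonneg (by positivity)]; linarith
  have hrec' := fun n => hrec (update a i n)
  simp only [update_sub_single, reflection_update, epsSign_update, ← hS,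
    sub_sub_eq_add_sub] at hrec'
  constructor
  · intro hodd n
    simp only [hodd.neg_one_zpow] at hrec'
    refine eq_of_odd_recurrence hr ?_ hneg hfg' hlim (fun n => ?_) n
    · intro h4
      have : (q : ℂ) ^ 2 = 1 := by rw [← hrq, ← pow_mul]; exact h4
      have : q ^ 2 = 1 := by exact_mod_cast this
      nlinarith
    · have := hrec' n
      rw [hrq, show S - n + 1 = S + 1 - n by ring, show S - n + 3 = S + 3 - n by ring]
      linear_combination this
  · intro heven n
    simp only [heven.neg_one_zpow] at hrec'
    refine eq_of_even_recurrence hr ?_ hneg hfg' hlim (fun n => ?_) n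
    · rw [hrq]; exact_mod_cast hq.ne'
    · have := hrec' n
      rw [hrq, show S - n + 1 = S + 1 - n by ring, show S - n + 2 = S + 2 - n by ring,
        show S - n + 3 = S + 3 - n by ring]
      linear_combination this

end

section

open Function Filter

variable {V : Type*} [Fintype V] [DecidableEq V] {Γ : SimpleGraph V} [DecidableRel Γ.Adj]
  {q : ℕ} {U : Set (V → ℂ)}

/-! ### The coefficients of the power series -/

theorem height_update (a : V → ℤ) (i : V) (n : ℤ) :
    height (update a i n) = height (update a i 0) + n := by
  rw [height, height, Finset.sum_update_of_mem (Finset.mem_univ i),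
    Finset.sum_update_of_mem (Finset.mem_univ i)]
  ring

/-- The formal power series with the coefficients `c`, indexed by plain functions. -/
def seriesOf (c : (V → ℕ) → ℂ) : MvPowerSeries V ℂ := fun a => c a

omit [Fintype V] [DecidableEq V] in
theorem coeff_seriesOf (c : (V → ℕ) → ℂ) (a : V →₀ ℕ) :
    MvPowerSeries.coeff a (seriesOf c) = c a := rfl

omit [DecidableEq V] in
theorem coeffZ_seriesOf (hq : 0 < q) (c : (V → ℕ) → ℂ) (a : V → ℤ) :
    coeffZ (seriesOf c) a = normCoeff q c a * sqrtq q ^ height a := by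
  rw [coeffZ, normCoeff]
  split_ifs
  · rw [coeff_seriesOf, div_mul_cancel₀ _ (zpow_ne_zero _ (sqrtq_ne_zero hq))]
    rfl
  · rw [zero_mul]

/-- In terms of normalized coefficients the powers of `q` in the functional equation disappear. -/
theorem functionalEquation_of_normCoeff (hq : 0 < q) (c : (V → ℕ) → ℂ) (i : V)
    (h : ∀ a : V → ℤ, (Odd (∑ j ∈ Γ.neighborFinset i, a j) → ∀ n, normCoeff q c (update a i n) =
      normCoeff q c (update a i (∑ j ∈ Γ.neighborFinset i, a j - 1 - n))) ∧
    (Even (∑ j ∈ Γ.neighborFinset i, a j) → ∀ n,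
      normCoeff q c (update a i n) - sqrtq q * normCoeff q c (update a i (n - 1)) =
      normCoeff q c (update a i (∑ j ∈ Γ.neighborFinset i, a j - n)) -
        sqrtq q * normCoeff q c (update a i (∑ j ∈ Γ.neighborFinset i, a j - n - 1)))) :
    FunctionalEquation Γ q (seriesOf c) i := by
  intro a
  have hr := sqrtq_ne_zero hq
  have hc : ∀ m, coeffZ (seriesOf c) (update a i m) =
      normCoeff q c (update a i m) * (sqrtq q ^ height (update a i 0) * sqrtq q ^ m) := fun m => by
    rw [coeffZ_seriesOf hq, height_update a i m, zpow_add₀ hr]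
  obtain ⟨hodd, heven⟩ := h a
  simp only [hc]
  set S := ∑ j ∈ Γ.neighborFinset i, a j with hS
  set r := sqrtq q
  have hqr : (q : ℂ) = r ^ (2 : ℤ) := by
    rw [← sqrtq_sq q]; norm_cast
  constructor
  · intro h1
    rw [hodd h1 (a i)]
    obtain ⟨t, ht⟩ := h1
    have h2 : (S - 1) / 2 = t := by omega
    rw [h2, ht, hqr, ← zpow_mul]
    have h3 : r ^ (a i) = r ^ (2 * (a i - t)) * r ^ (2 * t + 1 - 1 - a i) := by
      rw [← zpow_add₀ hr]; congr 1; ring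
    rw [h3]; ring
  · intro h1
    have h4 := heven h1 (a i)
    obtain ⟨t, ht⟩ := h1
    have h2 : S / 2 = t := by omega
    rw [h2, hqr, ← zpow_mul]
    have h3 : r ^ (a i) = r ^ (2 * (a i - t)) * r ^ (S - a i) := by
      rw [← zpow_add₀ hr, ht]; congr 1; ring
    have h5 : ∀ m : ℤ, r ^ (2 : ℤ) * r ^ (m - 1) = r * r ^ m := fun m => by
      rw [← zpow_add₀ hr, ← zpow_one_add₀ hr]; congr 1; ring
    have h6 := h5 (a i)
    have h7 := h5 (S - a i)
    set A := r ^ height (update a i 0)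
    linear_combination A * r ^ (a i) * h4 - normCoeff q c (update a i (a i - 1)) * A * h6 +
      r ^ (2 * (a i - t)) * normCoeff q c (update a i (S - a i - 1)) * A * h7 +
      A * (normCoeff q c (update a i (S - a i)) -
        r * normCoeff q c (update a i (S - a i - 1))) * h3

/-! ### Values at the origin -/

omit [DecidableEq V] in
theorem sv_zero_left (q : ℕ) {α : V → ℤ} (hα : α ≠ 0) : sv q 0 α = 0 := by
  obtain ⟨k, hk⟩ := Function.ne_iff.1 hα
  rw [sv, monomial, Finset.prod_eq_zero (Finset.mem_univ k), mul_zero]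
  exact zero_zpow _ hk

theorem rootProd_zero (q : ℕ) (c : ℂ) (L : Finset (V → ℤ)) : rootProd Γ q c L 0 = 1 := by
  have h : ∀ γ : posRoots Γ, (1 + if (γ : V → ℤ) ∈ L then 0 else
      -(c * sv q (0 : V → ℂ) (γ : V → ℤ) ^ 2)) = 1 :=
    fun γ => by simp [sv_zero_left q γ.2.1.ne_zero]
  rw [rootProd, tprod_congr h, tprod_one]

/-- At the origin only the identity of the Weyl group contributes. -/
theorem numerator_zero {word : (coxeterMatrix Γ).Group → List V} (hw : IsReducedWords word) :
    numerator q word 0 = 1 := by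
  rw [numerator, tsum_eq_single 1]
  · have h1 := (hw 1).1.eq
    rw [(hw 1).2, CoxeterSystem.length_one] at h1
    rw [List.eq_nil_of_length_eq_zero h1.symm]
    simp [termNum, slashNum, rootProd_zero]
  · intro w hne
    have hnil : word w ≠ [] := fun h => hne (by rw [← (hw w).2, h, CoxeterSystem.wordProd_nil])
    obtain ⟨ω, i, h⟩ := (List.eq_nil_or_concat (word w)).resolve_left hnil
    have h0 : sv q (0 : V → ℂ) (Pi.single i 1) = 0 := sv_zero_left q (by simp)
    rw [termNum, h, List.concat_eq_append, slashNum_concat, h0]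
    simp [numEven, numOdd]

/-! ### The functional equation -/

theorem IsGoodDomain.functionalEquation (hU : IsGoodDomain Γ q U) (hq : 1 < q)
    {word : (coxeterMatrix Γ).Group → List V} (hw : IsReducedWords word) {G : (V → ℂ) → ℂ}
    (hG : DifferentiableOn ℂ G U)
    (hNG : ∀ x ∈ U, numerator q word x = rootProd Γ q 1 ∅ x * G x) {r₀ : ℝ} (hr₀ : 0 < r₀)
    {c : (V → ℕ) → ℂ} (hc : ∀ x : V → ℂ, (∀ k, ‖x k‖ < r₀) →
      HasSum (fun a => c a * ∏ k, x k ^ a k) (G x / rootProd Γ q q ∅ x)) (i : V) :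
    FunctionalEquation Γ q (seriesOf c) i := by
  have hq0 : 0 < q := by omega
  have hqR : (1 : ℝ) < q := by exact_mod_cast hq
  obtain ⟨δ, hδ, hP⟩ := hU.exists_polydisc hq0 i (ρ := 2) two_pos
  have hPi : ∀ x : V → ℂ, ‖x i‖ ≤ 2 → (∀ j, j ≠ i → ‖x j‖ ≤ δ) →
      rootProd Γ q q {Pi.single i 1} x ≠ 0 := fun x h1 h2 =>
    hU.rootProd_ne_zero _ _ (hP x h1 h2).1 fun γ hγ hγi =>
      (hP x h1 h2).2 γ hγ (by simpa using hγi)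
  have hsingle : ∀ γ ∈ ({Pi.single i 1} : Finset (V → ℤ)), γ ∈ posRoots Γ := by
    simpa using single_mem_posRoots Γ i
  refine functionalEquation_of_normCoeff hq0 c i fun a => recurrence_normCoeff hq i hδ hr₀
    (H := fun x => G x / rootProd Γ q q {Pi.single i 1} x)
    (F := fun x => G x / rootProd Γ q q ∅ x) ?_ hc (fun x hx => ?_) (fun x hx hxi hxj s hs => ?_) a
  · have hb : ∀ x ∈ {x : V → ℂ | ∀ k, ‖x k‖ < if k = i then 2 else δ},
        ‖x i‖ ≤ 2 ∧ ∀ j, j ≠ i → ‖x j‖ ≤ δ := fun x hx =>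
      ⟨by simpa using (hx i).le, fun j hj => by simpa [hj] using (hx j).le⟩
    have hsub : {x : V → ℂ | ∀ k, ‖x k‖ < if k = i then 2 else δ} ⊆ U := fun x hx =>
      (hP x (hb x hx).1 (hb x hx).2).1
    simp only [div_eq_mul_inv]
    exact (hG.mono hsub).mul (((hU.differentiableOn_rootProd _ _).mono hsub).fun_inv fun x hx =>
      hPi x (hb x hx).1 (hb x hx).2)
  · have hxi : ‖x i‖ < (q : ℝ)⁻¹ := by simpa using hx i
    have hxj : ∀ j, j ≠ i → ‖x j‖ ≤ δ := fun j hj => by simpa [hj] using (hx j).le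
    have hqi : (q : ℝ)⁻¹ < 1 := inv_lt_one_of_one_lt₀ hqR
    have hx2 : ‖x i‖ ≤ 2 := by linarith
    have h1 := hPi x hx2 hxj
    have h2 := hU.rootProd_mul_prod q hsingle (hP x hx2 hxj).1
    rw [Finset.prod_singleton, sv_single hq0] at h2
    have h3 : 1 - q * (sqrtq q * x i) ^ 2 ≠ 0 := fun h0 => by
      have h4 : (q : ℂ) ^ 2 * x i ^ 2 = 1 := by
        have := sqrtq_sq q
        linear_combination -h0 - (q : ℂ) * x i ^ 2 * this
      have h5 := congr_arg norm h4
      rw [norm_mul, norm_pow, norm_pow, Complex.norm_natCast, norm_one, ← mul_pow] at h5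
      have h6 : (q : ℝ) * ‖x i‖ < 1 := by
        rw [← mul_inv_cancel₀ (by positivity : (q : ℝ) ≠ 0)]
        gcongr
      have h7 : 0 ≤ (q : ℝ) * ‖x i‖ := by positivity
      nlinarith
    rw [← h2, div_mul_eq_div_div, mul_div_cancel₀ _ h3]
  · have hx2 : ‖x i‖ ≤ 2 := by linarith
    have h1 := hPi x hx2 fun j hj => (hxj j hj).le
    have h2 := quotient_sigma hU hq0 hw hG hNG i (hP x hx2 fun j hj => (hxj j hj).le).1 hx
    rw [sv_single hq0, ← hs] at h2
    rw [rootProd_epsilon, rootProd_single_sigma hq0 _ i hx]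
    field_simp
    linear_combination 2 * h2

end

/-! ### The average on a good domain -/

section

open Function Filter

variable {V : Type*} [Fintype V] [DecidableEq V] {Γ : SimpleGraph V} [DecidableRel Γ.Adj]
  {q : ℕ} {U : Set (V → ℂ)}

omit [DecidableEq V] in
theorem convergesNearZero_seriesOf {F : (V → ℂ) → ℂ} {c : (V → ℕ) → ℂ} {r : ℝ} (hr : 0 < r)
    (hc : ∀ x : V → ℂ, (∀ k, ‖x k‖ < r) → HasSum (fun a => c a * ∏ k, x k ^ a k) (F x)) :
    ConvergesNearZero (seriesOf c) F :=
  ⟨r, hr, fun x hx =>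
    (Finsupp.equivFunOnFinite : (V →₀ ℕ) ≃ (V → ℕ)).hasSum_iff.2 (hc x hx)⟩

omit [DecidableEq V] in
theorem constantCoeff_seriesOf {F : (V → ℂ) → ℂ} {c : (V → ℕ) → ℂ}
    (hc : HasSum (fun a => c a * ∏ k, (0 : V → ℂ) k ^ a k) (F 0)) :
    MvPowerSeries.constantCoeff (seriesOf c) = F 0 := by
  refine HasSum.unique ?_ hc
  have h : c 0 * ∏ k, (0 : V → ℂ) k ^ (0 : V → ℕ) k = MvPowerSeries.constantCoeff (seriesOf c) := by
    simp [← MvPowerSeries.coeff_zero_eq_constantCoeff_apply, coeff_seriesOf]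
  rw [← h]
  refine hasSum_single 0 fun a ha => ?_
  obtain ⟨k, hk⟩ := Function.ne_iff.1 ha
  rw [Finset.prod_eq_zero (Finset.mem_univ k), mul_zero]
  simpa using hk

theorem IsGoodDomain.zero_mem [Nonempty V] (hU : IsGoodDomain Γ q U) : (0 : V → ℂ) ∈ U := by
  have h := hU.single_mem (Classical.arbitrary V) 0
  rwa [Pi.single_zero] at h

/-- The Taylor series at the origin, where `D = 1`. -/
theorem IsGoodDomain.exists_series [Nonempty V] (hU : IsGoodDomain Γ q U) {G : (V → ℂ) → ℂ}
    (hG : DifferentiableOn ℂ G U) : ∃ r > 0, ∃ c : (V → ℕ) → ℂ, ∀ x : V → ℂ, (∀ k, ‖x k‖ < r) →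
      HasSum (fun a => c a * ∏ k, x k ^ a k) (G x / rootProd Γ q q ∅ x) := by
  have hD := hU.differentiableOn_rootProd q ∅
  have hopen : IsOpen (U ∩ rootProd Γ q q ∅ ⁻¹' {0}ᶜ) :=
    hD.continuousOn.isOpen_inter_preimage hU.isOpen isOpen_compl_singleton
  obtain ⟨ε, hε, hball⟩ := Metric.isOpen_iff.1 hopen 0
    ⟨hU.zero_mem, by simp [rootProd_zero]⟩
  have hsub : ∀ x : V → ℂ, (∀ k, ‖x k‖ < ε) → x ∈ U ∧ rootProd Γ q q ∅ x ≠ 0 := fun x hx =>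
    hball (by rwa [mem_ball_zero_iff, pi_norm_lt_iff hε])
  obtain ⟨c, hc⟩ := exists_hasSum_of_differentiableOn (R := fun _ : V => ε / 2)
    (R' := fun _ => ε) (f := fun x => G x / rootProd Γ q q ∅ x) (fun _ => by positivity)
    (fun _ => by linarith) (by
      simp only [div_eq_mul_inv]
      exact (hG.mono fun x hx => (hsub x hx).1).mul
        ((hD.mono fun x hx => (hsub x hx).1).fun_inv fun x hx => (hsub x hx).2))
  exact ⟨ε / 2, by positivity, c, hc⟩

theorem IsGoodDomain.isMeromorphicOn (hU : IsGoodDomain Γ q U) (hq : 0 < q) {G : (V → ℂ) → ℂ}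
    (hG : DifferentiableOn ℂ G U) : IsMeromorphicOn (fun x => G x / rootProd Γ q q ∅ x) U := by
  intro p hp
  refine ⟨U, hU.isOpen, hp, G, rootProd Γ q q ∅, hG, hU.differentiableOn_rootProd q ∅, fun h => ?_,
    fun _ _ _ => rfl⟩
  obtain ⟨x, hx, hx0, hxU⟩ := (dense_regularSet (Γ := Γ) hq).inter_nhds_nonempty
    (h.and (hU.isOpen.mem_nhds hp))
  exact (hU.rootProd_ne_zero_of_regular hxU hx).1 hx0

theorem IsGoodDomain.isAverage (hU : IsGoodDomain Γ q U) (hq : 0 < q)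
    {word : (coxeterMatrix Γ).Group → List V} (hw : IsReducedWords word) {G : (V → ℂ) → ℂ}
    (hNG : ∀ x ∈ U, numerator q word x = rootProd Γ q 1 ∅ x * G x) :
    IsAverage Γ q U fun x => G x / rootProd Γ q q ∅ x := by
  intro x hxU hx hD hΔ word' hw'
  simp only [weylD_eq Γ hq, weylDelta_eq] at hD hΔ ⊢
  have h := hasSum_average hU hq hw' hxU hx hD hΔ
  rw [numerator_congr hU hq hw' hw hxU, hNG x hxU] at h
  convert h using 1
  field_simp

/-- The power series, its continuation, and the properties of both, on any good domain. -/
theorem IsGoodDomain.exists_average [Nonempty V] (hU : IsGoodDomain Γ q U) (hq : 1 < q) :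
    ∃ (Z : MvPowerSeries V ℂ) (F : (V → ℂ) → ℂ),
      MvPowerSeries.constantCoeff Z = 1 ∧
      (∀ i, FunctionalEquation Γ q Z i) ∧
      ConvergesNearZero Z F ∧
      IsMeromorphicOn F U ∧
      IsAverage Γ q U F ∧
      (∀ x ∈ U, Summable (fun α : posRoots Γ => ‖factorD q x α - 1‖)) ∧
      (∀ x ∈ U, Summable (fun α : posRoots Γ => ‖factorDelta q x α - 1‖)) ∧
      DifferentiableOn ℂ (weylD Γ q) U ∧
      DifferentiableOn ℂ (weylDelta Γ q) U ∧
      (∃ G : (V → ℂ) → ℂ, DifferentiableOn ℂ G U ∧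
        ∀ x ∈ U, weylD Γ q x ≠ 0 → F x = G x / weylD Γ q x) := by
  have hq0 : 0 < q := by omega
  obtain ⟨word, hw⟩ := exists_isReducedWords Γ
  obtain ⟨G, hG, hNG⟩ := exists_numerator_eq_delta_mul hU hq hw
  obtain ⟨r, hr, c, hc⟩ := hU.exists_series hG
  have hDeq : weylD Γ q = rootProd Γ q q ∅ := funext (weylD_eq Γ hq0)
  have hΔeq : weylDelta Γ q = rootProd Γ q 1 ∅ := funext (weylDelta_eq Γ q)
  have hsum : ∀ c : ℂ, ∀ x ∈ U, Summable fun γ : posRoots Γ => ‖c * sv q x γ ^ 2‖ :=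
    fun c x hx => by
      simpa using hU.summable_rootFactor c ∅ hx
  refine ⟨seriesOf c, fun x => G x / rootProd Γ q q ∅ x, ?_,
    fun i => hU.functionalEquation hq hw hG hNG hr hc i,
    convergesNearZero_seriesOf hr hc, hU.isMeromorphicOn hq0 hG, hU.isAverage hq0 hw hNG,
    fun x hx => ?_, fun x hx => ?_, ?_, ?_, G, hG, fun x _ _ => by rw [hDeq]⟩
  · rw [constantCoeff_seriesOf (F := fun x => G x / rootProd Γ q q ∅ x) (hc 0 (by simpa using hr))]
    have h := hNG 0 hU.zero_mem
    rw [numerator_zero hw, rootProd_zero, one_mul] at h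
    rw [← h, rootProd_zero, div_one]
  · refine (hsum q x hx).congr fun γ => ?_
    rw [factorD_eq hq0, sub_sub_cancel_left, norm_neg]
  · refine (hsum 1 x hx).congr fun γ => ?_
    rw [factorDelta_eq, sub_sub_cancel_left, norm_neg, one_mul]
  · rw [hDeq]; exact hU.differentiableOn_rootProd _ _
  · rw [hΔeq]; exact hU.differentiableOn_rootProd _ _

end

end WeylSeries


end
open WeylSeries

theorem proposition3p2 {V : Type*} [Fintype V] [DecidableEq V]
    (Γ : SimpleGraph V) [DecidableRel Γ.Adj] (hΓ : IsFiniteType Γ ∨ IsAffineType Γ)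
    (q : ℕ) (hq : IsPrimePow q) (hq4 : q % 4 = 1) :
    ∃ (U : Set (V → ℂ)) (Z : MvPowerSeries V ℂ) (F : (V → ℂ) → ℂ),
      -- the domain
      (IsFiniteType Γ → U = Set.univ) ∧
      (IsAffineType Γ → ∃ α₀ : V → ℤ, IsLeast (invariantVectors Γ) α₀ ∧
        U = {x | ‖monomial x α₀‖ < (q : ℝ) ^ (-(height α₀ : ℝ) / 2)}) ∧
      -- the power series and its functional equations
      MvPowerSeries.constantCoeff Z = 1 ∧
      (∀ i, FunctionalEquation Γ q Z i) ∧
      -- it has the meromorphic continuation `F` to the domain, which is the average over `W`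
      ConvergesNearZero Z F ∧
      IsMeromorphicOn F U ∧
      IsAverage Γ q U F ∧
      -- the denominators converge absolutely and are holomorphic, and `D * Z` is holomorphic
      (∀ x ∈ U, Summable (fun α : posRoots Γ => ‖factorD q x α - 1‖)) ∧
      (∀ x ∈ U, Summable (fun α : posRoots Γ => ‖factorDelta q x α - 1‖)) ∧
      DifferentiableOn ℂ (weylD Γ q) U ∧
      DifferentiableOn ℂ (weylDelta Γ q) U ∧
      (∃ G : (V → ℂ) → ℂ, DifferentiableOn ℂ G U ∧
        ∀ x ∈ U, weylD Γ q x ≠ 0 → F x = G x / weylD Γ q x) := by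
  have hq1 : 1 < q := hq.one_lt
  have hexcl : IsFiniteType Γ → IsAffineType Γ → False := fun h h' => h.2.det_pos.ne' h'.2.2
  rcases hΓ with h | h
  · have := h.1.nonempty
    obtain ⟨Z, F, hZF⟩ := (isGoodDomain_of_isFiniteType Γ h (q := q)).exists_average hq1
    exact ⟨Set.univ, Z, F, fun _ => rfl, fun h' => (hexcl h h').elim, hZF⟩
  · have := h.1.nonempty
    obtain ⟨δ, hδ⟩ := exists_isLeast_invariantVectors h
    have hU := isGoodDomain_of_isAffineType h (q := q) (by omega) hδ.1
    simp only [norm_sv_lt_one_iff (q := q) (by omega)] at hU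
    obtain ⟨Z, F, hZF⟩ := hU.exists_average hq1
    exact ⟨_, Z, F, fun h' => (hexcl h' h).elim, fun _ => ⟨δ, hδ, rfl⟩, hZF⟩
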